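/- Let $\mathbf{k}$ be an algebraically closed field of characteristic $p>2$. A quantization of a Poisson $\mathbf{k}$-algebra $B$ is an associative, topologically free $\mathbf{k}[[\hbar]]$-algebra $A$ with an identification $A/\hbar A=B$ such that $\{a \bmod \hbar,\, b \bmod \hbar\}=\frac{1}{\hbar}[a,b] \bmod \hbar$ for all $a,b\in A$. It is called weakly central if for every $a\in A$ there is $a^{[p]}\in A$ with $a^p-\hbar^{p-1}a^{[p]}$ in the center $Z(A)$. A symplectic leaf of an affine Poisson variety $X=\operatorname{Spec} B$ is a maximal locally closed connected subvariety $Y\subset X$ such that the ideal $I(\overline{Y})$ is a Poisson ideal and $Y$ is a smooth symplectic variety under the induced Poisson bracket. Let $\overline{W_{n,\hbar}}$ be the complete Weyl algebra, that is, the completion of the $\mathbf{k}[[\hbar]]$-algebra with generators $x_1,\dots,x_n,y_1,\dots,y_n$ and relations $[x_i,x_j]=[y_i,y_j]=0$, $[x_i,y_j]=\hbar\delta_{ij}$ at the two-sided ideal $(\hbar,x_1,\dots,x_n,y_1,\dots,y_n)$. Theorem. Let $B$ be a finitely generated commutative Poisson $\mathbf{k}$-algebra, let $A$ be a weakly central quantization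 of $B$ with quotient map $\rho:A\to A/\hbar A=B$, let $y\in X=\operatorname{Spec} B$ be a closed point with maximal ideal $m_y$, and suppose that $y$ lies on a symplectic leaf $Y$ of $X$ with $\dim Y=2n$. Let $A_{\bar y}=\varprojlim_N A/\rho^{-1}(m_y)^N$ be the completion of $A$ at the two-sided ideal $\rho^{-1}(m_y)$. Then there are a complete local Poisson $\mathbf{k}$-algebra $L$ (a local $\mathbf{k}$-algebra with a Poisson bracket, complete and separated in the topology of its maximal ideal, whose maximal ideal is a Poisson ideal), a weakly central quantization $A^+$ of $L$, and a $Z(\overline{W_{n,\hbar}})$-algebra structure on $A^+$ compatible with its $\mathbf{k}[[\hbar]]$-algebra structure, such that $$A_{\bar y}\;\cong\;\overline{W_{n,\hbar}}\otimes_{Z(\overline{W_{n,\hbar}})}A^+$$ as $\mathbf{k}[[\hbar]]$-algebras. -/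

import Mathlib

open scoped PowerSeries TensorProduct
universe u v w

/-! ### Poisson algebras -/

/-- A `k`-linear Poisson bracket on a commutative `k`-algebra `B`. The value `br a` is the
derivation `{a, -}`, so the Leibniz rule is part of the type. -/
structure PoissonBracket (k B : Type*) [CommRing k] [CommRing B] [Algebra k B] where
  br : B →ₗ[k] Derivation k B B
  self : ∀ a, br a a = 0
  jacobi : ∀ a b c, br a (br b c) + br b (br c a) + br c (br a b) = 0

namespace PoissonBracket

section

variable {k B : Type*} [CommRing k] [CommRing B] [Algebra k B] (P : PoissonBracket k B)

theorem skew (a b : B) : P.br a b = -P.br b a := by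
  have h := P.self (a + b)
  simp only [map_add, Derivation.add_apply, P.self, zero_add, add_zero] at h
  exact eq_neg_of_add_eq_zero_right h

/-- A Poisson ideal is an ideal stable under all derivations `{a, -}`. -/
def IsPoissonIdeal (I : Ideal B) : Prop :=
  ∀ a : B, ∀ b ∈ I, P.br a b ∈ I

/-- The derivation of `B ⧸ I` induced by `{a, -}`, for a Poisson ideal `I`. -/
def quotientDer (I : Ideal B) (hI : P.IsPoissonIdeal I) (a : B) :
    Derivation k (B ⧸ I) (B ⧸ I) :=
  Derivation.mk'
    ((I.restrictScalars k).mapQ (I.restrictScalars k) (P.br a).toLinearMap (fun b hb => hI a b hb))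
    (by
      intro x y
      obtain ⟨x, rfl⟩ := Ideal.Quotient.mk_surjective x
      obtain ⟨y, rfl⟩ := Ideal.Quotient.mk_surjective y
      change Ideal.Quotient.mk I (P.br a (x * y)) =
        Ideal.Quotient.mk I x * Ideal.Quotient.mk I (P.br a y) +
        Ideal.Quotient.mk I y * Ideal.Quotient.mk I (P.br a x)
      rw [Derivation.leibniz]
      simp)

theorem quotientDer_mk (I : Ideal B) (hI : P.IsPoissonIdeal I) (a b : B) :
    P.quotientDer I hI a (Ideal.Quotient.mk I b) = Ideal.Quotient.mk I (P.br a b) := rfl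

/-- The Poisson bracket induced on the quotient by a Poisson ideal:
`{a mod I, b mod I} = {a, b} mod I`. -/
def quotient (I : Ideal B) (hI : P.IsPoissonIdeal I) : PoissonBracket k (B ⧸ I) where
  br := (I.restrictScalars k).liftQ
    { toFun := P.quotientDer I hI
      map_add' := by
        intro a b
        ext x
        obtain ⟨x, rfl⟩ := Ideal.Quotient.mk_surjective x
        simp [quotientDer_mk]
      map_smul' := by
        intro c a
        ext x
        obtain ⟨x, rfl⟩ := Ideal.Quotient.mk_surjective x
        simp only [quotientDer_mk, map_smul, RingHom.id_apply, Derivation.smul_apply]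
        rfl }
    (by
      intro a ha
      rw [LinearMap.mem_ker]
      ext x
      obtain ⟨x, rfl⟩ := Ideal.Quotient.mk_surjective x
      change P.quotientDer I hI a (Ideal.Quotient.mk I x) = 0
      rw [quotientDer_mk, Ideal.Quotient.eq_zero_iff_mem, P.skew]
      exact I.neg_mem (hI x a ha))
  self := by
    intro a
    obtain ⟨a, rfl⟩ := Ideal.Quotient.mk_surjective a
    change Ideal.Quotient.mk I (P.br a a) = 0
    rw [P.self, map_zero]
  jacobi := by
    intro a b c
    obtain ⟨a, rfl⟩ := Ideal.Quotient.mk_surjective a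
    obtain ⟨b, rfl⟩ := Ideal.Quotient.mk_surjective b
    obtain ⟨c, rfl⟩ := Ideal.Quotient.mk_surjective c
    change Ideal.Quotient.mk I (P.br a (P.br b c)) + Ideal.Quotient.mk I (P.br b (P.br c a)) +
      Ideal.Quotient.mk I (P.br c (P.br a b)) = 0
    rw [← map_add, ← map_add, P.jacobi, map_zero]

theorem quotient_br_mk (I : Ideal B) (hI : P.IsPoissonIdeal I) (a b : B) :
    (P.quotient I hI).br (Ideal.Quotient.mk I a) (Ideal.Quotient.mk I b) =
      Ideal.Quotient.mk I (P.br a b) := rfl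

/-- The alternating form `(f, g) ↦ {f, g} mod 𝔪` on the cotangent space `𝔪 / 𝔪 ^ 2` at a
closed point is nondegenerate. -/
def IsNondegenerateAt (m : Ideal B) : Prop :=
  ∀ f ∈ m, (∀ g ∈ m, P.br f g ∈ m) → f ∈ m ^ 2

/-- `Y` is a locally closed connected subvariety of `Spec B` whose closure has a Poisson ideal
and which, with its reduced structure and the induced bracket, is a smooth symplectic variety.
With `C = B ⧸ I(Y)`, the variety `Y` is the open subset of `Spec C` of those primes whose
preimage in `B` lies in `Y`; smoothness is required at all these points, and nondegeneracy of the
Poisson bivector at all closed points among them. -/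
def IsSymplecticSubvariety (Y : Set (PrimeSpectrum B)) : Prop :=
  IsLocallyClosed Y ∧ IsConnected Y ∧
  ∃ hI : P.IsPoissonIdeal (PrimeSpectrum.vanishingIdeal Y),
    (∀ q : PrimeSpectrum (B ⧸ PrimeSpectrum.vanishingIdeal Y),
      PrimeSpectrum.comap (Ideal.Quotient.mk (PrimeSpectrum.vanishingIdeal Y)) q ∈ Y →
        Algebra.IsSmoothAt k q.asIdeal) ∧
    (∀ q : MaximalSpectrum (B ⧸ PrimeSpectrum.vanishingIdeal Y),
      PrimeSpectrum.comap (Ideal.Quotient.mk (PrimeSpectrum.vanishingIdeal Y))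
          q.toPrimeSpectrum ∈ Y →
        (P.quotient (PrimeSpectrum.vanishingIdeal Y) hI).IsNondegenerateAt q.asIdeal)

/-- A symplectic leaf: a maximal locally closed connected symplectic subvariety. -/
def IsSymplecticLeaf (Y : Set (PrimeSpectrum B)) : Prop :=
  Maximal P.IsSymplecticSubvariety Y

/-- A complete local Poisson algebra: the ring is local, complete and separated for the topology
of its maximal ideal, and the maximal ideal is a Poisson ideal. -/
structure IsCompleteLocal : Prop where
  isLocalRing : IsLocalRing B
  isAdicComplete : IsAdicComplete (IsLocalRing.maximalIdeal B) B
  isPoissonIdeal : P.IsPoissonIdeal (IsLocalRing.maximalIdeal B)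

end

end PoissonBracket

/-! ### Quantizations (the variable `X` of `k⟦X⟧` is `ħ`) -/

/-- A deformation quantization of the Poisson algebra `(B, P)`: an associative `k⟦ħ⟧`-algebra `A`
that is topologically free over `k⟦ħ⟧` (`ħ`-torsion free, `ħ`-adically complete and separated)
with an identification `A / ħ A = B` of `k`-algebras, given as a surjection `ρ : A → B` with
kernel `ħ A`, such that `{ρ a, ρ b} = ρ (ħ⁻¹ [a, b])`. -/
structure Quantization {k B : Type*} [Field k] [CommRing B] [Algebra k B]
    (P : PoissonBracket k B) (A : Type*) [Ring A] [Algebra k⟦X⟧ A] where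
  torsionFree : ∀ a : A, (PowerSeries.X : k⟦X⟧) • a = 0 → a = 0
  complete : IsAdicComplete (Ideal.span {(PowerSeries.X : k⟦X⟧)}) A
  ρ : A →+* B
  ρ_algebraMap : ∀ f : k⟦X⟧,
    ρ (algebraMap k⟦X⟧ A f) = algebraMap k B (PowerSeries.constantCoeff f)
  ρ_surjective : Function.Surjective ρ
  ρ_eq_zero_iff : ∀ a : A, ρ a = 0 ↔ ∃ c : A, a = (PowerSeries.X : k⟦X⟧) • c
  bracket : ∀ a b c : A, a * b - b * a = (PowerSeries.X : k⟦X⟧) • c → P.br (ρ a) (ρ b) = ρ c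

/-- The weak centrality condition on a `k⟦ħ⟧`-algebra in characteristic `p`: every `a` has some
`a'` such that `a ^ p - ħ ^ (p - 1) a'` is central. -/
def IsWeaklyCentral (p : ℕ) (k A : Type*) [Field k] [Ring A] [Algebra k⟦X⟧ A] : Prop :=
  ∀ a : A, ∃ a' : A, a ^ p - (PowerSeries.X : k⟦X⟧) ^ (p - 1) • a' ∈ Subring.center A

/-! ### Completion at a two-sided ideal -/

/-- The completion `lim A / J ^ n` of an `R`-algebra `A` at a two-sided ideal `J`, as the
subalgebra of compatible families in the product of all `A / J ^ n`. -/
def adicCompletionAlg (R : Type*) {A : Type*} [CommRing R] [Ring A] [Algebra R A]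
    (J : Ideal A) [J.IsTwoSided] : Subalgebra R (∀ n : ℕ, A ⧸ J ^ n) where
  carrier := {f | ∀ (m n : ℕ) (h : m ≤ n),
    Ideal.Quotient.factor (Ideal.pow_le_pow_right h) (f n) = f m}
  mul_mem' := by
    intro f g hf hg m n h
    rw [Pi.mul_apply, Pi.mul_apply, map_mul, hf m n h, hg m n h]
  add_mem' := by
    intro f g hf hg m n h
    rw [Pi.add_apply, Pi.add_apply, map_add, hf m n h, hg m n h]
  algebraMap_mem' := by
    intro r m n h
    rfl

/-! ### The complete Weyl algebra -/

noncomputable section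

variable (k : Type*) [Field k] (n : ℕ)

/-- The defining relations of the Weyl algebra over `k⟦ħ⟧`; the generators `x i` and `y i` are
indexed by `Sum.inl i` and `Sum.inr i`. -/
inductive WeylRel :
    FreeAlgebra k⟦X⟧ (Fin n ⊕ Fin n) → FreeAlgebra k⟦X⟧ (Fin n ⊕ Fin n) → Prop
  | xx (i j : Fin n) : WeylRel
      (FreeAlgebra.ι k⟦X⟧ (Sum.inl i) * FreeAlgebra.ι k⟦X⟧ (Sum.inl j))
      (FreeAlgebra.ι k⟦X⟧ (Sum.inl j) * FreeAlgebra.ι k⟦X⟧ (Sum.inl i))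
  | yy (i j : Fin n) : WeylRel
      (FreeAlgebra.ι k⟦X⟧ (Sum.inr i) * FreeAlgebra.ι k⟦X⟧ (Sum.inr j))
      (FreeAlgebra.ι k⟦X⟧ (Sum.inr j) * FreeAlgebra.ι k⟦X⟧ (Sum.inr i))
  | xy (i j : Fin n) : WeylRel
      (FreeAlgebra.ι k⟦X⟧ (Sum.inl i) * FreeAlgebra.ι k⟦X⟧ (Sum.inr j))
      (FreeAlgebra.ι k⟦X⟧ (Sum.inr j) * FreeAlgebra.ι k⟦X⟧ (Sum.inl i) +
        algebraMap k⟦X⟧ _ (if i = j then PowerSeries.X else 0))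

/-- The (uncompleted) Weyl algebra over `k⟦ħ⟧`. -/
def WeylAlg : Type _ := (ringConGen (WeylRel k n)).Quotient

instance : Ring (WeylAlg k n) :=
  inferInstanceAs (Ring (ringConGen (WeylRel k n)).Quotient)

instance : Algebra k⟦X⟧ (WeylAlg k n) :=
  inferInstanceAs (Algebra k⟦X⟧ (ringConGen (WeylRel k n)).Quotient)

/-- The generators of the Weyl algebra: `x i` and `y i` for `Sum.inl i` and `Sum.inr i`. -/
def weylGen (s : Fin n ⊕ Fin n) : WeylAlg k n :=
  (RingCon.toQuotient (FreeAlgebra.ι k⟦X⟧ s) : (ringConGen (WeylRel k n)).Quotient)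

/-- The two-sided ideal of the Weyl algebra generated by `ħ` and all `x i`, `y i`. -/
def weylIdeal : Ideal (WeylAlg k n) :=
  (TwoSidedIdeal.span
    (insert (algebraMap k⟦X⟧ (WeylAlg k n) PowerSeries.X) (Set.range (weylGen k n)))).asIdeal

instance : (weylIdeal k n).IsTwoSided :=
  inferInstanceAs (TwoSidedIdeal.asIdeal _).IsTwoSided

/-- The complete Weyl algebra `k⟦ħ⟧⟨⟨x₁, …, xₙ, y₁, …, yₙ⟩⟩` with `[x i, y j] = ħ δ i j` and
`[x i, x j] = [y i, y j] = 0`: the completion of the Weyl algebra over `k⟦ħ⟧` at the two-sided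
ideal generated by `ħ` and all `x i`, `y i`. Its reduction modulo `ħ` is the ring of formal power
series in the `x i`, `y i`. -/
def CompleteWeyl : Type _ := adicCompletionAlg k⟦X⟧ (weylIdeal k n)

instance : Ring (CompleteWeyl k n) :=
  inferInstanceAs (Ring (adicCompletionAlg k⟦X⟧ (weylIdeal k n)))

instance : Algebra k⟦X⟧ (CompleteWeyl k n) :=
  inferInstanceAs (Algebra k⟦X⟧ (adicCompletionAlg k⟦X⟧ (weylIdeal k n)))

end

/-- Any algebra is an algebra over its center. -/
instance centerAlgebra (R A : Type*) [CommRing R] [Ring A] [Algebra R A] :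
    Algebra (Subalgebra.center R A) A where
  algebraMap := (Subalgebra.center R A).val.toRingHom
  commutes' := fun r x => (Subalgebra.mem_center_iff.mp r.2 x).symm
  smul_def' := fun _ _ => rfl

/-! The theorem is a formal Darboux theorem in characteristic p, proved directly on the
quantization. Write {a, b} = ħ⁻¹[a, b], ad a = {a, ·}, and let χ be evaluation at the point.

Splitting off pairs. If {u, v} = 1 and u^p, v^p are central, then ad u and ad v are commuting
derivations with zero p-th power. Taylor expansion then makes the algebra free over the centralizer
of u and v, with basis the monomials u^i v^j, i, j < p (`IsDarboux.decomp`). The centralizer is a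
direct summand, so it inherits all properties needed to repeat the argument, while the form (a, b) ↦
χ{a, b} loses exactly rank 2 (`IsDarboux.finrank_range_residueForm`). From rank 2n one obtains n
commuting pairs and a centralizer A⁺ on which the form vanishes, so A⁺/ħA⁺ has a Poisson maximal
ideal. The complete Weyl algebra W maps to the algebra through these pairs. Since monomials with
exponents below p span W over its center Z, and their images form a basis over A⁺, the map from W
⊗_Z A⁺ is bijective.

Finding a pair (`IsLocalQuantum.exists_canonical_pair`). Weak centrality a^p = z + ħ^(p-1) h gives
(ad a)^p = ad h, so p^s-th powers of inner derivations are inner. For large s such a power is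
diagonalizable on a finite-dimensional quotient of the algebra, and an eigenvector that is a unit
yields {f, g} congruent to 1. Replacing f by f + g^(p-1) h cancels h to leading order, by Jacobson's
formula for (a + b)^p and Wilson's theorem; the limit of these corrections has a central p-th power.
Then (ad f)^p = 0, and the approximate partner of f can be replaced by an exact one.

Inputs. Generators of B vanishing at the point have p-th powers that lift to central elements of A.
These make A an algebra over S = k⟦ħ⟧[X₁, …, X_r], finite modulo ħ, and the required completion is
the adic one for 𝔫 = (ħ, X₁, …, X_r); Artin–Rees over S controls division by ħ. The initial rank is
2n because the form descends to a nondegenerate form on the cotangent space, at the point, of the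
closure of Y, and this space has dimension dim Y as Y is smooth and connected. -/

/-! ### Powers in noncommutative rings of characteristic `p` -/

section CharP

variable {R : Type*} [Ring R] (p : ℕ) [hp : Fact p.Prime] [CharP R p]

include hp in
theorem CharP.neg_one_pow_mul_choose_pred {i : ℕ} (hi : i ≤ p - 1) :
    (-1 : R) ^ i * ((p - 1).choose i : R) = 1 := by
  induction i with
  | zero => simp
  | succ i ih =>
    have h1 := ih (by omega)
    have h2 : ((p.choose (i + 1) : ℕ) : R) = 0 := by
      rw [CharP.cast_eq_zero_iff R p]
      exact hp.out.dvd_choose_self (by omega) (by have := hp.out.two_le; omega)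
    have h3 : p.choose (i + 1) = (p - 1).choose i + (p - 1).choose (i + 1) := by
      conv_lhs => rw [show p = (p - 1) + 1 by have := hp.out.two_le; omega]
      exact Nat.choose_succ_succ _ _
    rw [h3, Nat.cast_add] at h2
    rw [eq_neg_of_add_eq_zero_right h2, pow_succ, mul_neg_one, neg_mul_neg, h1]

include hp in
-- The signs of the binomial expansion cancel against C(p-1, i) ≡ (-1)^i; the parities of i and
-- p-1-i agree because p is odd. Applied to left and right multiplication by a, this turns the
-- (p-1)-st power of the commutator with a into the sum that differentiates the p-th power.
theorem Commute.sub_pow_pred_char (hp2 : 2 < p) {x y : R} (h : Commute x y) :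
    (x - y) ^ (p - 1) = ∑ i ∈ Finset.range p, x ^ i * y ^ (p - 1 - i) := by
  have hodd : Odd p := hp.out.odd_of_ne_two (by omega)
  rw [sub_eq_add_neg, (h.neg_right).add_pow, Nat.sub_add_cancel hp.out.one_le]
  refine Finset.sum_congr rfl fun i hi => ?_
  have hi' : i ≤ p - 1 := by have := Finset.mem_range.mp hi; omega
  have hpar : (-1 : R) ^ (p - 1 - i) = (-1) ^ i := by
    obtain ⟨m, hm⟩ := hodd
    rcases Nat.even_or_odd i with he | ho
    · rw [he.neg_one_pow, Even.neg_one_pow]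
      obtain ⟨c, hc⟩ := he
      exact ⟨m - c, by omega⟩
    · rw [ho.neg_one_pow, Odd.neg_one_pow]
      obtain ⟨c, hc⟩ := ho
      exact ⟨m - c - 1, by omega⟩
  rw [neg_pow, hpar, (Nat.cast_commute ((p - 1).choose i) ((-1) ^ i * y ^ (p - 1 - i))).eq.symm.trans
    ?_ |> fun e => (mul_assoc _ _ _).trans (congrArg (x ^ i * ·) e)]
  rw [← mul_assoc, (Nat.cast_commute ((p - 1).choose i) ((-1 : R) ^ i)).eq,
    CharP.neg_one_pow_mul_choose_pred p hi', one_mul]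

end CharP

/-! ### Iterated commutators and Jacobson's formula -/

section Commutator

variable {R : Type*} [Ring R]

/-- The additive endomorphism `b ↦ a * b - b * a`. -/
def commEnd (a : R) : Module.End ℤ R := LinearMap.mulLeft ℤ a - LinearMap.mulRight ℤ a

theorem commEnd_apply (a b : R) : commEnd a b = a * b - b * a := rfl

theorem commEnd_pow_pred_char (p : ℕ) [hp : Fact p.Prime] [CharP R p] (hp2 : 2 < p) (a b : R) :
    (commEnd a ^ (p - 1)) b = ∑ i ∈ Finset.range p, a ^ i * b * a ^ (p - 1 - i) := by
  have hc : CharP (Module.End ℤ R) p := by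
    refine ⟨fun n => ?_⟩
    rw [← CharP.cast_eq_zero_iff R p]
    constructor
    · intro h
      have := LinearMap.congr_fun h (1 : R)
      simpa using this
    · intro h
      ext x
      simp [h]
  rw [commEnd, Commute.sub_pow_pred_char p hp2 (LinearMap.commute_mulLeft_right a a),
    LinearMap.sum_apply]
  refine Finset.sum_congr rfl fun i _ => ?_
  rw [LinearMap.pow_mulLeft, LinearMap.pow_mulRight]
  simp [mul_assoc]

/-- Left and right multiplication commute, so Frobenius is additive on their difference. -/
theorem commEnd_pow_char (p : ℕ) [hp : Fact p.Prime] [CharP R p] (a b : R) :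
    (commEnd a ^ p) b = a ^ p * b - b * a ^ p := by
  have hc : CharP (Module.End ℤ R) p := by
    refine ⟨fun n => ?_⟩
    rw [← CharP.cast_eq_zero_iff R p]
    constructor
    · intro h
      have := LinearMap.congr_fun h (1 : R)
      simpa using this
    · intro h
      ext x
      simp [h]
  rw [commEnd, sub_pow_char_of_commute p (LinearMap.commute_mulLeft_right a a),
    LinearMap.pow_mulLeft, LinearMap.pow_mulRight]
  rfl

open Polynomial in
theorem Polynomial.derivative_pow_sum (q : R[X]) (n : ℕ) :
    derivative (q ^ n) = ∑ i ∈ Finset.range n, q ^ i * derivative q * q ^ (n - 1 - i) := by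
  induction n with
  | zero => simp
  | succ n ih =>
    rw [pow_succ, derivative_mul, ih, Finset.sum_range_succ, Finset.sum_mul]
    congr 1
    · refine Finset.sum_congr rfl fun i hi => ?_
      have := Finset.mem_range.mp hi
      rw [mul_assoc, ← pow_succ]
      congr 2
      omega
    · simp

open Polynomial in
/-- Jacobson's formula for `(a + b) ^ p`: the terms of degree `i + 1` in `b` are
`1 / (i + 1)` times the coefficients of `ad (a + T b) ^ (p - 1) b`. -/
theorem add_pow_char_eq_sum_coeff (p : ℕ) [hp : Fact p.Prime] [CharP R p] (hp2 : 2 < p)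
    (a b : R) : ∃ s : ℕ → R, (a + b) ^ p = a ^ p + b ^ p + ∑ i ∈ Finset.range (p - 1), s i ∧
      ∀ i, s i * (i + 1) = ((commEnd (C a + X * C b) ^ (p - 1)) (C b)).coeff i := by
  have hcp : CharP R[X] p := inferInstance
  set q : R[X] := C a + X * C b with hq
  -- The extreme coefficients of (a + T b)^p are a^p and b^p; the middle ones are the correction
  -- terms. Evaluation at T = 1 is multiplicative because 1 is central.
  refine ⟨fun i => (q ^ p).coeff (i + 1), ?_, ?_⟩
  · have hdeg1 : q.natDegree ≤ 1 := by
      rw [hq, X_mul_C]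
      compute_degree
    have hdeg : (q ^ p).natDegree < p + 1 :=
      lt_of_le_of_lt (natDegree_pow_le_of_le p hdeg1) (by omega)
    have hev : (q ^ p).eval 1 = (a + b) ^ p := by
      let e := Polynomial.eval₂RingHom' (RingHom.id R) 1 (fun r => Commute.one_right _)
      have he : ∀ r, e r = r.eval 1 := fun r => rfl
      rw [← he, map_pow, he]
      simp [hq, X_mul_C]
    rw [← hev, eval_eq_sum_range' hdeg, Finset.sum_range_succ]
    obtain ⟨m, hm⟩ : ∃ m, p = m + 1 := ⟨p - 1, by omega⟩
    have h0 : (q ^ p).coeff 0 = a ^ p := by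
      have := map_pow (Polynomial.constantCoeff (R := R)) q p
      simpa [hq, X_mul_C] using this
    have hp' : (q ^ p).coeff p = b ^ p := by
      have := coeff_pow_of_natDegree_le (m := p) hdeg1
      rw [mul_one] at this
      rw [this]
      congr 1
      simp [hq, X_mul_C, coeff_C]
    rw [hp']
    have : ∑ x ∈ Finset.range p, (q ^ p).coeff x * 1 ^ x =
        a ^ p + ∑ i ∈ Finset.range (p - 1), (q ^ p).coeff (i + 1) := by
      conv_lhs => rw [show Finset.range p = Finset.range (p - 1 + 1) by congr 1; omega]
      rw [Finset.sum_range_succ']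
      simp [h0, add_comm]
    rw [this]
    simp only [one_pow, mul_one]
    abel
  · intro i
    -- Both sides are coefficients of the T-derivative of q^p: it equals ∑ q^j q' q^(p-1-j) with q'
    -- = b, which is the (p-1)-fold commutator of q with b.
    rw [commEnd_pow_pred_char p hp2, ← coeff_derivative, Polynomial.derivative_pow_sum]
    congr 1
    refine Finset.sum_congr rfl fun j _ => ?_
    congr 2
    simp [hq, X_mul_C]

open Polynomial in
theorem coeff_commEnd_C_add_X_mul_C (a b : R) (r : R[X]) (i : ℕ) :
    (commEnd (C a + X * C b) r).coeff i = a * r.coeff i - r.coeff i * a +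
      (if i = 0 then 0 else b * r.coeff (i - 1) - r.coeff (i - 1) * b) := by
  have : commEnd (C a + X * C b) r = C a * r - r * C a + (C b * r - r * C b) * X := by
    rw [commEnd_apply]
    simp only [add_mul, mul_add, sub_mul, mul_assoc, X_mul]
    abel
  rw [this]
  cases i <;> simp [coeff_C_mul, coeff_mul_C]

end Commutator

/-! ### The filtration by powers of an ideal -/


/-- The submodules `𝔫 ^ N A`. -/
abbrev adicFil {S : Type*} [CommRing S] (𝔫 : Ideal S) (A : Type*) [AddCommGroup A] [Module S A]
    (N : ℕ) : Submodule S A := 𝔫 ^ N • ⊤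

section AdicFil

variable {S : Type*} [CommRing S] {𝔫 : Ideal S} {A : Type*} [AddCommGroup A] [Module S A]

theorem adicFil_anti (𝔫 : Ideal S) {M N : ℕ} (h : M ≤ N) : adicFil 𝔫 A N ≤ adicFil 𝔫 A M :=
  Submodule.smul_mono_left (Ideal.pow_le_pow_right h)

theorem smul_mem_adicFil {i : ℕ} {s : S} (hs : s ∈ 𝔫 ^ i) (a : A) : s • a ∈ adicFil 𝔫 A i :=
  Submodule.smul_mem_smul hs trivial

theorem adicFil_induction {i : ℕ} {P : A → Prop} (h : ∀ s ∈ 𝔫 ^ i, ∀ a, P (s • a))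
    (hadd : ∀ x ∈ adicFil 𝔫 A i, ∀ y ∈ adicFil 𝔫 A i, P x → P y → P (x + y))
    {a : A} (ha : a ∈ adicFil 𝔫 A i) : P a := by
  have : a ∈ adicFil 𝔫 A i ∧ P a := by
    refine Submodule.smul_induction_on ha (fun s hs a _ => ⟨smul_mem_adicFil hs a, h s hs a⟩) ?_
    rintro x y ⟨hx, hx'⟩ ⟨hy, hy'⟩
    exact ⟨add_mem hx hy, hadd x hx y hy hx' hy'⟩
  exact this.2

theorem smul_mem_adicFil_add {i j : ℕ} {s : S} (hs : s ∈ 𝔫 ^ i) {a : A} (ha : a ∈ adicFil 𝔫 A j) :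
    s • a ∈ adicFil 𝔫 A (i + j) := by
  refine adicFil_induction (P := fun a => s • a ∈ adicFil 𝔫 A (i + j)) ?_ ?_ ha
  · intro t ht b
    rw [← mul_smul]
    exact smul_mem_adicFil (pow_add 𝔫 i j ▸ Ideal.mul_mem_mul hs ht) b
  · intro x _ y _ hx hy
    rw [smul_add]; exact add_mem hx hy

theorem adicFil_map {B : Type*} [AddCommGroup B] [Module S B] (f : A →ₗ[S] B) {i : ℕ} {a : A}
    (ha : a ∈ adicFil 𝔫 A i) : f a ∈ adicFil 𝔫 B i := by
  have : (adicFil 𝔫 A i).map f ≤ adicFil 𝔫 B i := by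
    rw [Submodule.map_smul'']
    exact Submodule.smul_mono le_rfl le_top
  exact this ⟨a, ha, rfl⟩

end AdicFil

/-! ### Almost commutative algebras and their bracket -/

/-- The `S`-algebra `A` has no `ħ`-torsion and all commutators are divisible by `ħ`. -/
class AlmostComm {S : Type*} [CommRing S] (ħ : S) (A : Type*) [Ring A] [Algebra S A] : Prop where
  torsionFree : ∀ a : A, ħ • a = 0 → a = 0
  exists_comm : ∀ a b : A, ∃ c : A, a * b - b * a = ħ • c

section Bracket

variable {S : Type*} [CommRing S] (ħ : S) {A : Type*} [Ring A] [Algebra S A] [AlmostComm ħ A]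

theorem AlmostComm.cancel {a b : A} (h : ħ • a = ħ • b) : a = b := by
  refine sub_eq_zero.mp (AlmostComm.torsionFree (ħ := ħ) _ ?_)
  rw [smul_sub, h, sub_self]

theorem AlmostComm.cancel_pow (n : ℕ) {a b : A} (h : ħ ^ n • a = ħ ^ n • b) : a = b := by
  induction n with
  | zero => simpa using h
  | succ n ih =>
    rw [pow_succ', mul_smul, mul_smul] at h
    exact ih (AlmostComm.cancel ħ h)

/-- The bracket `ħ⁻¹ [a, b]`. -/
noncomputable def hbr (a b : A) : A := (AlmostComm.exists_comm (ħ := ħ) a b).choose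

theorem smul_hbr (a b : A) : ħ • hbr ħ a b = a * b - b * a :=
  (AlmostComm.exists_comm (ħ := ħ) a b).choose_spec.symm

variable {ħ} in
theorem hbr_unique {a b c : A} (h : a * b - b * a = ħ • c) : hbr ħ a b = c :=
  AlmostComm.cancel ħ ((smul_hbr ħ a b).trans h)

theorem hbr_eq_zero_iff {a b : A} : hbr ħ a b = 0 ↔ Commute a b := by
  constructor
  · intro h
    have := smul_hbr ħ a b
    rw [h, smul_zero] at this
    exact (sub_eq_zero.mp this.symm)
  · intro h
    exact hbr_unique (by rw [h.eq, sub_self, smul_zero])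

theorem hbr_self (a : A) : hbr ħ a a = 0 := (hbr_eq_zero_iff ħ).mpr (Commute.refl a)

theorem hbr_add_right (a b c : A) : hbr ħ a (b + c) = hbr ħ a b + hbr ħ a c :=
  hbr_unique (by rw [smul_add, smul_hbr, smul_hbr]; noncomm_ring)

theorem hbr_skew (a b : A) : hbr ħ a b = -hbr ħ b a :=
  hbr_unique (by rw [smul_neg, smul_hbr]; noncomm_ring)

theorem hbr_smul_right (s : S) (a b : A) : hbr ħ a (s • b) = s • hbr ħ a b :=
  hbr_unique (by rw [smul_comm, smul_hbr, smul_sub, mul_smul_comm, smul_mul_assoc])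

theorem hbr_mul_right (a b c : A) : hbr ħ a (b * c) = b * hbr ħ a c + hbr ħ a b * c :=
  hbr_unique (by
    rw [smul_add, ← mul_smul_comm, ← smul_mul_assoc, smul_hbr, smul_hbr]; noncomm_ring)

/-- The `S`-linear derivation `b ↦ ħ⁻¹ [a, b]`. -/
noncomputable def adh (a : A) : Module.End S A where
  toFun := hbr ħ a
  map_add' := hbr_add_right ħ a
  map_smul' s b := hbr_smul_right ħ s a b

theorem adh_apply (a b : A) : adh ħ a b = hbr ħ a b := rfl

theorem hbr_add_left (a b c : A) : hbr ħ (a + b) c = hbr ħ a c + hbr ħ b c := by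
  rw [hbr_skew, hbr_add_right, neg_add, ← hbr_skew, ← hbr_skew]

theorem hbr_smul_left (s : S) (a b : A) : hbr ħ (s • a) b = s • hbr ħ a b := by
  rw [hbr_skew, hbr_smul_right, ← smul_neg, ← hbr_skew]

theorem hbr_zero_right (a : A) : hbr ħ a 0 = 0 := (adh ħ a).map_zero
theorem hbr_neg_right (a b : A) : hbr ħ a (-b) = -hbr ħ a b := (adh ħ a).map_neg b
theorem hbr_sub_right (a b c : A) : hbr ħ a (b - c) = hbr ħ a b - hbr ħ a c :=
  (adh ħ a).map_sub b c
theorem hbr_neg_left (a b : A) : hbr ħ (-a) b = -hbr ħ a b := by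
  rw [hbr_skew, hbr_neg_right, ← hbr_skew]
theorem hbr_sub_left (a b c : A) : hbr ħ (a - b) c = hbr ħ a c - hbr ħ b c := by
  rw [sub_eq_add_neg, hbr_add_left, hbr_neg_left, ← sub_eq_add_neg]

theorem hbr_mul_left (a b c : A) : hbr ħ (a * b) c = a * hbr ħ b c + hbr ħ a c * b := by
  rw [hbr_skew, hbr_mul_right, hbr_skew ħ c b, hbr_skew ħ c a]; noncomm_ring

theorem hbr_center {z : A} (hz : z ∈ Subring.center A) (a : A) : hbr ħ a z = 0 :=
  (hbr_eq_zero_iff ħ).mpr (Subring.mem_center_iff.mp hz a)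

theorem center_hbr {z : A} (hz : z ∈ Subring.center A) (a : A) : hbr ħ z a = 0 := by
  rw [hbr_skew, hbr_center ħ hz, neg_zero]

theorem hbr_one_right (a : A) : hbr ħ a 1 = 0 := (hbr_eq_zero_iff ħ).mpr (Commute.one_right a)

theorem hbr_jacobi (a b c : A) :
    hbr ħ a (hbr ħ b c) = hbr ħ (hbr ħ a b) c + hbr ħ b (hbr ħ a c) := by
  refine AlmostComm.cancel ħ (AlmostComm.cancel ħ ?_)
  simp only [smul_add]
  rw [← hbr_smul_right, smul_hbr, smul_hbr, ← hbr_smul_left ħ ħ (hbr ħ a b), smul_hbr, smul_hbr,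
    ← hbr_smul_right ħ ħ b, smul_hbr, smul_hbr]
  noncomm_ring

theorem commEnd_pow_smul_adh (a b : A) (n : ℕ) :
    (commEnd a ^ n) b = ħ ^ n • (adh ħ a ^ n) b := by
  induction n with
  | zero => simp
  | succ n ih =>
    rw [pow_succ' (commEnd a), Module.End.mul_apply, ih, pow_succ' (adh ħ a), Module.End.mul_apply,
      adh_apply, commEnd_apply, pow_succ', mul_smul, smul_comm ħ, smul_hbr, mul_smul_comm, smul_mul_assoc, ← smul_sub]

/-- The commutator with a^p is ħ^p (ad a)^p. It is also ħ^(p-1) times the commutator with h, that is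
ħ^p ad h. Cancelling ħ^p shows that h acts as a restricted p-th power of a. -/
theorem adh_pow_char (p : ℕ) [hp : Fact p.Prime] [CharP A p] {a z h : A}
    (hz : z ∈ Subring.center A) (ha : a ^ p = z + ħ ^ (p - 1) • h) :
    adh ħ a ^ p = adh ħ h := by
  ext b
  refine AlmostComm.cancel_pow ħ p ?_
  rw [← commEnd_pow_smul_adh, commEnd_pow_char, ha, adh_apply]
  obtain ⟨m, rfl⟩ : ∃ m, p = m + 1 := ⟨p - 1, by have := hp.out.one_le; omega⟩
  rw [pow_succ, mul_smul, smul_hbr, add_mul, mul_add, Subring.mem_center_iff.mp hz b, smul_sub]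
  simp

/-- Both a^p and z commute with a, hence so does ħ^(p-1) h, and ħ is not a zero divisor. -/
theorem hbr_self_of_pow_eq (p : ℕ) {a z h : A} (hz : z ∈ Subring.center A)
    (ha : a ^ p = z + ħ ^ (p - 1) • h) : hbr ħ a h = 0 := by
  refine AlmostComm.cancel_pow ħ (p - 1) ?_
  rw [← hbr_smul_right, ← sub_eq_of_eq_add' ha, hbr_sub_right, hbr_center ħ hz, smul_zero, sub_zero]
  exact (hbr_eq_zero_iff ħ).mpr (Commute.self_pow a p)

/-- The part of Jacobson's formula of degree at least two in `b` lies in any submodule that is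
stable under brackets and contains all `{b, {a, …, {a, b}}}`. -/
theorem add_pow_char_hbr (p : ℕ) [hp : Fact p.Prime] [CharP A p] (hp2 : 2 < p) (a b : A)
    (N : Submodule S A) (hN : ∀ x, ∀ r ∈ N, hbr ħ x r ∈ N)
    (h : ∀ j, hbr ħ b ((adh ħ a ^ j) b) ∈ N) :
    ∃ r ∈ N, (a + b) ^ p = a ^ p + b ^ p + ħ ^ (p - 1) • ((adh ħ a ^ (p - 1)) b + r) := by
  -- After division by ħ^m, the constant coefficient of the m-fold commutator of a + T b with b is
  -- (ad a)^m b. Every higher coefficient comes from lower stages by brackets with a or b, and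
  -- enters N for the first time as {b, (ad a)^j b}.
  have key : ∀ m : ℕ, ∃ ω : ℕ → A, ω 0 = (adh ħ a ^ m) b ∧ (∀ i, ω (i + 1) ∈ N) ∧
      ∀ i, ((commEnd (Polynomial.C a + Polynomial.X * Polynomial.C b) ^ m)
        (Polynomial.C b)).coeff i = ħ ^ m • ω i := by
    intro m
    induction m with
    | zero =>
      refine ⟨fun i => if i = 0 then b else 0, by simp, by simp, fun i => ?_⟩
      simp [Polynomial.coeff_C]
    | succ m ih =>
      obtain ⟨ω, h0, h1, h2⟩ := ih
      refine ⟨fun i => hbr ħ a (ω i) + (if i = 0 then 0 else hbr ħ b (ω (i - 1))), ?_, ?_, ?_⟩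
      · simp [h0, pow_succ', adh_apply]
      · intro i
        simp only [Nat.add_eq_zero_iff, one_ne_zero, and_false, if_false, Nat.add_sub_cancel]
        refine N.add_mem (hN _ _ (h1 i)) ?_
        cases i with
        | zero => rw [h0]; exact h m
        | succ i => exact hN _ _ (h1 i)
      · intro i
        rw [pow_succ', Module.End.mul_apply, coeff_commEnd_C_add_X_mul_C, h2, h2, pow_succ, mul_smul,
          smul_add, smul_add, smul_hbr]
        congr 1
        · rw [smul_sub, mul_smul_comm, smul_mul_assoc]
        · split_ifs
          · simp
          · rw [smul_hbr, smul_sub, mul_smul_comm, smul_mul_assoc]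
  obtain ⟨s, hs, hs'⟩ := add_pow_char_eq_sum_coeff p hp2 a b
  obtain ⟨ω, h0, h1, h2⟩ := key (p - 1)
  -- The factor i + 1 < p of Jacobson's formula is invertible modulo p; u is an integer inverse of
  -- it.
  have hinv : ∀ i < p - 1, ∃ u : ℕ, s i = ħ ^ (p - 1) • (u • ω i) := by
    intro i hi
    have hcop : Nat.Coprime (i + 1) p :=
      (Nat.Coprime.symm ((Nat.Prime.coprime_iff_not_dvd hp.out).mpr
        (Nat.not_dvd_of_pos_of_lt (by omega) (by omega))))
    obtain ⟨u, -, hu⟩ := Nat.exists_mul_mod_eq_one_of_coprime hcop (by omega)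
    refine ⟨u, ?_⟩
    have h1 : ((i : A) + 1) * u = 1 := by
      have h3 := (CharP.cast_eq_mod A p ((i + 1) * u))
      rw [hu] at h3
      simpa using h3
    have h4 := hs' i
    rw [h2] at h4
    calc s i = s i * (((i : A) + 1) * u) := by rw [h1, mul_one]
      _ = (ħ ^ (p - 1) • ω i) * u := by rw [← mul_assoc, h4]
      _ = _ := by rw [smul_mul_assoc, ← (Nat.cast_commute u _).eq, nsmul_eq_mul]
  choose! t ht using hinv
  refine ⟨∑ i ∈ Finset.range (p - 2), t (i + 1) • ω (i + 1),
    N.sum_mem fun i _ => N.smul_of_tower_mem _ (h1 i), ?_⟩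
  rw [hs, Finset.sum_congr rfl (fun i hi => ht i (Finset.mem_range.mp hi)), ← Finset.smul_sum]
  congr 2
  obtain ⟨m, hm⟩ : ∃ m, p = m + 2 := ⟨p - 2, by omega⟩
  rw [show p - 1 = (p - 2) + 1 by omega, Finset.sum_range_succ', add_comm]
  congr 1
  have h5 : s 0 = ω 0 * ħ ^ (p - 1) • (1 : A) := by
    have h4 := hs' 0
    rw [h2] at h4
    simpa using h4
  have h6 : ħ ^ (p - 1) • (t 0 • ω 0) = ħ ^ (p - 1) • ω 0 := by
    rw [← ht 0 (by omega), h5, mul_smul_comm, mul_one]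
  rw [AlmostComm.cancel_pow ħ (p - 1) h6, h0, show p - 1 = (p - 2) + 1 by omega]

/-! ### The filtration by powers of an ideal of central elements -/

section Filtration

variable (𝔫 : Ideal S)
omit [AlmostComm ħ A] in
variable {𝔫} in
theorem mul_mem_adicFil {i j : ℕ} {a b : A} (ha : a ∈ adicFil 𝔫 A i) (hb : b ∈ adicFil 𝔫 A j) :
    a * b ∈ adicFil 𝔫 A (i + j) := by
  refine adicFil_induction (P := fun a => a * b ∈ adicFil 𝔫 A (i + j)) ?_ ?_ ha
  · intro s hs c
    rw [smul_mul_assoc]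
    exact smul_mem_adicFil_add hs (adicFil_map (LinearMap.mulLeft S c) hb)
  · intro x _ y _ hx hy
    rw [add_mul]; exact add_mem hx hy

omit [AlmostComm ħ A] in
variable {𝔫} in
theorem mul_mem_adicFil_left {i : ℕ} {a : A} (b : A) (ha : a ∈ adicFil 𝔫 A i) :
    a * b ∈ adicFil 𝔫 A i := adicFil_map (LinearMap.mulRight S b) ha

omit [AlmostComm ħ A] in
variable {𝔫} in
theorem mul_mem_adicFil_right {i : ℕ} (a : A) {b : A} (hb : b ∈ adicFil 𝔫 A i) :
    a * b ∈ adicFil 𝔫 A i := adicFil_map (LinearMap.mulLeft S a) hb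

variable {𝔫} in
theorem hbr_mem_adicFil_right {i : ℕ} (a : A) {b : A} (hb : b ∈ adicFil 𝔫 A i) :
    hbr ħ a b ∈ adicFil 𝔫 A i := adicFil_map (adh ħ a) hb

variable {𝔫} in
theorem hbr_mem_adicFil_left {i : ℕ} {a : A} (b : A) (ha : a ∈ adicFil 𝔫 A i) :
    hbr ħ a b ∈ adicFil 𝔫 A i := by
  rw [hbr_skew]; exact neg_mem (hbr_mem_adicFil_right ħ b ha)

variable {𝔫} in
theorem hbr_mem_adicFil {i j : ℕ} {a b : A} (ha : a ∈ adicFil 𝔫 A i) (hb : b ∈ adicFil 𝔫 A j) :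
    hbr ħ a b ∈ adicFil 𝔫 A (i + j) := by
  refine adicFil_induction (P := fun a => hbr ħ a b ∈ adicFil 𝔫 A (i + j)) ?_ ?_ ha
  · intro s hs c
    rw [hbr_smul_left]
    exact smul_mem_adicFil_add hs (hbr_mem_adicFil_right ħ c hb)
  · intro x _ y _ hx hy
    rw [hbr_add_left]; exact add_mem hx hy

omit [AlmostComm ħ A] in
variable {𝔫} in
theorem sub_mem_adicFil_pow {i : ℕ} {a b : A} (h : a - b ∈ adicFil 𝔫 A i) (n : ℕ) :
    a ^ n - b ^ n ∈ adicFil 𝔫 A i := by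
  induction n with
  | zero => simp
  | succ n ih =>
    have : a ^ (n + 1) - b ^ (n + 1) = (a ^ n - b ^ n) * a + b ^ n * (a - b) := by
      rw [pow_succ, pow_succ]; noncomm_ring
    rw [this]
    exact add_mem (mul_mem_adicFil_left _ ih) (mul_mem_adicFil_right _ h)

omit [AlmostComm ħ A] in
theorem smul_mem_center (s : S) {z : A} (hz : z ∈ Subring.center A) :
    s • z ∈ Subring.center A := by
  rw [Subring.mem_center_iff] at hz ⊢
  intro g
  rw [mul_smul_comm, hz, smul_mul_assoc]

/-- Elements that are central up to `ħ ^ (p - 1) 𝔫 ^ N A`. -/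
def NearlyCentral (p N : ℕ) (a : A) : Prop :=
  ∃ z ∈ Subring.center A, ∃ r ∈ adicFil 𝔫 A N, a = z + ħ ^ (p - 1) • r

variable {ħ 𝔫}

omit [AlmostComm ħ A] in
theorem NearlyCentral.add {p N : ℕ} {a b : A} (ha : NearlyCentral ħ 𝔫 p N a)
    (hb : NearlyCentral ħ 𝔫 p N b) : NearlyCentral ħ 𝔫 p N (a + b) := by
  obtain ⟨z, hz, r, hr, rfl⟩ := ha
  obtain ⟨z', hz', r', hr', rfl⟩ := hb
  exact ⟨z + z', add_mem hz hz', r + r', add_mem hr hr', by rw [smul_add]; abel⟩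

omit [AlmostComm ħ A] in
theorem NearlyCentral.smul {p N : ℕ} {a : A} (s : S) (ha : NearlyCentral ħ 𝔫 p N a) :
    NearlyCentral ħ 𝔫 p N (s • a) := by
  obtain ⟨z, hz, r, hr, rfl⟩ := ha
  exact ⟨s • z, smul_mem_center s hz, s • r, Submodule.smul_mem _ _ hr, by
    rw [smul_add, smul_comm]⟩

omit [AlmostComm ħ A] in
theorem nearlyCentral_smul {p N : ℕ} {r : A} (hr : r ∈ adicFil 𝔫 A N) :
    NearlyCentral ħ 𝔫 p N (ħ ^ (p - 1) • r) := ⟨0, zero_mem _, r, hr, by simp⟩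

omit [AlmostComm ħ A] in
theorem nearlyCentral_center {p N : ℕ} {z : A} (hz : z ∈ Subring.center A) :
    NearlyCentral ħ 𝔫 p N z := ⟨z, hz, 0, zero_mem _, by simp⟩

theorem add_pow_char_adicFil (p : ℕ) [hp : Fact p.Prime] [CharP A p] (hp2 : 2 < p) {a b : A} {M : ℕ}
    (h : ∀ j, hbr ħ b ((adh ħ a ^ j) b) ∈ adicFil 𝔫 A M) :
    ∃ r ∈ adicFil 𝔫 A M,
      (a + b) ^ p = a ^ p + b ^ p + ħ ^ (p - 1) • ((adh ħ a ^ (p - 1)) b + r) :=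
  add_pow_char_hbr ħ p hp2 a b _ (fun x _ hr => hbr_mem_adicFil_right ħ x hr) h

theorem adh_pow_mem_adicFil {i : ℕ} (a : A) {b : A} (hb : b ∈ adicFil 𝔫 A i) (j : ℕ) :
    (adh ħ a ^ j) b ∈ adicFil 𝔫 A i := adicFil_map _ hb

/-- Every correction term of Jacobson's formula is an iterated bracket containing {a, b}; this
includes the linear term (ad a)^(p-1) b, since p - 1 ≥ 1. -/
theorem NearlyCentral.add_pow (p : ℕ) [hp : Fact p.Prime] [CharP A p] (hp2 : 2 < p) {a b : A}
    {M : ℕ} (hab : hbr ħ a b ∈ adicFil 𝔫 A M) (ha : NearlyCentral ħ 𝔫 p M (a ^ p))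
    (hb : NearlyCentral ħ 𝔫 p M (b ^ p)) : NearlyCentral ħ 𝔫 p M ((a + b) ^ p) := by
  have h1 : ∀ j, (adh ħ a ^ (j + 1)) b ∈ adicFil 𝔫 A M := by
    intro j
    rw [pow_succ, Module.End.mul_apply]
    exact adh_pow_mem_adicFil a hab j
  obtain ⟨r, hr, h⟩ := add_pow_char_adicFil (𝔫 := 𝔫) (ħ := ħ) (M := M) p hp2 (a := a) (b := b)
    (fun j => by
      cases j with
      | zero => simp [hbr_self]
      | succ j => exact hbr_mem_adicFil_right ħ b (h1 j))
  rw [h]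
  refine (ha.add hb).add (nearlyCentral_smul (add_mem ?_ hr))
  rw [show p - 1 = (p - 2) + 1 by omega]
  exact h1 _

/-- On s a with s ∈ 𝔫^N, the p-th power multiplies the error by s^p ∈ 𝔫^(Np), and Np ≥ N + 1. Sums
are harmless because brackets of two elements of 𝔫^N A lie in 𝔫^(2N) A. -/
theorem nearlyCentral_pow_of_mem (p : ℕ) [hp : Fact p.Prime] [CharP A p] (hp2 : 2 < p)
    (hwc : ∀ a : A, NearlyCentral ħ 𝔫 p 0 (a ^ p)) {N : ℕ} (hN : 1 ≤ N) {e : A}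
    (he : e ∈ adicFil 𝔫 A N) : NearlyCentral ħ 𝔫 p (N + 1) (e ^ p) := by
  refine adicFil_induction (P := fun e => NearlyCentral ħ 𝔫 p (N + 1) (e ^ p)) ?_ ?_ he
  · intro s hs a
    obtain ⟨z, hz, r, -, h⟩ := hwc a
    rw [_root_.smul_pow, h, smul_add, smul_comm]
    refine (nearlyCentral_center (smul_mem_center _ hz)).add (nearlyCentral_smul ?_)
    refine adicFil_anti 𝔫 ?_ (smul_mem_adicFil (i := N * p) (by rw [pow_mul]; exact Ideal.pow_mem_pow hs p) r)
    nlinarith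
  · intro x hx y hy h1 h2
    refine NearlyCentral.add_pow p hp2 ?_ h1 h2
    exact adicFil_anti 𝔫 (by omega) (hbr_mem_adicFil ħ hx hy)

end Filtration

end Bracket

/-! ### Complete local quantum algebras -/

theorem exists_dependent_seq {α : Type*} (P : ℕ → α → Prop) (R : ℕ → α → α → Prop) {a : α}
    (h0 : P 0 a) (hs : ∀ n a, P n a → ∃ b, P (n + 1) b ∧ R n a b) :
    ∃ f : ℕ → α, f 0 = a ∧ (∀ n, P n (f n)) ∧ ∀ n, R n (f n) (f (n + 1)) := by
  choose! g hg using hs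
  let F : ℕ → α := fun n => Nat.rec a (fun n b => g n b) n
  have hF : ∀ n, P n (F n) := by
    intro n
    induction n with
    | zero => exact h0
    | succ n ih => exact (hg n _ ih).1
  exact ⟨F, rfl, hF, fun n => (hg n _ (hF n)).2⟩

section Limits

variable {S : Type*} [CommRing S] {𝔫 : Ideal S} {A : Type*} [AddCommGroup A] [Module S A]

theorem adicFil_seq_sub {f : ℕ → A} (hf : ∀ n, f (n + 1) - f n ∈ adicFil 𝔫 A n) {m n : ℕ}
    (h : m ≤ n) : f n - f m ∈ adicFil 𝔫 A m := by
  induction n, h using Nat.le_induction with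
  | base => simp
  | succ n hmn ih =>
    have := add_mem (Submodule.smul_mono_left (Ideal.pow_le_pow_right hmn) (hf n)) ih
    simpa using this

theorem IsAdicComplete.exists_limit (hc : IsAdicComplete 𝔫 A) {f : ℕ → A}
    (hf : ∀ n, f (n + 1) - f n ∈ adicFil 𝔫 A n) : ∃ L, ∀ n, L - f n ∈ adicFil 𝔫 A n := by
  obtain ⟨L, hL⟩ := hc.prec' f (fun {m n} h => by
    rw [SModEq.comm, SModEq.sub_mem]
    exact adicFil_seq_sub hf h)
  refine ⟨L, fun n => ?_⟩
  have := (hL n).symm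
  rwa [SModEq.sub_mem] at this

theorem IsAdicComplete.eq_zero_of_mem (hc : IsAdicComplete 𝔫 A) {a : A}
    (ha : ∀ n, a ∈ adicFil 𝔫 A n) : a = 0 :=
  hc.haus' a fun n => by rw [SModEq.sub_mem, sub_zero]; exact ha n

theorem IsAdicComplete.eq_of_sub_mem (hc : IsAdicComplete 𝔫 A) {a b : A}
    (ha : ∀ n, a - b ∈ adicFil 𝔫 A n) : a = b :=
  sub_eq_zero.mp (hc.eq_zero_of_mem ha)

theorem IsAdicComplete.isUnit_one_sub {A : Type*} [Ring A] [Algebra S A]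
    (hc : IsAdicComplete 𝔫 A) {t : A} (ht : t ∈ adicFil 𝔫 A 1) : IsUnit (1 - t) := by
  have hpow : ∀ n, t ^ n ∈ adicFil 𝔫 A n := by
    intro n
    induction n with
    | zero => simp [adicFil]
    | succ n ih => rw [pow_succ]; exact mul_mem_adicFil ih ht
  obtain ⟨L, hL⟩ := hc.exists_limit (f := fun n => ∑ i ∈ Finset.range n, t ^ i)
    (fun n => by simpa [Finset.sum_range_succ] using hpow n)
  refine ⟨⟨1 - t, L, ?_, ?_⟩, rfl⟩
  · refine hc.eq_of_sub_mem fun n => ?_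
    have h1 := mul_mem_adicFil_right (1 - t) (hL n)
    rw [mul_sub, mul_neg_geom_sum] at h1
    have := sub_mem h1 (hpow n)
    convert this using 1
    abel
  · refine hc.eq_of_sub_mem fun n => ?_
    have h1 := mul_mem_adicFil_left (1 - t) (hL n)
    rw [sub_mul, geom_sum_mul_neg] at h1
    have := sub_mem h1 (hpow n)
    convert this using 1
    abel

end Limits

/-- A local `S`-algebra with residue character `χ`, complete for the central ideal `𝔫`, in which
`ħ` behaves as the deformation parameter of a weakly central quantization. -/
structure IsLocalQuantum (p : ℕ) {k S : Type*} [Field k] [CommRing S] [Algebra k S] (ħ : S)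
    (𝔫 : Ideal S) {A : Type*} [Ring A] [Algebra S A] [Algebra k A] [IsScalarTower k S A]
    (χ : A →ₐ[k] k) : Prop where
  ħ_mem : ħ ∈ 𝔫
  χ_smul : ∀ s ∈ 𝔫, ∀ a, χ (s • a) = 0
  complete : IsAdicComplete 𝔫 A
  artinRees : ∀ N, ∃ M, ∀ a : A, ħ • a ∈ adicFil 𝔫 A M → a ∈ adicFil 𝔫 A N
  exists_comm : ∀ a b : A, ∃ c : A, a * b - b * a = ħ • c
  weaklyCentral : ∀ a : A, NearlyCentral ħ 𝔫 p 0 (a ^ p)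
  pow_mem : ∀ a, χ a = 0 → a ^ p ∈ adicFil 𝔫 A 1
  finite : Module.Finite k (A ⧸ adicFil 𝔫 A 1)

namespace IsLocalQuantum

variable {p : ℕ} {k S : Type*} [Field k] [CommRing S] [Algebra k S] {ħ : S}
    {𝔫 : Ideal S} {A : Type*} [Ring A] [Algebra S A] [Algebra k A] [IsScalarTower k S A]
    {χ : A →ₐ[k] k}

/-- An element killed by ħ has ħ-multiple in every 𝔫^M A, so the Artin–Rees condition puts it in
every 𝔫^N A, and A is separated. -/
theorem almostComm (H : IsLocalQuantum p ħ 𝔫 χ) : AlmostComm ħ A where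
  torsionFree a ha := H.complete.eq_zero_of_mem fun N => by
    obtain ⟨M, hM⟩ := H.artinRees N
    exact hM a (by rw [ha]; exact zero_mem _)
  exists_comm := H.exists_comm

theorem χ_adicFil (H : IsLocalQuantum p ħ 𝔫 χ) {N : ℕ} (hN : 1 ≤ N) {a : A}
    (ha : a ∈ adicFil 𝔫 A N) : χ a = 0 := by
  refine adicFil_induction (P := fun a => χ a = 0) ?_ ?_ (adicFil_anti 𝔫 hN ha)
  · intro s hs a
    exact H.χ_smul s (by simpa using hs) a
  · intro x _ y _ hx hy
    rw [map_add, hx, hy, add_zero]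

theorem nontrivial (χ : A →ₐ[k] k) : Nontrivial A := χ.toRingHom.domain_nontrivial

theorem charP (χ : A →ₐ[k] k) [CharP k p] : CharP A p :=
  have := nontrivial χ
  charP_of_injective_algebraMap (algebraMap k A).injective p

/-- After scaling, a = 1 - m with χ(m) = 0. Then m^p ∈ 𝔫A, so 1 - m^p is a unit by the geometric
series, and 1 - m is a factor of it with a commuting cofactor. -/
theorem isUnit (H : IsLocalQuantum p ħ 𝔫 χ) {a : A} (ha : χ a ≠ 0) : IsUnit a := by
  set m : A := 1 - (χ a)⁻¹ • a with hm
  have h1 : χ m = 0 := by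
    rw [hm, map_sub, map_one, map_smul, smul_eq_mul, inv_mul_cancel₀ ha, sub_self]
  have h2 := H.complete.isUnit_one_sub (H.pow_mem m h1)
  have h3 : IsUnit (1 - m) := by
    rw [← mul_neg_geom_sum m p] at h2
    have hcomm : Commute (1 - m) (∑ i ∈ Finset.range p, m ^ i) := by
      unfold Commute SemiconjBy
      rw [mul_neg_geom_sum, geom_sum_mul_neg]
    exact ((hcomm.isUnit_mul_iff).mp h2).1
  rw [hm, sub_sub_cancel] at h3
  have h4 : a = algebraMap k A (χ a) * ((χ a)⁻¹ • a) := by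
    rw [← Algebra.smul_def, smul_smul, mul_inv_cancel₀ ha, one_smul]
  rw [h4]
  exact ((isUnit_iff_ne_zero.mpr ha).map (algebraMap k A)).mul h3

/-- Write u^p = z + ħ^(p-1) r. Since u^p ∈ 𝔫A, also z ∈ 𝔫A, and after squaring each error term
carries a factor z or ħ. This gains one order in 𝔫 without assuming u ∈ 𝔫A. -/
theorem nearlyCentral_mul_self (H : IsLocalQuantum p ħ 𝔫 χ) (hp2 : 2 < p) {u : A} (hu : χ u = 0) :
    NearlyCentral ħ 𝔫 p 1 ((u * u) ^ p) := by
  obtain ⟨z, hz, r, -, h⟩ := H.weaklyCentral u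
  have hħ : ∀ (m : ℕ) (a : A), 1 ≤ m → ħ ^ m • a ∈ adicFil 𝔫 A 1 := fun m a hm =>
    adicFil_anti 𝔫 hm (smul_mem_adicFil (Ideal.pow_mem_pow H.ħ_mem m) a)
  have hz1 : z ∈ adicFil 𝔫 A 1 := by
    have := sub_mem (H.pow_mem u hu) (hħ (p - 1) r (by omega))
    rwa [h, add_sub_cancel_right] at this
  have h2 : (u * u) ^ p = z * z + ħ ^ (p - 1) • (z * r + r * z + ħ ^ (p - 1) • (r * r)) := by
    rw [(Commute.refl u).mul_pow, h]
    simp only [smul_add, add_mul, mul_add, smul_mul_assoc, mul_smul_comm]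
    abel
  rw [h2]
  refine (nearlyCentral_center (mul_mem hz hz)).add (nearlyCentral_smul ?_)
  exact add_mem (add_mem (mul_mem_adicFil_left _ hz1) (mul_mem_adicFil_right _ hz1))
    (hħ _ _ (by omega))

variable [AlmostComm ħ A]

/-- Polarization reduces to squares: uv = ¼((u+v)² - (u-v)²) + ½ħ{u, v}. All brackets between the
summands lie in 𝔫A, so their p-th powers add up to the required order. -/
theorem nearlyCentral_mul (H : IsLocalQuantum p ħ 𝔫 χ) [hp : Fact p.Prime] [CharP k p]
    (hp2 : 2 < p) {u v : A}
    (hu : χ u = 0) (hv : χ v = 0) (huv : hbr ħ u v ∈ adicFil 𝔫 A 1) :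
    NearlyCentral ħ 𝔫 p 1 ((u * v) ^ p) := by
  have := charP (p := p) χ
  have h2 : (2 : k) ≠ 0 := by
    intro h
    have : ((2 : ℕ) : k) = 0 := by exact_mod_cast h
    rw [CharP.cast_eq_zero_iff k p] at this
    exact absurd (Nat.le_of_dvd (by norm_num) this) (by omega)
  set s := u + v with hs
  set d := u - v with hd
  set q : S := algebraMap k S (4⁻¹) with hq
  have hsd : hbr ħ s d ∈ adicFil 𝔫 A 1 := by
    rw [hs, hd, hbr_add_left, hbr_sub_right, hbr_sub_right, hbr_self, hbr_self]
    exact add_mem (sub_mem (zero_mem _) huv)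
      (sub_mem (by rw [hbr_skew]; exact neg_mem huv) (zero_mem _))
  have hsd2 : hbr ħ (s * s) (d * d) ∈ adicFil 𝔫 A 1 := by
    have h3 : hbr ħ s (d * d) ∈ adicFil 𝔫 A 1 := by
      rw [hbr_mul_right]
      exact add_mem (mul_mem_adicFil_right _ hsd) (mul_mem_adicFil_left _ hsd)
    rw [hbr_mul_left]
    exact add_mem (mul_mem_adicFil_right _ h3) (mul_mem_adicFil_left _ h3)
  have hc : ħ • ((algebraMap k S 2⁻¹) • hbr ħ u v) ∈ adicFil 𝔫 A 1 :=
    smul_mem_adicFil (by simpa using H.ħ_mem) _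
  have huv' : u * v = (q • (s * s) + (-q) • (d * d)) +
      ħ • ((algebraMap k S 2⁻¹) • hbr ħ u v) := by
    rw [smul_comm, smul_hbr, hq, ← map_neg, algebraMap_smul, algebraMap_smul, algebraMap_smul]
    have h4 : (4 : k) ≠ 0 := by
      have : (4 : k) = 2 * 2 := by norm_num
      rw [this]; exact mul_ne_zero h2 h2
    have h5 : (2⁻¹ : k) = 4⁻¹ * 2 := by field_simp; norm_num
    have h6 : (4⁻¹ : k) • ((4 : k) • (u * v)) = u * v := by
      rw [smul_smul, inv_mul_cancel₀ h4, one_smul]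
    rw [h5, mul_smul, neg_smul, ← smul_neg, ← smul_add, ← smul_add]
    conv_lhs => rw [← h6]
    congr 1
    rw [show (4 : k) = ((4 : ℕ) : k) by norm_num, show (2 : k) = ((2 : ℕ) : k) by norm_num,
      Nat.cast_smul_eq_nsmul, Nat.cast_smul_eq_nsmul, hs, hd]
    noncomm_ring
  have hsq : ∀ t : A, χ t = 0 → ∀ q : S, NearlyCentral ħ 𝔫 p 1 ((q • (t * t)) ^ p) := by
    intro t ht q
    rw [_root_.smul_pow]
    exact (H.nearlyCentral_mul_self hp2 ht).smul _
  rw [huv']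
  refine NearlyCentral.add_pow p hp2 (hbr_mem_adicFil_right ħ _ hc) ?_ ?_
  · refine NearlyCentral.add_pow p hp2 ?_ (hsq s (by simp [hs, hu, hv]) _)
      (hsq d (by simp [hd, hu, hv]) _)
    rw [hbr_smul_left, hbr_smul_right]
    exact Submodule.smul_mem _ _ (Submodule.smul_mem _ _ hsd2)
  · rw [_root_.smul_pow]
    obtain ⟨m, hm⟩ : ∃ m, p = m + 1 := ⟨p - 1, by omega⟩
    have : ħ ^ p • ((algebraMap k S 2⁻¹) • hbr ħ u v) ^ p =
        ħ ^ (p - 1) • (ħ • ((algebraMap k S 2⁻¹) • hbr ħ u v) ^ p) := by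
      rw [smul_smul, ← pow_succ]; congr 2; omega
    rw [this]
    exact nearlyCentral_smul (smul_mem_adicFil (by simpa using H.ħ_mem) _)

omit [Algebra k S] [Algebra k A] [IsScalarTower k S A] in
theorem hbr_pow_sub_mem {f g : A} (h : hbr ħ f g - 1 ∈ adicFil 𝔫 A 1) (n : ℕ) :
    hbr ħ f (g ^ (n + 1)) - (n + 1) • g ^ n ∈ adicFil 𝔫 A 1 := by
  induction n with
  | zero => simpa using h
  | succ n ih =>
    have : hbr ħ f (g ^ (n + 1 + 1)) - (n + 1 + 1) • g ^ (n + 1) =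
        g ^ (n + 1) * (hbr ħ f g - 1) + (hbr ħ f (g ^ (n + 1)) - (n + 1) • g ^ n) * g := by
      rw [pow_succ g (n + 1), hbr_mul_right, add_smul, sub_mul, smul_mul_assoc, ← pow_succ]
      noncomm_ring
    rw [this]
    exact add_mem (mul_mem_adicFil_right _ h) (mul_mem_adicFil_left _ ih)

omit [Algebra k S] [Algebra k A] [IsScalarTower k S A] in
-- Modulo 𝔫A, ad f acts on powers of g as d/dg; 𝔫A is stable under ad f, so the error does not
-- spread.
theorem adh_pow_pow_sub_mem {f g : A} (h : hbr ħ f g - 1 ∈ adicFil 𝔫 A 1) (n j : ℕ) (hj : j ≤ n) :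
    (adh ħ f ^ j) (g ^ n) - (n.descFactorial j) • g ^ (n - j) ∈ adicFil 𝔫 A 1 := by
  induction j with
  | zero => simp
  | succ j ih =>
    have h1 := adicFil_map (adh ħ f) (ih (by omega))
    have h2 := hbr_pow_sub_mem h (n - (j + 1))
    rw [map_sub, map_nsmul, ← Module.End.mul_apply, ← pow_succ', adh_apply] at h1
    have h3 := add_mem h1 (Submodule.smul_of_tower_mem _ (n.descFactorial j) h2)
    convert h3 using 1
    rw [show n - (j + 1) + 1 = n - j by omega, smul_sub, smul_smul, Nat.descFactorial_succ, mul_comm]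
    abel

omit [Algebra k S] [Algebra k A] [IsScalarTower k S A] in
theorem adh_pow_mul_of_hbr_eq_zero {f h : A} (hh : hbr ħ f h = 0) (t : A) (j : ℕ) :
    (adh ħ f ^ j) (t * h) = (adh ħ f ^ j) t * h := by
  induction j generalizing t with
  | zero => simp
  | succ j ih =>
    rw [pow_succ, Module.End.mul_apply, Module.End.mul_apply, adh_apply, hbr_mul_right, hh, mul_zero,
      zero_add, ih, adh_apply]

omit [Algebra k S] [Algebra k A] [IsScalarTower k S A] in
theorem hbr_pow_self_left (g : A) (n : ℕ) : hbr ħ (g ^ n) g = 0 :=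
  (hbr_eq_zero_iff ħ).mpr (Commute.pow_self g n)

theorem descFactorial_pred_self (p : ℕ) [hp : Fact p.Prime] (R : Type*) [Ring R] [CharP R p] :
    (((p - 1).descFactorial (p - 1) : ℕ) : R) = -1 := by
  rw [Nat.descFactorial_self]
  have h := ZMod.wilsons_lemma p
  have h2 : ((((p - 1).factorial + 1 : ℕ)) : ZMod p) = 0 := by push_cast; rw [h]; ring
  rw [ZMod.natCast_eq_zero_iff] at h2
  have h3 := (CharP.cast_eq_zero_iff R p _).mpr h2
  push_cast at h3
  exact eq_neg_of_add_eq_zero_left h3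

omit [AlmostComm ħ A] in
-- The normalization χ(h) = 0 matters only for N = 0, where the scalar χ(h) is moved into the
-- central part. For N ≥ 1 it is automatic.
theorem exists_pow_eq (H : IsLocalQuantum p ħ 𝔫 χ) {N : ℕ} {f : A}
    (hf : NearlyCentral ħ 𝔫 p N (f ^ p)) :
    ∃ z ∈ Subring.center A, ∃ h ∈ adicFil 𝔫 A N, χ h = 0 ∧ f ^ p = z + ħ ^ (p - 1) • h := by
  obtain ⟨z, hz, h, hh, e⟩ := hf
  rcases Nat.eq_zero_or_pos N with rfl | hN
  · refine ⟨z + ħ ^ (p - 1) • algebraMap k A (χ h),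
      add_mem hz (smul_mem_center _ (Subring.mem_center_iff.mpr fun g =>
        (Algebra.commutes (χ h) g).symm)), h - algebraMap k A (χ h), by simp [adicFil], ?_, ?_⟩
    · simp
    · rw [e, smul_sub]; abel
  · exact ⟨z, hz, h, hh, H.χ_adicFil hN hh, e⟩

/-- One step of the correction that makes the `p`-th power of `f` central: replace `f` by
`f + g ^ (p - 1) h` where `f ^ p = z + ħ ^ (p - 1) h` with `z` central. -/
theorem straighten_step (H : IsLocalQuantum p ħ 𝔫 χ) [hp : Fact p.Prime] [CharP k p]
    (hp2 : 2 < p) {f g : A} {N : ℕ} (hf : χ f = 0) (hg : χ g = 0)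
    (hfg : hbr ħ f g - 1 ∈ adicFil 𝔫 A 1) (hN : NearlyCentral ħ 𝔫 p N (f ^ p)) :
    ∃ f' : A, f' - f ∈ adicFil 𝔫 A N ∧ χ f' = 0 ∧ hbr ħ f' g - 1 ∈ adicFil 𝔫 A 1 ∧
      (hbr ħ f g = 1 → hbr ħ f' g = 1) ∧ NearlyCentral ħ 𝔫 p (N + 1) (f' ^ p) := by
  have := charP (p := p) χ
  obtain ⟨z, hz, h, hh, hχ, e⟩ := H.exists_pow_eq hN
  have hD : adh ħ f ^ p = adh ħ h := adh_pow_char ħ p hz e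
  have hfh : hbr ħ f h = 0 := hbr_self_of_pow_eq ħ p hz e
  -- Here {h, g} = (ad f)^p g = (ad f)^(p-1) {f, g}, and the constant 1 may be subtracted because ad
  -- f kills it. Hence {h, g} lies in 𝔫A and vanishes when {f, g} = 1 exactly, so the correction
  -- preserves an exact relation.
  have hhg : hbr ħ h g = (adh ħ f ^ (p - 1)) (hbr ħ f g - 1) := by
    rw [map_sub, ← adh_apply ħ f g, ← Module.End.mul_apply, ← pow_succ, Nat.sub_add_cancel (by omega),
      hD, adh_apply, show p - 1 = (p - 2) + 1 by omega, pow_succ, Module.End.mul_apply, adh_apply,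
      hbr_one_right, map_zero, sub_zero]
  have hhg1 : hbr ħ h g ∈ adicFil 𝔫 A 1 := by rw [hhg]; exact adh_pow_mem_adicFil f hfg _
  have hgh1 : hbr ħ g h ∈ adicFil 𝔫 A 1 := by rw [hbr_skew]; exact neg_mem hhg1
  have hgnh : ∀ n, hbr ħ (g ^ n) h ∈ adicFil 𝔫 A 1 := by
    intro n
    induction n with
    | zero => rw [pow_zero, hbr_skew, hbr_one_right, neg_zero]; exact zero_mem _
    | succ n ih =>
      rw [pow_succ, hbr_mul_left]
      exact add_mem (mul_mem_adicFil_right _ hgh1) (mul_mem_adicFil_left _ ih)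
  set E := g ^ (p - 1) * h with hE
  have hEg : hbr ħ E g = g ^ (p - 1) * hbr ħ h g := by
    rw [hE, hbr_mul_left, hbr_pow_self_left, zero_mul, add_zero]
  have hEN : E ∈ adicFil 𝔫 A N := mul_mem_adicFil_right _ hh
  have hDE : ∀ j, (adh ħ f ^ j) E = (adh ħ f ^ j) (g ^ (p - 1)) * h := fun j =>
    adh_pow_mul_of_hbr_eq_zero hfh _ j
  -- For N ≥ 1 the p-th power of an element of 𝔫^N A gains an order by itself. For N = 0 that gives
  -- nothing; there E is a product of g^(p-1) and h, both in ker χ, with bracket in 𝔫A.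
  have hEp : NearlyCentral ħ 𝔫 p (N + 1) (E ^ p) := by
    rcases Nat.eq_zero_or_pos N with rfl | hN0
    · exact H.nearlyCentral_mul hp2 (by rw [map_pow, hg, zero_pow (by omega)]) hχ (hgnh _)
    · exact nearlyCentral_pow_of_mem p hp2 H.weaklyCentral hN0 hEN
  -- The terms of Jacobson's formula that are not linear in E. For N ≥ 1 they lie in 𝔫^(2N) A. For N
  -- = 0 and j ≤ p - 1, (ad f)^j E is, modulo 𝔫A, a multiple of g^(p-1-j) h, whose bracket with E
  -- only involves brackets of h with powers of g; for larger j it is 0 modulo 𝔫A.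
  have hEE : ∀ j, hbr ħ E ((adh ħ f ^ j) E) ∈ adicFil 𝔫 A (N + 1) := by
    intro j
    rcases Nat.eq_zero_or_pos N with rfl | hN0
    · by_cases hj : j ≤ p - 1
      · have h1 := adh_pow_pow_sub_mem hfg (p - 1) j hj
        rw [hDE, ← sub_add_cancel ((adh ħ f ^ j) (g ^ (p - 1)))
          ((p - 1).descFactorial j • g ^ (p - 1 - j)), add_mul, hbr_add_right]
        refine add_mem (hbr_mem_adicFil_right ħ _ (mul_mem_adicFil_left _ h1)) ?_
        rw [smul_mul_assoc, ← adh_apply, map_nsmul, adh_apply]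
        refine Submodule.smul_of_tower_mem _ _ ?_
        have h2 : hbr ħ (g ^ (p - 1)) (g ^ (p - 1 - j) * h) ∈ adicFil 𝔫 A 1 := by
          rw [hbr_mul_right, (hbr_eq_zero_iff ħ).mpr (Commute.pow_pow_self g _ _), zero_mul,
            add_zero]
          exact mul_mem_adicFil_right _ (hgnh _)
        have h3 : hbr ħ h (g ^ (p - 1 - j) * h) ∈ adicFil 𝔫 A 1 := by
          rw [hbr_mul_right, hbr_self, mul_zero, zero_add, hbr_skew]
          exact mul_mem_adicFil_left _ (neg_mem (hgnh _))
        rw [hE, hbr_mul_left]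
        exact add_mem (mul_mem_adicFil_right _ h3) (mul_mem_adicFil_left _ h2)
      · have h1 := adh_pow_pow_sub_mem hfg (p - 1) (p - 1) le_rfl
        obtain ⟨i, rfl⟩ : ∃ i, j = i + 1 + (p - 1) := ⟨j - p, by omega⟩
        rw [hDE, pow_add, Module.End.mul_apply]
        have h2 : (adh ħ f ^ (i + 1)) ((adh ħ f ^ (p - 1)) (g ^ (p - 1))) ∈ adicFil 𝔫 A 1 := by
          rw [← sub_add_cancel ((adh ħ f ^ (p - 1)) (g ^ (p - 1)))
            ((p - 1).descFactorial (p - 1) • g ^ (p - 1 - (p - 1))), map_add]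
          refine add_mem (adh_pow_mem_adicFil _ h1 _) ?_
          rw [Nat.sub_self, pow_zero, map_nsmul, pow_succ, Module.End.mul_apply, adh_apply,
            hbr_one_right, map_zero, smul_zero]
          exact zero_mem _
        exact hbr_mem_adicFil_right ħ _ (mul_mem_adicFil_left _ h2)
    · exact adicFil_anti 𝔫 (by omega) (hbr_mem_adicFil ħ hEN (adh_pow_mem_adicFil f hEN j))
  obtain ⟨r, hr, hpow⟩ := add_pow_char_adicFil p hp2 hEE
  -- By Wilson's theorem (ad f)^(p-1) g^(p-1) ≡ (p-1)! = -1 modulo 𝔫A. As {f, h} = 0, the term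
  -- linear in E cancels h up to 𝔫^(N+1) A.
  have hlast : (adh ħ f ^ (p - 1)) E + h ∈ adicFil 𝔫 A (N + 1) := by
    have h1 := adh_pow_pow_sub_mem hfg (p - 1) (p - 1) le_rfl
    rw [nsmul_eq_mul, descFactorial_pred_self p A, Nat.sub_self, pow_zero, mul_one,
      sub_neg_eq_add] at h1
    have h2 := mul_mem_adicFil h1 hh
    rw [add_mul, one_mul, ← hDE, add_comm 1 N] at h2
    exact h2
  refine ⟨f + E, by simpa using hEN, ?_, ?_, ?_, ?_⟩
  · rw [map_add, hf, hE, map_mul, hχ, mul_zero, add_zero]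
  · rw [hbr_add_left, hEg, add_sub_right_comm]
    exact add_mem hfg (mul_mem_adicFil_right _ hhg1)
  · intro h1
    rw [hbr_add_left, hEg, hhg, h1, sub_self, map_zero, mul_zero, add_zero]
  · have : (f + E) ^ p = z + (E ^ p + ħ ^ (p - 1) • (((adh ħ f ^ (p - 1)) E + h) + r)) := by
      rw [hpow, e]
      simp only [smul_add]
      abel
    rw [this]
    exact (nearlyCentral_center hz).add (hEp.add (nearlyCentral_smul (add_mem hlast hr)))

omit [AlmostComm ħ A] in
theorem mem_center_of_sub_mem (H : IsLocalQuantum p ħ 𝔫 χ) {a : A}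
    (h : ∀ N, ∃ z ∈ Subring.center A, a - z ∈ adicFil 𝔫 A N) : a ∈ Subring.center A := by
  rw [Subring.mem_center_iff]
  intro g
  refine H.complete.eq_of_sub_mem fun N => ?_
  obtain ⟨z, hz, hN⟩ := h N
  have := sub_mem (mul_mem_adicFil_right g hN) (mul_mem_adicFil_left g hN)
  rw [mul_sub, sub_mul, Subring.mem_center_iff.mp hz g] at this
  simpa using this

/-- An element `f` with `{f, g} ∈ 1 + 𝔫 A` can be corrected so that its `p`-th power is central. -/
theorem straighten (H : IsLocalQuantum p ħ 𝔫 χ) [hp : Fact p.Prime] [CharP k p]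
    (hp2 : 2 < p) {f g : A} (hf : χ f = 0) (hg : χ g = 0)
    (hfg : hbr ħ f g - 1 ∈ adicFil 𝔫 A 1) :
    ∃ f' : A, χ f' = 0 ∧ hbr ħ f' g - 1 ∈ adicFil 𝔫 A 1 ∧
      (hbr ħ f g = 1 → hbr ħ f' g = 1) ∧ f' ^ p ∈ Subring.center A := by
  obtain ⟨F, h0, hP, hR⟩ := exists_dependent_seq
    (fun N a => χ a = 0 ∧ hbr ħ a g - 1 ∈ adicFil 𝔫 A 1 ∧ (hbr ħ f g = 1 → hbr ħ a g = 1) ∧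
      NearlyCentral ħ 𝔫 p N (a ^ p))
    (fun N a b => b - a ∈ adicFil 𝔫 A N) (a := f) ⟨hf, hfg, id, H.weaklyCentral f⟩
    (fun N a ⟨h1, h2, h3, h4⟩ => by
      obtain ⟨b, hb1, hb2, hb3, hb4, hb5⟩ := H.straighten_step hp2 h1 hg h2 h4
      exact ⟨b, ⟨hb2, hb3, fun h => hb4 (h3 h), hb5⟩, hb1⟩)
  obtain ⟨L, hL⟩ := H.complete.exists_limit hR
  refine ⟨L, ?_, ?_, ?_, ?_⟩
  · have := H.χ_adicFil le_rfl (hL 1)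
    rwa [map_sub, (hP 1).1, sub_zero] at this
  · have := add_mem (hbr_mem_adicFil_left ħ g (hL 1)) (hP 1).2.1
    rw [hbr_sub_left] at this
    simpa using this
  · intro h
    refine H.complete.eq_of_sub_mem fun N => ?_
    have := hbr_mem_adicFil_left ħ g (hL N)
    rwa [hbr_sub_left, (hP N).2.2.1 h] at this
  · refine H.mem_center_of_sub_mem fun N => ?_
    obtain ⟨z, hz, r, hr, e⟩ := (hP N).2.2.2
    refine ⟨z, hz, ?_⟩
    have := add_mem (sub_mem_adicFil_pow (hL N) p) (Submodule.smul_mem _ (ħ ^ (p - 1)) hr)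
    rw [e] at this
    convert this using 1
    abel

end IsLocalQuantum

/-! ### Existence of a canonical pair -/

/-- On the generalized eigenspace of c one has (T - c)^(p^s) = 0, because p^s ≥ dim V; by Frobenius,
T^(p^s) is the scalar c^(p^s) there. If all eigenvectors with nonzero eigenvalue were in M, the
whole image of T^(p^s) would be in M. -/
theorem Module.End.exists_eigenvector_pow_notMem {k V : Type*} [Field k] [IsAlgClosed k] {p : ℕ}
    [hp : Fact p.Prime] [CharP k p] [AddCommGroup V] [Module k V] [FiniteDimensional k V]
    (T : Module.End k V) (M : Submodule k V) {s : ℕ} (hs : Module.finrank k V ≤ p ^ s) {x : V}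
    (hx : (T ^ p ^ s) x ∉ M) : ∃ w ∉ M, ∃ c : k, c ≠ 0 ∧ (T ^ p ^ s) w = c • w := by
  by_contra hcon
  push Not at hcon
  have hV : Nontrivial V := ⟨_, _, fun h : (T ^ p ^ s) x = 0 => hx (h ▸ zero_mem M)⟩
  have hc : CharP (Module.End k V) p :=
    charP_of_injective_algebraMap (algebraMap k (Module.End k V)).injective p
  have hgen : ∀ (c : k) (w : V), w ∈ T.maxGenEigenspace c → (T ^ p ^ s) w = c ^ p ^ s • w := by
    intro c w hw
    rw [Module.End.maxGenEigenspace_eq_genEigenspace_finrank, Module.End.mem_genEigenspace_nat] at hw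
    have h1 : ((T - algebraMap k (Module.End k V) c) ^ p ^ s) w = 0 := by
      obtain ⟨d, hd⟩ := Nat.exists_eq_add_of_le hs
      rw [hd, add_comm, pow_add, Module.End.mul_apply]
      have : (T - algebraMap k (Module.End k V) c) ^ Module.finrank k V *
        1 = (T - algebraMap k (Module.End k V) c) ^ Module.finrank k V := mul_one _
      rw [show ((T - algebraMap k (Module.End k V) c) ^ Module.finrank k V) w = 0 from hw, map_zero]
    rw [sub_pow_char_pow_of_commute p s ((Algebra.commutes c T).symm : Commute T _),
      ← map_pow, LinearMap.sub_apply, Module.algebraMap_end_apply] at h1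
    exact sub_eq_zero.mp h1
  have hle : ∀ c : k, c ≠ 0 → T.maxGenEigenspace c ≤ M := by
    intro c hc w hw
    by_contra hwM
    exact hcon w hwM (c ^ p ^ s) (pow_ne_zero _ hc) (hgen c w hw)
  have hall : ∀ y ∈ (⨆ c, T.maxGenEigenspace c), (T ^ p ^ s) y ∈ M := by
    intro y hy
    induction hy using Submodule.iSup_induction' with
    | mem c y hy =>
      rw [hgen c y hy]
      by_cases hc : c = 0
      · rw [hc, zero_pow (pow_ne_zero _ hp.out.ne_zero), zero_smul]; exact zero_mem _
      · exact M.smul_mem _ (hle c hc hy)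
    | zero => simp
    | add y z _ _ hy hz => rw [map_add]; exact add_mem hy hz
  exact hx (hall x (by rw [Module.End.iSup_maxGenEigenspace_eq_top]; trivial))

namespace IsLocalQuantum

variable {p : ℕ} {k S : Type*} [Field k] [CommRing S] [Algebra k S] {ħ : S}
    {𝔫 : Ideal S} {A : Type*} [Ring A] [Algebra S A] [Algebra k A] [IsScalarTower k S A]
    {χ : A →ₐ[k] k} [AlmostComm ħ A]

omit [Algebra k S] [Algebra k A] [IsScalarTower k S A] in
/-- The residue character kills `{a, b c}` if it kills `b` and `c`. -/
theorem χ_hbr_mul {χ : A →+* k} {b c : A} (hb : χ b = 0) (hc : χ c = 0) (a : A) :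
    χ (hbr ħ a (b * c)) = 0 := by
  rw [hbr_mul_right, map_add, map_mul, map_mul, hb, hc]; simp

omit [Algebra k S] [IsScalarTower k S A] in
theorem hbr_algebraMap_right (a : A) (c : k) : hbr ħ a (algebraMap k A c) = 0 :=
  (hbr_eq_zero_iff ħ).mpr (Algebra.commutes c a).symm

omit [Algebra k S] [IsScalarTower k S A] in
theorem hbr_sub_algebraMap (a b : A) (c d : k) :
    hbr ħ (a - algebraMap k A c) (b - algebraMap k A d) = hbr ħ a b := by
  rw [hbr_sub_right, hbr_algebraMap_right, sub_zero, hbr_sub_left, hbr_skew ħ (algebraMap k A c),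
    hbr_algebraMap_right, neg_zero, sub_zero]

theorem hbr_ksmul_right (c : k) (a b : A) : hbr ħ a (c • b) = c • hbr ħ a b := by
  rw [← algebraMap_smul S, hbr_smul_right, algebraMap_smul]

theorem hbr_ksmul_left (c : k) (a b : A) : hbr ħ (c • a) b = c • hbr ħ a b := by
  rw [hbr_skew, hbr_ksmul_right, ← smul_neg, ← hbr_skew]

/-- Take a = fg + εf. As f, g ∈ ker χ, χ kills every {fg, ·}; and {fg, g} = {f, g} g is g modulo the
radical of χ{·, ·}. Hence the ε-linear coefficient of χ((ad a)^m g) comes only from {f, (ad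
fg)^(m-1) g} and equals χ{f, g} = 1. A polynomial in ε with a nonzero coefficient has a nonzero
value on an infinite field. -/
theorem exists_χ_adh_pow_ne_zero [Infinite k] {f g : A} (hf : χ f = 0) (hg : χ g = 0)
    (hfg : χ (hbr ħ f g) = 1) {m : ℕ} (hm : 1 ≤ m) :
    ∃ a : A, χ ((adh ħ a ^ m) g) ≠ 0 := by
  set rad : Set A := {r | ∀ b, χ (hbr ħ b r) = 0} with hrad
  have hmul : ∀ b c, χ b = 0 → χ c = 0 → b * c ∈ rad := fun b c hb hc a =>
    χ_hbr_mul (χ := (χ : A →+* k)) hb hc a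
  have hadd : ∀ b c, b ∈ rad → c ∈ rad → b + c ∈ rad := fun b c hb hc a => by
    rw [hbr_add_right, map_add, hb a, hc a, add_zero]
  have hYχ : ∀ a, χ (hbr ħ (f * g) a) = 0 := fun a => by
    rw [hbr_mul_left, map_add, map_mul, map_mul, hf, hg, zero_mul, mul_zero, add_zero]
  have hYrad : ∀ r ∈ rad, hbr ħ (f * g) r ∈ rad := fun r hr => by
    rw [hbr_mul_left]
    exact hadd _ _ (hmul _ _ hf (hr g)) (hmul _ _ (hr f) hg)
  have hYg : ∀ j, (adh ħ (f * g) ^ j) g - g ∈ rad := by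
    intro j
    induction j with
    | zero => intro b; simp [hbr_zero_right]
    | succ j ih =>
      have h1 : (adh ħ (f * g) ^ (j + 1)) g - g =
          hbr ħ (f * g) ((adh ħ (f * g) ^ j) g - g) + (hbr ħ f g - 1) * g := by
        rw [hbr_sub_right, pow_succ', Module.End.mul_apply, adh_apply, hbr_mul_left ħ f g g, hbr_self]
        noncomm_ring
      rw [h1]
      exact hadd _ _ (hYrad _ ih) (hmul _ _ (by rw [map_sub, hfg, map_one, sub_self]) hg)
  have key : ∀ m : ℕ, ∃ c : ℕ → A, (∀ ε : k, (adh ħ (f * g + ε • f) ^ m) g =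
      ∑ i ∈ Finset.range (m + 1), ε ^ i • c i) ∧ (∀ i, m < i → c i = 0) ∧
      c 0 = (adh ħ (f * g) ^ m) g ∧ (1 ≤ m → χ (c 1) = 1) := by
    intro m
    induction m with
    | zero =>
      refine ⟨fun i => if i = 0 then g else 0, by simp, ?_, by simp, by simp⟩
      intro i hi
      simp [hi.ne']
    | succ m ih =>
      obtain ⟨c, h1, h2, h3, -⟩ := ih
      refine ⟨fun i => hbr ħ (f * g) (c i) + (if i = 0 then 0 else hbr ħ f (c (i - 1))), ?_, ?_,
        ?_, ?_⟩
      · intro ε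
        rw [pow_succ', Module.End.mul_apply, h1, adh_apply, hbr_add_left]
        simp only [smul_add, Finset.sum_add_distrib]
        congr 1
        · rw [Finset.sum_range_succ _ (m + 1), h2 (m + 1) (by omega), hbr_zero_right, smul_zero,
            add_zero, ← adh_apply, map_sum]
          exact Finset.sum_congr rfl fun i _ => by rw [adh_apply, hbr_ksmul_right]
        · rw [Finset.sum_range_succ' _ (m + 1), ← adh_apply, map_sum]
          simp only [Nat.add_eq_zero_iff, one_ne_zero, and_false, if_false, Nat.add_sub_cancel,
            if_true, smul_zero, add_zero]
          exact Finset.sum_congr rfl fun i _ => by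
            rw [adh_apply, hbr_ksmul_right, hbr_ksmul_left, smul_smul, pow_succ]
      · intro i hi
        have hi0 : i ≠ 0 := by omega
        simp only [hi0, if_false]
        rw [h2 i (by omega), h2 (i - 1) (by omega), hbr_zero_right, hbr_zero_right, add_zero]
      · simp [h3, pow_succ', adh_apply]
      · intro _
        simp only [one_ne_zero, if_false, Nat.sub_self, map_add, hYχ, zero_add, h3]
        have := hYg m f
        rw [hbr_sub_right, map_sub, hfg] at this
        exact sub_eq_zero.mp this
  obtain ⟨c, h1, -, -, h4⟩ := key m
  by_contra hcon
  push Not at hcon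
  have hQ : (∑ i ∈ Finset.range (m + 1), Polynomial.C (χ (c i)) * Polynomial.X ^ i) = 0 := by
    refine Polynomial.funext fun ε => ?_
    have := hcon (f * g + ε • f)
    rw [h1, map_sum] at this
    rw [Polynomial.eval_finsetSum, Polynomial.eval_zero, ← this]
    exact Finset.sum_congr rfl fun i _ => by
      rw [Polynomial.eval_C_mul, Polynomial.eval_pow, Polynomial.eval_X, map_smul, smul_eq_mul,
        mul_comm]
  have h5 := congrArg (fun q => Polynomial.coeff q 1) hQ
  simp only [Polynomial.finsetSum_coeff, Polynomial.coeff_C_mul_X_pow, Polynomial.coeff_zero] at h5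
  rw [Finset.sum_ite_eq, if_pos (Finset.mem_range.mpr (by omega)), h4 hm] at h5
  exact one_ne_zero h5

/-- Weak centrality makes the p-th power of ad F again inner; iterate. Subtracting the scalar χ(F)
does not change ad F. -/
theorem exists_adh_eq_pow (H : IsLocalQuantum p ħ 𝔫 χ) [hp : Fact p.Prime] [CharP k p] (a : A)
    (s : ℕ) : ∃ F : A, χ F = 0 ∧ adh ħ a ^ p ^ s = adh ħ F := by
  have := charP (p := p) χ
  suffices h : ∃ F : A, adh ħ a ^ p ^ s = adh ħ F by
    obtain ⟨F, hF⟩ := h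
    refine ⟨F - algebraMap k A (χ F), by simp, ?_⟩
    rw [hF]
    ext b
    rw [adh_apply, adh_apply, hbr_sub_left, hbr_skew ħ (algebraMap k A _), hbr_algebraMap_right,
      neg_zero, sub_zero]
  induction s with
  | zero => exact ⟨a, by simp⟩
  | succ s ih =>
    obtain ⟨F, hF⟩ := ih
    obtain ⟨z, hz, h, -, e⟩ := H.weaklyCentral F
    exact ⟨h, by rw [pow_succ, pow_mul, hF, adh_pow_char ħ p hz e]⟩

/-- On the finite-dimensional space A/𝔫A, a high p^s-th power of ad a is diagonalizable. If it does
not send g into ker χ, some eigenvector with nonzero eigenvalue lies outside ker χ; and this power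
of ad a is itself some ad F. -/
theorem exists_eigenvector (H : IsLocalQuantum p ħ 𝔫 χ) [hp : Fact p.Prime] [CharP k p]
    [IsAlgClosed k] {f g : A} (hf : χ f = 0) (hg : χ g = 0) (hfg : χ (hbr ħ f g) = 1) :
    ∃ F w : A, ∃ c : k, χ F = 0 ∧ χ w ≠ 0 ∧ c ≠ 0 ∧ hbr ħ F w - c • w ∈ adicFil 𝔫 A 1 := by
  have := H.finite
  have : Infinite k := IsAlgClosed.instInfinite
  set V := A ⧸ adicFil 𝔫 A 1
  obtain ⟨s, hs⟩ : ∃ s, Module.finrank k V ≤ p ^ s :=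
    ⟨Module.finrank k V, (Nat.lt_pow_self hp.out.one_lt).le⟩
  obtain ⟨a, ha⟩ := exists_χ_adh_pow_ne_zero hf hg hfg (m := p ^ s)
    (Nat.one_le_pow _ _ hp.out.pos)
  let π : A →ₗ[k] V := (adicFil 𝔫 A 1).mkQ.restrictScalars k
  let T : Module.End k V := ((adicFil 𝔫 A 1).mapQ (adicFil 𝔫 A 1) (adh ħ a)
    (fun b hb => hbr_mem_adicFil_right ħ a hb)).restrictScalars k
  have hT : ∀ n b, (T ^ n) (π b) = π ((adh ħ a ^ n) b) := by
    intro n b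
    induction n with
    | zero => rfl
    | succ n ih => rw [pow_succ', pow_succ', Module.End.mul_apply, ih]; rfl
  have hker : ∀ b, π b ∈ (LinearMap.ker χ.toLinearMap).map π ↔ χ b = 0 := by
    intro b
    constructor
    · rintro ⟨c, hc, hcb⟩
      have h1 : c - b ∈ adicFil 𝔫 A 1 := (Submodule.Quotient.eq _).mp hcb
      have h2 := H.χ_adicFil le_rfl h1
      rw [map_sub, show χ c = 0 from hc, zero_sub, neg_eq_zero] at h2
      exact h2
    · exact fun h => ⟨b, h, rfl⟩
  obtain ⟨w', hw', c, hc, hcw⟩ := Module.End.exists_eigenvector_pow_notMem (p := p) T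
    ((LinearMap.ker χ.toLinearMap).map π) hs (x := π g) (by rw [hT, hker]; exact ha)
  obtain ⟨w, rfl⟩ := Submodule.mkQ_surjective _ w'
  obtain ⟨F, hF0, hF⟩ := H.exists_adh_eq_pow a s
  refine ⟨F, w, c, hF0, fun h => hw' ((hker w).mpr h), hc, ?_⟩
  have h1 : π (hbr ħ F w) = π (c • w) := by
    rw [← adh_apply, ← hF, ← hT, map_smul]; exact hcw
  exact (Submodule.Quotient.eq _).mp h1

/-- An eigenvector w with χ(w) ≠ 0 is a unit, and w⁻¹ commutes with w, so {c⁻¹w⁻¹F, w} = c⁻¹w⁻¹{F,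
w} ≡ 1. Subtracting a scalar from w moves it into ker χ. -/
theorem exists_approx_pair (H : IsLocalQuantum p ħ 𝔫 χ) [hp : Fact p.Prime] [CharP k p]
    [IsAlgClosed k] {f g : A} (hf : χ f = 0) (hg : χ g = 0) (hfg : χ (hbr ħ f g) = 1) :
    ∃ x y : A, χ x = 0 ∧ χ y = 0 ∧ hbr ħ x y - 1 ∈ adicFil 𝔫 A 1 := by
  obtain ⟨F, w, c, hF, hw, hc, h⟩ := H.exists_eigenvector hf hg hfg
  obtain ⟨u, rfl⟩ := H.isUnit hw
  refine ⟨c⁻¹ • (↑u⁻¹ * F), u - algebraMap k A (χ u), by simp [hF], by simp, ?_⟩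
  have h1 : hbr ħ (↑u⁻¹ : A) (u : A) = 0 := (hbr_eq_zero_iff ħ).mpr (by simp [Commute, SemiconjBy])
  rw [hbr_sub_right, hbr_algebraMap_right, sub_zero, hbr_ksmul_left, hbr_mul_left, h1, zero_mul,
    add_zero]
  have h2 : c⁻¹ • ((↑u⁻¹ : A) * hbr ħ F u) - 1 =
      c⁻¹ • ((↑u⁻¹ : A) * (hbr ħ F u - c • (u : A))) := by
    rw [mul_sub, mul_smul_comm, Units.inv_mul, smul_sub, smul_smul, inv_mul_cancel₀ hc, one_smul]
  rw [h2, ← algebraMap_smul S]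
  exact Submodule.smul_mem _ _ (mul_mem_adicFil_right _ h)

theorem adh_pow_eq_zero [hp : Fact p.Prime] [CharP A p] {f : A}
    (hf : f ^ p ∈ Subring.center A) : adh ħ f ^ p = 0 := by
  rw [adh_pow_char ħ p hf (h := 0) (by simp)]
  ext b
  rw [adh_apply, hbr_skew, hbr_zero_right, neg_zero]; rfl

/-- Since f^p is central, (ad f)^p = 0, so u = (ad f)^(p-1) g^(p-1) commutes with f. It is a unit
because it is -1 modulo 𝔫A. Dividing (ad f)^(p-2) g^(p-1), whose bracket with f is u, by u gives
bracket exactly 1. -/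
theorem exists_exact_partner (H : IsLocalQuantum p ħ 𝔫 χ) [hp : Fact p.Prime] [CharP k p]
    (hp2 : 2 < p) {f g : A} (hg : χ g = 0) (hfg : hbr ħ f g - 1 ∈ adicFil 𝔫 A 1)
    (hfp : f ^ p ∈ Subring.center A) : ∃ y : A, χ y = 0 ∧ hbr ħ f y = 1 := by
  have := charP (p := p) χ
  have hD := adh_pow_eq_zero (ħ := ħ) (p := p) hfp
  have h1 := adh_pow_pow_sub_mem hfg (p - 1) (p - 1) le_rfl
  have h2 := adh_pow_pow_sub_mem hfg (p - 1) (p - 2) (by omega)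
  rw [nsmul_eq_mul, descFactorial_pred_self p A, Nat.sub_self, pow_zero, mul_one] at h1
  have hv : χ ((adh ħ f ^ (p - 1)) (g ^ (p - 1))) ≠ 0 := by
    have := H.χ_adicFil le_rfl h1
    rw [map_sub, map_neg, map_one] at this
    rw [sub_eq_zero.mp this]
    exact neg_ne_zero.mpr one_ne_zero
  obtain ⟨u, hu⟩ := H.isUnit hv
  have hfu : Commute f (u : A) := by
    rw [← hbr_eq_zero_iff ħ, hu, ← adh_apply, ← Module.End.mul_apply, ← pow_succ',
      Nat.sub_add_cancel (by omega), hD, LinearMap.zero_apply]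
  have hfu' : hbr ħ f (↑u⁻¹ : A) = 0 := (hbr_eq_zero_iff ħ).mpr hfu.units_inv_right
  refine ⟨↑u⁻¹ * (adh ħ f ^ (p - 2)) (g ^ (p - 1)), ?_, ?_⟩
  · have := H.χ_adicFil le_rfl h2
    rw [map_sub, map_nsmul, map_pow χ, hg, zero_pow (by omega), smul_zero, sub_zero] at this
    rw [map_mul, this, mul_zero]
  · rw [hbr_mul_right, hfu', zero_mul, add_zero, ← adh_apply, ← Module.End.mul_apply, ← pow_succ',
      show p - 2 + 1 = p - 1 by omega, ← hu, Units.inv_mul]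

/-- If the bracket does not vanish at the residue point, there are `x`, `y` with `{x, y} = 1`
whose `p`-th powers are central. -/
theorem exists_canonical_pair (H : IsLocalQuantum p ħ 𝔫 χ) [hp : Fact p.Prime] [CharP k p]
    [IsAlgClosed k] (hp2 : 2 < p) {a b : A} (hab : χ (hbr ħ a b) ≠ 0) :
    ∃ x y : A, χ x = 0 ∧ χ y = 0 ∧ hbr ħ x y = 1 ∧ x ^ p ∈ Subring.center A ∧
      y ^ p ∈ Subring.center A := by
  obtain ⟨f, g, hf, hg, hfg⟩ := H.exists_approx_pair (f := a - algebraMap k A (χ a))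
    (g := (χ (hbr ħ a b))⁻¹ • (b - algebraMap k A (χ b))) (by simp) (by simp) (by
      rw [hbr_ksmul_right, hbr_sub_algebraMap, map_smul, smul_eq_mul, inv_mul_cancel₀ hab])
  obtain ⟨x, hx, hxg, -, hxp⟩ := H.straighten hp2 hf hg hfg
  obtain ⟨y, hy, hxy⟩ := H.exists_exact_partner hp2 hg hxg hxp
  -- The pair (y, -x) again has bracket 1. Straightening y against -x preserves this exact relation
  -- and leaves x, whose p-th power is already central, unchanged.
  have hyx : hbr ħ y (-x) = 1 := by rw [hbr_neg_right, ← hbr_skew, hxy]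
  obtain ⟨y', hy', -, hy'x, hyp⟩ := H.straighten hp2 hy (g := -x) (by simp [hx])
    (by rw [hyx, sub_self]; exact zero_mem _)
  refine ⟨x, y', hx, hy', ?_, hxp, hyp⟩
  have := hy'x hyx
  rwa [hbr_neg_right, ← hbr_skew] at this

end IsLocalQuantum

/-! ### Decomposition with respect to commuting nilpotent derivations -/

section Decomposition

variable {S : Type*} [CommRing S] {A : Type*} [Ring A] [Algebra S A]

theorem derivation_pow_succ_mul {D : Module.End S A} (hD : ∀ a b, D (a * b) = a * D b + D a * b)
    {t : A} (ht : D t = 1) {c : A} (hc : D c = 0) (j : ℕ) :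
    D (t ^ (j + 1) * c) = (j + 1) • (t ^ j * c) := by
  induction j with
  | zero => simp [hD, ht, hc]
  | succ j ih =>
    rw [pow_succ', mul_assoc, hD, ih, ht, one_mul, mul_smul_comm, ← mul_assoc, ← pow_succ',
      ← succ_nsmul]

theorem derivation_pow_mul_pow {D : Module.End S A} (hD : ∀ a b, D (a * b) = a * D b + D a * b)
    {t : A} (ht : D t = 1) {c : A} (hc : D c = 0) (m i : ℕ) (h : i ≤ m) :
    (D ^ i) (t ^ m * c) = m.descFactorial i • (t ^ (m - i) * c) := by
  induction i with
  | zero => simp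
  | succ i ih =>
    obtain ⟨d, hd⟩ : ∃ d, m - i = d + 1 := ⟨m - i - 1, by omega⟩
    rw [pow_succ', Module.End.mul_apply, ih (by omega), map_nsmul, hd,
      derivation_pow_succ_mul hD ht hc, smul_smul, Nat.descFactorial_succ, hd,
      show m - (i + 1) = d by omega, mul_comm]

theorem derivation_pow_mul_pow_eq_zero {D : Module.End S A}
    (hD : ∀ a b, D (a * b) = a * D b + D a * b)
    {t : A} (ht : D t = 1) {c : A} (hc : D c = 0) (m i : ℕ) (h : m < i) :
    (D ^ i) (t ^ m * c) = 0 := by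
  obtain ⟨d, rfl⟩ : ∃ d, i = d + 1 + m := ⟨i - m - 1, by omega⟩
  rw [pow_add, Module.End.mul_apply, derivation_pow_mul_pow hD ht hc m m le_rfl, Nat.sub_self,
    pow_zero, one_mul, map_nsmul, pow_succ, Module.End.mul_apply, hc, map_zero, smul_zero]

theorem exists_factorial_inv (p : ℕ) [hp : Fact p.Prime] [CharP A p] {m : ℕ} (hm : m < p) :
    ∃ u : ℕ, ∀ a : A, u • m.factorial • a = a := by
  have hcop : Nat.Coprime m.factorial p :=
    (Nat.Coprime.symm ((Nat.Prime.coprime_iff_not_dvd hp.out).mpr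
      (fun h => by rw [hp.out.dvd_factorial] at h; omega)))
  obtain ⟨u, -, hu⟩ := Nat.exists_mul_mod_eq_one_of_coprime hcop hp.out.one_lt
  refine ⟨u, fun a => ?_⟩
  have h3 := (CharP.cast_eq_mod A p (m.factorial * u))
  rw [hu, Nat.cast_one] at h3
  rw [smul_smul, mul_comm, nsmul_eq_mul, h3, one_mul]

/-- Taylor expansion in t: the top coefficient is the highest nonzero derivative divided by a
factorial, invertible because it is of a number below p. The submodule K is carried along so that
the expansion can be repeated inside kernels of other derivations. -/
theorem exists_sum_pow_mul {p : ℕ} [hp : Fact p.Prime] [CharP A p] {D : Module.End S A}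
    (hD : ∀ a b, D (a * b) = a * D b + D a * b) {t : A} (ht : D t = 1) {K : Submodule S A}
    (hKD : ∀ a ∈ K, D a ∈ K) (hKt : ∀ a ∈ K, t * a ∈ K) (m : ℕ) (hm : m ≤ p) {a : A} (haK : a ∈ K)
    (ha : (D ^ m) a = 0) :
    ∃ c : ℕ → A, (∀ j, c j ∈ K ∧ D (c j) = 0) ∧ a = ∑ j ∈ Finset.range m, t ^ j * c j := by
  have hKDn : ∀ n, ∀ a ∈ K, (D ^ n) a ∈ K := fun n => by
    induction n with
    | zero => exact fun a h => h
    | succ n ih => intro a h; rw [pow_succ', Module.End.mul_apply]; exact hKD _ (ih a h)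
  have hKtn : ∀ n, ∀ a ∈ K, t ^ n * a ∈ K := fun n => by
    induction n with
    | zero => intro a h; simpa using h
    | succ n ih => intro a h; rw [pow_succ', mul_assoc]; exact hKt _ (ih a h)
  induction m generalizing a with
  | zero => exact ⟨0, by simp, by simpa using ha⟩
  | succ m ih =>
    obtain ⟨u, hu⟩ := exists_factorial_inv (A := A) p (m := m) (by omega)
    set e := (D ^ m) a with he
    have heK : e ∈ K := hKDn m a haK
    have hDe : D e = 0 := by rw [he, ← Module.End.mul_apply, ← pow_succ', ha]
    obtain ⟨c, hc, hsum⟩ := ih (by omega) (a := a - u • (t ^ m * e))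
      (K.sub_mem haK (K.smul_of_tower_mem u (hKtn m e heK))) (by
        rw [map_sub, map_nsmul, derivation_pow_mul_pow hD ht hDe m m le_rfl, Nat.sub_self, pow_zero,
          one_mul, Nat.descFactorial_self, hu, sub_self])
    refine ⟨fun j => if j = m then u • e else c j, ?_, ?_⟩
    · intro j
      dsimp only
      split_ifs
      · exact ⟨K.smul_of_tower_mem u heK, by rw [map_nsmul, hDe, smul_zero]⟩
      · exact hc j
    · rw [Finset.sum_range_succ]
      dsimp only
      rw [if_pos rfl, mul_smul_comm, ← sub_eq_iff_eq_add, hsum]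
      refine Finset.sum_congr rfl fun j hj => ?_
      rw [if_neg (Finset.mem_range.mp hj).ne]

theorem eq_zero_of_sum_pow_mul_eq_zero {p : ℕ} [hp : Fact p.Prime] [CharP A p]
    {D : Module.End S A} (hD : ∀ a b, D (a * b) = a * D b + D a * b) {t : A} (ht : D t = 1) (m : ℕ)
    (hm : m ≤ p) {c : ℕ → A} (hc : ∀ j, D (c j) = 0)
    (hsum : ∑ j ∈ Finset.range m, t ^ j * c j = 0) : ∀ j < m, c j = 0 := by
  induction m with
  | zero => intro j hj; omega
  | succ m ih =>
    have h1 : c m = 0 := by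
      have := congrArg (D ^ m) hsum
      rw [Finset.sum_range_succ, map_add, map_sum, Finset.sum_eq_zero (fun j hj =>
        derivation_pow_mul_pow_eq_zero hD ht (hc j) j m (Finset.mem_range.mp hj)), zero_add,
        derivation_pow_mul_pow hD ht (hc m) m m le_rfl, Nat.sub_self, pow_zero, one_mul,
        Nat.descFactorial_self, map_zero] at this
      obtain ⟨u, hu⟩ := exists_factorial_inv (A := A) p (m := m) (by omega)
      rw [← hu (c m), this, smul_zero]
    rw [Finset.sum_range_succ, h1, mul_zero, add_zero] at hsum
    intro j hj
    rcases Nat.lt_succ_iff_lt_or_eq.mp hj with h | rfl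
    · exact ih (by omega) hsum j h
    · exact h1

/-- The ordered monomial `t 0 ^ α 0 * t 1 ^ α 1 * …`. -/
def ordMonomial {R : Type*} [Monoid R] {m p : ℕ} (t : Fin m → R) (α : Fin m → Fin p) : R :=
  (List.ofFn fun i => t i ^ (α i : ℕ)).prod

theorem ordMonomial_zero {R : Type*} [Monoid R] {p : ℕ} (t : Fin 0 → R) (α : Fin 0 → Fin p) :
    ordMonomial t α = 1 := by simp [ordMonomial]

theorem ordMonomial_cons {R : Type*} [Monoid R] {m p : ℕ} (t : Fin (m + 1) → R) (j : Fin p)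
    (β : Fin m → Fin p) : ordMonomial t (Fin.cons j β : Fin (m + 1) → Fin p) =
      t 0 ^ (j : ℕ) * ordMonomial (fun i => t i.succ) β := by
  simp [ordMonomial, List.ofFn_succ]

theorem sum_ordMonomial_succ {R : Type*} [Semiring R] {m p : ℕ} (t : Fin (m + 1) → R)
    (c : (Fin (m + 1) → Fin p) → R) : ∑ α, ordMonomial t α * c α =
      ∑ j : Fin p, t 0 ^ (j : ℕ) *
        ∑ β : Fin m → Fin p, ordMonomial (fun i => t i.succ) β * c (Fin.cons j β) := by
  rw [← (Fin.consEquiv (fun _ : Fin (m + 1) => Fin p)).sum_comp, Fintype.sum_prod_type]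
  refine Finset.sum_congr rfl fun j _ => ?_
  rw [Finset.mul_sum]
  refine Finset.sum_congr rfl fun β _ => ?_
  rw [← mul_assoc, ← ordMonomial_cons]
  rfl

/-- A family of commuting derivations with `D i ^ p = 0` and elements `t j` with
`D i (t j) = δ i j`. -/
structure IsDualDerivations (p : ℕ) {m : ℕ} (t : Fin m → A) (D : Fin m → Module.End S A) :
    Prop where
  leibniz : ∀ i a b, D i (a * b) = a * D i b + D i a * b
  pow_eq_zero : ∀ i, D i ^ p = 0
  comm : ∀ i j, Commute (D i) (D j)
  apply_self : ∀ i, D i (t i) = 1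
  apply_ne : ∀ i j, i ≠ j → D i (t j) = 0

namespace IsDualDerivations

variable {p : ℕ} {m : ℕ}

theorem tail {t : Fin (m + 1) → A} {D : Fin (m + 1) → Module.End S A}
    (h : IsDualDerivations p t D) :
    IsDualDerivations p (fun i : Fin m => t i.succ) (fun i : Fin m => D i.succ) where
  leibniz i := h.leibniz _
  pow_eq_zero i := h.pow_eq_zero _
  comm i j := h.comm _ _
  apply_self i := h.apply_self _
  apply_ne i j hij := h.apply_ne _ _ (by simpa using hij)

/-- Expand in the first variable with coefficients in ker D 0, then expand those coefficients in the
remaining variables. The kernel is stable under the other derivations, which commute with D 0, and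
under multiplication by the other variables, which D 0 kills. -/
theorem exists_sum_of_mem [hp : Fact p.Prime] [CharP A p] {t : Fin m → A}
    {D : Fin m → Module.End S A} (h : IsDualDerivations p t D) (K : Submodule S A)
    (hKD : ∀ i, ∀ a ∈ K, D i a ∈ K) (hKt : ∀ i, ∀ a ∈ K, t i * a ∈ K) {a : A} (ha : a ∈ K) :
    ∃ c : (Fin m → Fin p) → A, (∀ α, c α ∈ K ∧ ∀ i, D i (c α) = 0) ∧
      a = ∑ α, ordMonomial t α * c α := by
  induction m generalizing K a with
  | zero => exact ⟨fun _ => a, fun _ => ⟨ha, fun i => i.elim0⟩, by simp [ordMonomial_zero]⟩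
  | succ m ih =>
    obtain ⟨c, hc, hsum⟩ := exists_sum_pow_mul (h.leibniz 0) (h.apply_self 0) (hKD 0) (hKt 0) p
      le_rfl ha (by rw [h.pow_eq_zero]; rfl)
    have hrec : ∀ j, ∃ e : (Fin m → Fin p) → A, (∀ α, e α ∈ K ⊓ LinearMap.ker (D 0) ∧
        ∀ i : Fin m, D i.succ (e α) = 0) ∧
        c j = ∑ α, ordMonomial (fun i => t i.succ) α * e α := by
      intro j
      refine ih h.tail (K ⊓ LinearMap.ker (D 0)) ?_ ?_ ⟨(hc j).1, (hc j).2⟩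
      · rintro i b ⟨hb, hb0⟩
        refine ⟨hKD _ b hb, ?_⟩
        have := LinearMap.congr_fun (h.comm 0 i.succ).eq b
        rw [Module.End.mul_apply, Module.End.mul_apply, LinearMap.mem_ker.mp hb0, map_zero] at this
        exact this
      · rintro i b ⟨hb, hb0⟩
        refine ⟨hKt _ b hb, ?_⟩
        change D 0 (t i.succ * b) = 0
        rw [h.leibniz, LinearMap.mem_ker.mp hb0, h.apply_ne 0 i.succ (Fin.succ_ne_zero i).symm,
          mul_zero, zero_mul, add_zero]
    choose e he hesum using hrec
    refine ⟨fun α => e (α 0) (fun i => α i.succ), fun α => ⟨((he _ _).1).1, fun i => ?_⟩, ?_⟩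
    · refine Fin.cases ((he _ _).1).2 (fun i => (he _ _).2 i) i
    · rw [hsum, sum_ordMonomial_succ, ← Fin.sum_univ_eq_sum_range (fun j => t 0 ^ j * c j)]
      refine Finset.sum_congr rfl fun j _ => ?_
      rw [hesum]
      simp

theorem apply_ordMonomial {t : Fin m → A} {E : Module.End S A}
    (hE : ∀ a b, E (a * b) = a * E b + E a * b) (ht : ∀ i, E (t i) = 0) (α : Fin m → Fin p) :
    E (ordMonomial t α) = 0 := by
  have h1 : E 1 = 0 := by have := hE 1 1; simpa using this
  unfold ordMonomial
  have : ∀ l : List A, (∀ x ∈ l, E x = 0) → E l.prod = 0 := by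
    intro l
    induction l with
    | nil => simpa using h1
    | cons x l ih =>
      intro hl
      rw [List.prod_cons, hE, ih (fun y hy => hl y (List.mem_cons_of_mem _ hy)),
        hl x List.mem_cons_self, mul_zero, zero_mul, add_zero]
  refine this _ fun x hx => ?_
  obtain ⟨i, rfl⟩ := (List.mem_ofFn' _ _).mp hx
  dsimp only
  induction (α i : ℕ) with
  | zero => simpa using h1
  | succ n ih => rw [pow_succ, hE, ih, ht, mul_zero, zero_mul, add_zero]

theorem eq_zero_of_sum_eq_zero [hp : Fact p.Prime] [CharP A p] {t : Fin m → A}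
    {D : Fin m → Module.End S A} (h : IsDualDerivations p t D) {c : (Fin m → Fin p) → A}
    (hc : ∀ α i, D i (c α) = 0) (hsum : ∑ α, ordMonomial t α * c α = 0) (α : Fin m → Fin p) :
    c α = 0 := by
  induction m with
  | zero =>
    rwa [Fintype.sum_eq_single α (fun β hβ => (hβ (Subsingleton.elim _ _)).elim),
      ordMonomial_zero, one_mul] at hsum
  | succ m ih =>
    set e : ℕ → A := fun j => if hj : j < p then
      ∑ β : Fin m → Fin p, ordMonomial (fun i => t i.succ) β * c (Fin.cons ⟨j, hj⟩ β) else 0 with he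
    have hej : ∀ j : Fin p, e j =
        ∑ β : Fin m → Fin p, ordMonomial (fun i => t i.succ) β * c (Fin.cons j β) := by
      intro j; simp [he]
    have hD : ∀ j, D 0 (e j) = 0 := by
      intro j
      simp only [he]
      split_ifs with hj
      · rw [map_sum]
        refine Finset.sum_eq_zero fun β _ => ?_
        rw [h.leibniz, hc, apply_ordMonomial (h.leibniz 0)
          (fun i => h.apply_ne 0 i.succ (Fin.succ_ne_zero i).symm), mul_zero, zero_mul, add_zero]
      · exact map_zero _
    rw [sum_ordMonomial_succ] at hsum
    simp only [← hej] at hsum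
    rw [Fin.sum_univ_eq_sum_range (fun j => t 0 ^ j * e j)] at hsum
    have h0 := eq_zero_of_sum_pow_mul_eq_zero (h.leibniz 0) (h.apply_self 0) p le_rfl hD hsum
    have h1 := ih h.tail (c := fun β => c (Fin.cons (α 0) β)) (fun β i => hc _ _)
      (by rw [← hej]; exact h0 _ (α 0).2) (fun i => α i.succ)
    rwa [show (Fin.cons (α 0) fun i => α i.succ) = α from Fin.cons_self_tail α] at h1

end IsDualDerivations

end Decomposition

/-! ### Darboux families -/

/-- Elements `x i`, `y i` satisfying the relations of the Weyl algebra, with central `p`-th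
powers. -/
structure IsDarboux {S : Type*} [CommRing S] (ħ : S) (p : ℕ) {A : Type*} [Ring A] [Algebra S A]
    {n : ℕ} (x y : Fin n → A) : Prop where
  xx : ∀ i j, Commute (x i) (x j)
  yy : ∀ i j, Commute (y i) (y j)
  xy : ∀ i j, x i * y j - y j * x i = ħ • (if i = j then 1 else 0 : A)
  xp : ∀ i, x i ^ p ∈ Subring.center A
  yp : ∀ i, y i ^ p ∈ Subring.center A

namespace IsDarboux

variable {S : Type*} [CommRing S] {ħ : S} {p : ℕ} {A : Type*} [Ring A] [Algebra S A]
    {n : ℕ} {x y : Fin n → A}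

/-- The subalgebra of elements commuting with all `x i` and `y i`. -/
abbrev centralizer (_ : IsDarboux ħ p x y) : Subalgebra S A :=
  Subalgebra.centralizer S (Set.range (Fin.append x y))

theorem mem_centralizer (h : IsDarboux ħ p x y) {a : A} :
    a ∈ h.centralizer ↔ (∀ i, Commute (x i) a) ∧ ∀ i, Commute (y i) a := by
  rw [Subalgebra.mem_centralizer_iff, Set.forall_mem_range]
  constructor
  · intro H
    exact ⟨fun i => by have := H (Fin.castAdd n i); rwa [Fin.append_left] at this,
      fun i => by have := H (Fin.natAdd n i); rwa [Fin.append_right] at this⟩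
  · rintro ⟨h1, h2⟩ i
    refine Fin.addCases (fun i => ?_) (fun i => ?_) i
    · rw [Fin.append_left]; exact h1 i
    · rw [Fin.append_right]; exact h2 i

theorem center_le (h : IsDarboux ħ p x y) {z : A} (hz : z ∈ Subring.center A) :
    z ∈ h.centralizer :=
  h.mem_centralizer.mpr ⟨fun _ => Subring.mem_center_iff.mp hz _,
    fun _ => Subring.mem_center_iff.mp hz _⟩

variable [AlmostComm ħ A]

theorem hbr_xy (h : IsDarboux ħ p x y) (i j : Fin n) :
    hbr ħ (x i) (y j) = if i = j then 1 else 0 := hbr_unique (h.xy i j)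

theorem hbr_yx (h : IsDarboux ħ p x y) (i j : Fin n) :
    -hbr ħ (y i) (x j) = if i = j then 1 else 0 := by
  rw [← hbr_skew, h.hbr_xy]; simp [eq_comm]

/-- The derivations dual to the family `x 0, …, y 0, …`. -/
noncomputable def der (ħ : S) [AlmostComm ħ A] (x y : Fin n → A) : Fin (n + n) → Module.End S A :=
  Fin.append (fun i => -adh ħ (y i)) (fun i => adh ħ (x i))

/-- The derivation dual to x i is -ad (y i), and the one dual to y i is ad (x i). By the Jacobi
identity they commute, as all brackets between the x i and y j are central. Their p-th powers vanish
because the p-th powers of the elements are central. -/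
theorem isDualDerivations (h : IsDarboux ħ p x y) [hp : Fact p.Prime] [CharP A p] (hp2 : 2 < p) :
    IsDualDerivations p (Fin.append x y) (der ħ x y) := by
  have hadcomm : ∀ a b : A, hbr ħ a b ∈ Subring.center A → Commute (adh ħ a) (adh ħ b) := by
    intro a b hab
    ext c
    rw [Module.End.mul_apply, Module.End.mul_apply, adh_apply, adh_apply, adh_apply, adh_apply,
      hbr_jacobi, center_hbr ħ hab, zero_add]
  have hc : ∀ (i j : Fin n), (if i = j then 1 else 0 : A) ∈ Subring.center A := by
    intro i j; split_ifs
    · exact one_mem _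
    · exact zero_mem _
  have hxy : ∀ i j, Commute (adh ħ (x i)) (adh ħ (y j)) := fun i j =>
    hadcomm _ _ (by rw [h.hbr_xy]; exact hc i j)
  have hodd : Odd p := hp.out.odd_of_ne_two (by omega)
  constructor
  · intro i a b
    refine Fin.addCases (fun i => ?_) (fun i => ?_) i
    · simp only [der, Fin.append_left, LinearMap.neg_apply, adh_apply, hbr_mul_right]
      noncomm_ring
    · simp only [der, Fin.append_right, adh_apply, hbr_mul_right]
  · intro i
    refine Fin.addCases (fun i => ?_) (fun i => ?_) i
    · have h1 : -adh ħ (y i) = adh ħ (-y i) := by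
        ext b; rw [LinearMap.neg_apply, adh_apply, adh_apply, hbr_neg_left]
      rw [der, Fin.append_left, h1, IsLocalQuantum.adh_pow_eq_zero]
      rw [hodd.neg_pow]
      exact neg_mem (h.yp i)
    · rw [der, Fin.append_right, IsLocalQuantum.adh_pow_eq_zero (h.xp i)]
  · intro i j
    refine Fin.addCases (fun i => ?_) (fun i => ?_) i <;>
      refine Fin.addCases (fun j => ?_) (fun j => ?_) j <;>
      simp only [der, Fin.append_left, Fin.append_right]
    · refine Commute.neg_left (Commute.neg_right (hadcomm _ _ ?_))
      rw [(hbr_eq_zero_iff ħ).mpr (h.yy i j)]; exact zero_mem _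
    · exact Commute.neg_left (hxy _ _).symm
    · exact Commute.neg_right (hxy _ _)
    · refine hadcomm _ _ ?_
      rw [(hbr_eq_zero_iff ħ).mpr (h.xx i j)]; exact zero_mem _
  · intro i
    refine Fin.addCases (fun i => ?_) (fun i => ?_) i
    · simp only [der, Fin.append_left, LinearMap.neg_apply, adh_apply, h.hbr_yx, if_true]
    · simp only [der, Fin.append_right, adh_apply, h.hbr_xy, if_true]
  · intro i j
    refine Fin.addCases (fun i => ?_) (fun i => ?_) i <;>
      refine Fin.addCases (fun j => ?_) (fun j => ?_) j <;>
      intro hij <;>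
      simp only [der, Fin.append_left, Fin.append_right, LinearMap.neg_apply, adh_apply]
    · rw [h.hbr_yx, if_neg (fun e => hij (by rw [e]))]
    · rw [(hbr_eq_zero_iff ħ).mpr (h.yy i j), neg_zero]
    · rw [(hbr_eq_zero_iff ħ).mpr (h.xx i j)]
    · rw [h.hbr_xy, if_neg (fun e => hij (by rw [e]))]

theorem mem_centralizer_iff_der (h : IsDarboux ħ p x y) {a : A} :
    a ∈ h.centralizer ↔ ∀ i, der ħ x y i a = 0 := by
  rw [h.mem_centralizer]
  constructor
  · rintro ⟨h1, h2⟩ i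
    refine Fin.addCases (fun i => ?_) (fun i => ?_) i
    · rw [der, Fin.append_left, LinearMap.neg_apply, adh_apply, (hbr_eq_zero_iff ħ).mpr (h2 i),
        neg_zero]
    · rw [der, Fin.append_right, adh_apply, (hbr_eq_zero_iff ħ).mpr (h1 i)]
  · intro H
    constructor
    · intro i
      have := H (Fin.natAdd n i)
      rwa [der, Fin.append_right, adh_apply, hbr_eq_zero_iff] at this
    · intro i
      have := H (Fin.castAdd n i)
      rwa [der, Fin.append_left, LinearMap.neg_apply, adh_apply, neg_eq_zero, hbr_eq_zero_iff] at this

/-- `A` is freely generated by the ordered monomials in `x`, `y` with exponents less than `p` over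
the centralizer of `x` and `y`. -/
noncomputable def decomp (h : IsDarboux ħ p x y) [hp : Fact p.Prime] [CharP A p] (hp2 : 2 < p) :
    ((Fin (n + n) → Fin p) → h.centralizer) ≃ₗ[S] A :=
  LinearEquiv.ofBijective
    { toFun := fun c => ∑ α, ordMonomial (Fin.append x y) α * (c α : A)
      map_add' := by intro c d; simp [mul_add, Finset.sum_add_distrib]
      map_smul' := by intro s c; simp [Finset.smul_sum] } (by
    constructor
    · rw [← LinearMap.ker_eq_bot, LinearMap.ker_eq_bot']
      intro c hc
      funext α
      exact Subtype.ext ((h.isDualDerivations hp2).eq_zero_of_sum_eq_zero (c := fun α => (c α : A))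
        (fun α => h.mem_centralizer_iff_der.mp (c α).2) hc α)
    · intro a
      obtain ⟨c, hc, rfl⟩ := (h.isDualDerivations hp2).exists_sum_of_mem ⊤ (fun _ _ _ => trivial)
        (fun _ _ _ => trivial) (a := a) trivial
      exact ⟨fun α => ⟨c α, h.mem_centralizer_iff_der.mpr (hc α).2⟩, rfl⟩)

theorem decomp_apply (h : IsDarboux ħ p x y) [hp : Fact p.Prime] [CharP A p] (hp2 : 2 < p)
    (c : (Fin (n + n) → Fin p) → h.centralizer) :
    h.decomp hp2 c = ∑ α, ordMonomial (Fin.append x y) α * (c α : A) := rfl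

/-- The coefficient of the monomial 1 is the projection. Through it the centralizer inherits
completeness and its adic filtration from A. -/
theorem exists_retraction (h : IsDarboux ħ p x y) [hp : Fact p.Prime] [CharP A p] (hp2 : 2 < p) :
    ∃ π : A →ₗ[S] h.centralizer, ∀ c : h.centralizer, π c = c := by
  let o : Fin (n + n) → Fin p := fun _ => ⟨0, hp.out.pos⟩
  refine ⟨LinearMap.proj o ∘ₗ (h.decomp hp2).symm.toLinearMap, fun c => ?_⟩
  have : (c : A) = h.decomp hp2 (Pi.single o c) := by
    rw [decomp_apply, Finset.sum_eq_single o]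
    · simp [ordMonomial, o, List.ofFn_const]
    · intro α _ hα
      rw [Pi.single_eq_of_ne hα]; simp
    · simp
  rw [LinearMap.comp_apply, this]
  simp

end IsDarboux

/-! ### Retracts -/

theorem Submodule.finrank_eq_add_of_bijective {k V W : Type*} [Field k] [AddCommGroup V] [Module k V]
    [AddCommGroup W] [Module k W] {R : Submodule k V} {R' : Submodule k W} [Module.Finite k R']
    {m : ℕ} (G : R →ₗ[k] R' × (Fin m → k)) (hG : ∀ v, G v = 0 → v = 0)
    (hG' : Function.Surjective G) : Module.finrank k R = Module.finrank k R' + m := by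
  rw [(LinearEquiv.ofBijective G ⟨(injective_iff_map_eq_zero G).mpr hG, hG'⟩).finrank_eq,
    Module.finrank_prod, Module.finrank_fin_fun]

section Retract

variable {S : Type*} [CommRing S] {𝔫 : Ideal S} {A C : Type*} [AddCommGroup A] [Module S A]
  [AddCommGroup C] [Module S C] (i : C →ₗ[S] A) (π : A →ₗ[S] C) (hπ : ∀ c, π (i c) = c)

include hπ in
theorem mem_adicFil_of_retract {N : ℕ} {c : C} (h : i c ∈ adicFil 𝔫 A N) : c ∈ adicFil 𝔫 C N := by
  have := adicFil_map π h
  rwa [hπ] at this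

include hπ in
theorem IsAdicComplete.of_retract (hA : IsAdicComplete 𝔫 A) : IsAdicComplete 𝔫 C where
  toIsHausdorff := ⟨fun c hc => by
    have : i c = 0 := hA.eq_zero_of_mem fun n => by
      have := hc n
      rw [SModEq.sub_mem, sub_zero] at this
      exact adicFil_map i this
    rw [← hπ c, this, map_zero]⟩
  toIsPrecomplete := ⟨fun f hf => by
    obtain ⟨L, hL⟩ := hA.prec' (fun n => i (f n)) (fun {m n} h => by
      have := hf h
      rw [SModEq.sub_mem] at this ⊢
      rw [← map_sub]
      exact adicFil_map i this)
    refine ⟨π L, fun n => ?_⟩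
    have := hL n
    rw [SModEq.sub_mem] at this ⊢
    have := adicFil_map π this
    rwa [map_sub, hπ] at this⟩

end Retract

namespace IsLocalQuantum

variable {p : ℕ} {k S : Type*} [Field k] [CommRing S] [Algebra k S] {ħ : S}
    {𝔫 : Ideal S} {A : Type*} [Ring A] [Algebra S A] [Algebra k A] [IsScalarTower k S A]
    {χ : A →ₐ[k] k}

/-- The restriction of the residue character to a subalgebra. -/
abbrev resChar (χ : A →ₐ[k] k) (C : Subalgebra S A) : C →ₐ[k] k :=
  χ.comp (C.val.restrictScalars k)

/-- Each axiom is verified in A and then projected. In particular the center of A lies in C, so a^p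
= z + ħ^(p-1) r projects to a^p = z + ħ^(p-1) π(r). -/
theorem of_retract (H : IsLocalQuantum p ħ 𝔫 χ) (C : Subalgebra S A)
    (hC : ∀ z ∈ Subring.center A, z ∈ C) (π : A →ₗ[S] C) (hπ : ∀ c : C, π c = c) :
    IsLocalQuantum p ħ 𝔫 (resChar χ C) where
  ħ_mem := H.ħ_mem
  χ_smul s hs a := H.χ_smul s hs a
  complete := IsAdicComplete.of_retract C.val.toLinearMap π hπ H.complete
  artinRees N := by
    obtain ⟨M, hM⟩ := H.artinRees N
    refine ⟨M, fun a ha => mem_adicFil_of_retract C.val.toLinearMap π hπ (hM a ?_)⟩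
    exact adicFil_map C.val.toLinearMap ha
  exists_comm a b := by
    obtain ⟨c, hc⟩ := H.exists_comm a b
    refine ⟨π c, ?_⟩
    rw [← map_smul, ← hc]
    exact (hπ (a * b - b * a)).symm
  weaklyCentral a := by
    obtain ⟨z, hz, r, -, h⟩ := H.weaklyCentral a
    refine ⟨⟨z, hC z hz⟩, ?_, π r, by simp [adicFil], ?_⟩
    · rw [Subring.mem_center_iff] at hz ⊢
      exact fun g => Subtype.ext (hz g)
    · have h1 : π ((a : A) ^ p) = a ^ p := hπ (a ^ p)
      have h2 : π z = ⟨z, hC z hz⟩ := hπ ⟨z, hC z hz⟩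
      rw [← h1, h, map_add, map_smul, h2]
  pow_mem a ha := mem_adicFil_of_retract C.val.toLinearMap π hπ (H.pow_mem a ha)
  finite := by
    have := H.finite
    refine Module.Finite.of_surjective (((adicFil 𝔫 A 1).mapQ (adicFil 𝔫 C 1) π
      (fun a ha => adicFil_map π ha)).restrictScalars k) ?_
    intro c
    obtain ⟨c, rfl⟩ := Submodule.mkQ_surjective _ c
    refine ⟨Submodule.Quotient.mk (c : A), ?_⟩
    change Submodule.Quotient.mk (π (c : A)) = _
    rw [hπ]; rfl

/-! ### The alternating form at the residue point -/

section ResidueForm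

variable [AlmostComm ħ A]

variable (ħ χ) in
/-- The alternating form `(a, b) ↦ χ {a, b}`. -/
noncomputable def residueForm : A →ₗ[k] A →ₗ[k] k :=
  LinearMap.mk₂ k (fun a b => χ (hbr ħ a b))
    (fun a b c => by rw [hbr_add_left, map_add])
    (fun c a b => by rw [hbr_ksmul_left, map_smul])
    (fun a b c => by rw [hbr_add_right, map_add])
    (fun c a b => by rw [hbr_ksmul_right, map_smul])

theorem residueForm_apply (a b : A) : residueForm ħ χ a b = χ (hbr ħ a b) := rfl

theorem residueForm_skew (a b : A) : residueForm ħ χ a b = -residueForm ħ χ b a := by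
  rw [residueForm_apply, hbr_skew, map_neg, residueForm_apply]

theorem finite_range_residueForm (H : IsLocalQuantum p ħ 𝔫 χ) :
    Module.Finite k (LinearMap.range (residueForm ħ χ)) := by
  have := H.finite
  have hle : (adicFil 𝔫 A 1).restrictScalars k ≤ LinearMap.ker (residueForm ħ χ) := by
    intro a ha
    rw [LinearMap.mem_ker]
    ext b
    exact H.χ_adicFil le_rfl (hbr_mem_adicFil_left ħ b ha)
  have h2 : Module.Finite k (A ⧸ (adicFil 𝔫 A 1).restrictScalars k) := this
  have h3 := Module.Finite.range (((adicFil 𝔫 A 1).restrictScalars k).liftQ (residueForm ħ χ) hle)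
  rwa [Submodule.range_liftQ] at h3

theorem mul_mem_ker_residueForm {a b : A} (ha : χ a = 0) (hb : χ b = 0) :
    a * b ∈ LinearMap.ker (residueForm ħ χ) := by
  rw [LinearMap.mem_ker]
  ext c
  have h : χ (hbr ħ c (a * b)) = 0 := χ_hbr_mul (χ := (χ : A →+* k)) ha hb c
  rw [residueForm_skew, residueForm_apply, h]
  simp

end ResidueForm

end IsLocalQuantum

/-! ### Rank of the form on the centralizer of a Darboux family -/

namespace IsDarboux

open IsLocalQuantum

variable {p : ℕ} {k S : Type*} [Field k] [CommRing S] [Algebra k S] {ħ : S}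
    {𝔫 : Ideal S} {A : Type*} [Ring A] [Algebra S A] [Algebra k A] [IsScalarTower k S A]
    {χ : A →ₐ[k] k} [AlmostComm ħ A] {n : ℕ} {x y : Fin n → A}

omit [Algebra k S] [IsScalarTower k S A] in
theorem der_eq (i : Fin (n + n)) : der ħ x y i = adh ħ (Fin.append (fun i => -y i) x i) := by
  refine Fin.addCases (fun i => ?_) (fun i => ?_) i
  · rw [der, Fin.append_left, Fin.append_left]
    ext b
    rw [LinearMap.neg_apply, adh_apply, adh_apply, hbr_neg_left]
  · rw [der, Fin.append_right, Fin.append_right]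

/-- Write t b = χ(b) t + t (b - χ(b)) for t one of the x i, y i. The last term is a product of two
elements of ker χ, so it lies in the radical; hence every nontrivial monomial contributes only
linear terms modulo the radical. -/
theorem exists_eq_add_sum_add (h : IsDarboux ħ p x y) [hp : Fact p.Prime] [CharP A p]
    (hp2 : 2 < p) (hx : ∀ i, χ (x i) = 0) (hy : ∀ i, χ (y i) = 0) (a : A) :
    ∃ c : h.centralizer, ∃ s : Fin (n + n) → k, ∃ r ∈ LinearMap.ker (residueForm ħ χ),
      a = c + ∑ i, s i • Fin.append x y i + r := by
  have ht : ∀ i, χ (Fin.append x y i) = 0 := fun i => by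
    refine Fin.addCases (fun i => ?_) (fun i => ?_) i
    · rw [Fin.append_left, hx]
    · rw [Fin.append_right, hy]
  set U : Submodule k A := (Subalgebra.toSubmodule h.centralizer).restrictScalars k ⊔
    Submodule.span k (Set.range (Fin.append x y)) ⊔ LinearMap.ker (residueForm ħ χ) with hU
  have h1 : ∀ i b, Fin.append x y i * b ∈ U := by
    intro i b
    have : Fin.append x y i * b = χ b • Fin.append x y i +
        Fin.append x y i * (b - algebraMap k A (χ b)) := by
      rw [mul_sub, ← Algebra.commutes, ← Algebra.smul_def]; abel
    rw [this]
    refine add_mem ?_ ?_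
    · exact Submodule.mem_sup_left (Submodule.mem_sup_right
        (Submodule.smul_mem _ _ (Submodule.subset_span ⟨i, rfl⟩)))
    · exact Submodule.mem_sup_right (mul_mem_ker_residueForm (ht i) (by simp))
  have h2 : ∀ (i : Fin (n + n)) (e : ℕ), ∀ b ∈ U, Fin.append x y i ^ e * b ∈ U := by
    intro i e b hb
    cases e with
    | zero => simpa using hb
    | succ e => rw [pow_succ', mul_assoc]; exact h1 _ _
  have h3 : ∀ (α : Fin (n + n) → Fin p), ∀ b ∈ U, ordMonomial (Fin.append x y) α * b ∈ U := by
    intro α b hb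
    unfold ordMonomial
    have : ∀ l : List A, (∀ u ∈ l, ∀ b ∈ U, u * b ∈ U) → ∀ b ∈ U, l.prod * b ∈ U := by
      intro l
      induction l with
      | nil => intro _ b hb; simpa using hb
      | cons u l ih =>
        intro hl b hb
        rw [List.prod_cons, mul_assoc]
        exact hl u List.mem_cons_self _ (ih (fun v hv => hl v (List.mem_cons_of_mem _ hv)) b hb)
    refine this _ (fun u hu => ?_) b hb
    obtain ⟨i, rfl⟩ := (List.mem_ofFn' _ _).mp hu
    exact h2 i _
  have haU : a ∈ U := by
    rw [← (h.decomp hp2).apply_symm_apply a, decomp_apply]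
    exact sum_mem fun α _ => h3 α _ (Submodule.mem_sup_left (Submodule.mem_sup_left
      ((h.decomp hp2).symm a α).2))
  obtain ⟨u, hu, r, hr, rfl⟩ := Submodule.mem_sup.mp haU
  obtain ⟨c, hc, v, hv, rfl⟩ := Submodule.mem_sup.mp hu
  obtain ⟨s, rfl⟩ := (Submodule.mem_span_range_iff_exists_fun k).mp hv
  exact ⟨⟨c, hc⟩, s, r, hr, rfl⟩

theorem isLocalQuantum_centralizer (h : IsDarboux ħ p x y) [hp : Fact p.Prime] [CharP k p]
    (hp2 : 2 < p) (H : IsLocalQuantum p ħ 𝔫 χ) :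
    IsLocalQuantum p ħ 𝔫 (resChar χ h.centralizer) := by
  have := charP (p := p) χ
  obtain ⟨π, hπ⟩ := h.exists_retraction hp2
  exact H.of_retract _ (fun z hz => h.center_le hz) π hπ

omit [Algebra k S] [Algebra k A] [IsScalarTower k S A] in
theorem coe_hbr_subalgebra (C : Subalgebra S A) [AlmostComm ħ C] (a b : C) :
    ((hbr ħ a b : C) : A) = hbr ħ (a : A) (b : A) :=
  (hbr_unique (by
    have := congrArg (Subtype.val) (smul_hbr ħ a b)
    exact this.symm)).symm

omit [Algebra k S] [Algebra k A] [IsScalarTower k S A] in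
-- The algebra is spanned by products of monomials in x, y with elements of the centralizer, and z
-- commutes with both factors. Thus p-th powers that are central in the centralizer stay central in
-- A.
theorem mem_center_of_centralizer (h : IsDarboux ħ p x y) [hp : Fact p.Prime] [CharP A p]
    (hp2 : 2 < p) {z : h.centralizer} (hz : z ∈ Subring.center h.centralizer) :
    (z : A) ∈ Subring.center A := by
  have ht : ∀ i, Commute (Fin.append x y i) (z : A) := fun i => by
    have := (Subalgebra.mem_centralizer_iff S).mp z.2
    exact this _ ⟨i, rfl⟩
  rw [Subring.mem_center_iff]
  intro a
  rw [← (h.decomp hp2).apply_symm_apply a, decomp_apply]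
  refine Commute.sum_left _ _ _ fun α _ => Commute.mul_left ?_ ?_
  · refine Commute.list_prod_left _ _ fun u hu => ?_
    obtain ⟨i, rfl⟩ := (List.mem_ofFn' _ _).mp hu
    exact (ht i).pow_left _
  · exact congrArg Subtype.val (Subring.mem_center_iff.mp hz _)

/-- Modulo the radical, A is the sum of the centralizer and the span of the x i, y i. The two are
orthogonal, and the form on the span is the standard symplectic one of rank 2n. So a functional in
the range is determined by its restriction to the centralizer and its 2n values on the x i, y i,
which are independent. -/
theorem finrank_range_residueForm (h : IsDarboux ħ p x y) [hp : Fact p.Prime] [CharP k p]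
    (hp2 : 2 < p) (H : IsLocalQuantum p ħ 𝔫 χ) (hx : ∀ i, χ (x i) = 0) (hy : ∀ i, χ (y i) = 0)
    [AlmostComm ħ h.centralizer] :
    Module.finrank k (LinearMap.range (residueForm ħ χ)) =
      Module.finrank k (LinearMap.range (residueForm ħ (resChar χ h.centralizer))) + (n + n) := by
  have := charP (p := p) χ
  have HC := h.isLocalQuantum_centralizer hp2 H
  set t := Fin.append x y with ht
  set t' : Fin (n + n) → A := Fin.append (fun i => -y i) x with ht'
  have hdual := h.isDualDerivations hp2
  have htt : ∀ i j, residueForm ħ χ (t' i) (t j) = if i = j then 1 else 0 := by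
    intro i j
    rw [residueForm_apply, ← adh_apply, ht', ← der_eq]
    split_ifs with hij
    · rw [← hij, hdual.apply_self, map_one]
    · rw [hdual.apply_ne i j hij, map_zero]
  have htc : ∀ i (c : h.centralizer), hbr ħ (t i) (c : A) = 0 := fun i c =>
    (hbr_eq_zero_iff ħ).mpr ((Subalgebra.mem_centralizer_iff S).mp c.2 _ ⟨i, rfl⟩)
  have ht'c : ∀ i (c : h.centralizer), hbr ħ (t' i) (c : A) = 0 := fun i c => by
    rw [← adh_apply, ht', ← der_eq]
    exact h.mem_centralizer_iff_der.mp c.2 i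
  have hres : ∀ c d : h.centralizer,
      residueForm ħ (resChar χ h.centralizer) c d = residueForm ħ χ (c : A) (d : A) := by
    intro c d
    rw [residueForm_apply, residueForm_apply, ← coe_hbr_subalgebra]; rfl
  let val : h.centralizer →ₗ[k] A := h.centralizer.val.toLinearMap.restrictScalars k
  have hval : ∀ φ ∈ LinearMap.range (residueForm ħ χ), φ ∘ₗ val ∈
      LinearMap.range (residueForm ħ (resChar χ h.centralizer)) := by
    rintro _ ⟨a, rfl⟩
    obtain ⟨c, s, r, hr, rfl⟩ := h.exists_eq_add_sum_add (χ := χ) hp2 hx hy a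
    refine ⟨c, ?_⟩
    ext d
    rw [hres, LinearMap.comp_apply, map_add, map_add, LinearMap.mem_ker.mp hr, add_zero, map_sum,
      LinearMap.add_apply, LinearMap.sum_apply, Finset.sum_eq_zero (fun i _ => ?_), add_zero]
    · rfl
    · rw [map_smul, LinearMap.smul_apply]
      have : residueForm ħ χ (t i) (d : A) = 0 := by rw [residueForm_apply, htc, map_zero]
      rw [show (val d : A) = d from rfl, this, smul_zero]
  let G : LinearMap.range (residueForm ħ χ) →ₗ[k]
      LinearMap.range (residueForm ħ (resChar χ h.centralizer)) × (Fin (n + n) → k) :=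
    LinearMap.prod
      (((LinearMap.lcomp k k val).comp (Submodule.subtype _)).codRestrict _ (fun φ => hval φ φ.2))
      ((LinearMap.pi fun i => LinearMap.applyₗ (t i)).comp (Submodule.subtype _))
  have hG1 : ∀ φ, ((G φ).1 : h.centralizer →ₗ[k] k) = (φ : A →ₗ[k] k) ∘ₗ val := fun _ => rfl
  have hG2 : ∀ φ i, (G φ).2 i = (φ : A →ₗ[k] k) (t i) := fun _ _ => rfl
  have hfin := HC.finite_range_residueForm
  refine Submodule.finrank_eq_add_of_bijective G ?_ ?_
  · rintro ⟨φ, a, rfl⟩ hφ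
    apply Subtype.ext
    ext b
    obtain ⟨c, s, r, hr, rfl⟩ := h.exists_eq_add_sum_add (χ := χ) hp2 hx hy b
    have e1 : residueForm ħ χ a (c : A) = 0 := by
      have := congrArg (fun q => (q.1 : h.centralizer →ₗ[k] k) c) hφ
      exact this
    have e2 : ∀ i, residueForm ħ χ a (t i) = 0 := fun i => congrArg (fun q => q.2 i) hφ
    have e3 : residueForm ħ χ a r = 0 := by
      rw [residueForm_skew, LinearMap.mem_ker.mp hr, LinearMap.zero_apply, neg_zero]
    change residueForm ħ χ a (c + ∑ i, s i • t i + r) = 0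
    rw [map_add, map_add, e1, e3, map_sum, Finset.sum_eq_zero (fun i _ => ?_), add_zero, add_zero]
    rw [map_smul, e2, smul_zero]
  · rintro ⟨⟨φ, c, rfl⟩, v⟩
    have e0 : ∀ i, residueForm ħ χ (c : A) (t i) = 0 := fun i => by
      rw [residueForm_skew, residueForm_apply, htc, map_zero, neg_zero]
    -- The family t' is dual to t under the form and orthogonal to the centralizer, so the added sum
    -- prescribes the values on t without changing the restriction.
    refine ⟨⟨residueForm ħ χ ((c : A) + ∑ i, v i • t' i), _, rfl⟩, ?_⟩
    refine Prod.ext (Subtype.ext ?_) ?_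
    · rw [hG1]
      ext d
      change residueForm ħ χ ((c : A) + ∑ i, v i • t' i) (d : A) = _
      rw [hres, map_add, map_sum, LinearMap.add_apply, LinearMap.sum_apply,
        Finset.sum_eq_zero (fun i _ => ?_), add_zero]
      · rw [map_smul, LinearMap.smul_apply]
        have : residueForm ħ χ (t' i) (d : A) = 0 := by rw [residueForm_apply, ht'c, map_zero]
        rw [this, smul_zero]
    · funext j
      rw [hG2]
      change residueForm ħ χ ((c : A) + ∑ i, v i • t' i) (t j) = v j
      rw [map_add, map_sum, LinearMap.add_apply, LinearMap.sum_apply, e0, zero_add,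
        Finset.sum_eq_single j]
      · rw [map_smul, LinearMap.smul_apply, htt, if_pos rfl, smul_eq_mul, mul_one]
      · intro i _ hij
        rw [map_smul, LinearMap.smul_apply, htt, if_neg hij, smul_zero]
      · simp

end IsDarboux

/-- A nonzero form gives a canonical pair. Its centralizer is again of the same kind with rank
smaller by 2, and the pairs found there by induction commute with the first one. The algebra is
quantified after n because the induction passes to the centralizer. -/
theorem IsLocalQuantum.exists_isDarboux {p : ℕ} {k S : Type*} [Field k] [CommRing S] [Algebra k S]
    {ħ : S} {𝔫 : Ideal S} [hp : Fact p.Prime] [CharP k p] [IsAlgClosed k] (hp2 : 2 < p) (n : ℕ) :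
    ∀ {A : Type u} [Ring A] [Algebra S A] [Algebra k A] [IsScalarTower k S A] {χ : A →ₐ[k] k}
    [AlmostComm ħ A] (_ : IsLocalQuantum p ħ 𝔫 χ)
    (_ : Module.finrank k (LinearMap.range (residueForm ħ χ)) = n + n),
    ∃ x y : Fin n → A, IsDarboux ħ p x y ∧ (∀ i, χ (x i) = 0) ∧ ∀ i, χ (y i) = 0 := by
  induction n with
  | zero =>
    intro A _ _ _ _ χ _ _ _
    exact ⟨fun i => i.elim0, fun i => i.elim0,
      ⟨fun i => i.elim0, fun i => i.elim0, fun i => i.elim0, fun i => i.elim0, fun i => i.elim0⟩,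
      fun i => i.elim0, fun i => i.elim0⟩
  | succ n ih =>
    intro A _ _ _ _ χ _ H hr
    have := charP (p := p) χ
    obtain ⟨a, b, hab⟩ : ∃ a b : A, χ (hbr ħ a b) ≠ 0 := by
      by_contra hcon
      push Not at hcon
      have : residueForm ħ χ = 0 := by ext a b; exact hcon a b
      rw [this, LinearMap.range_zero, finrank_bot] at hr
      omega
    obtain ⟨x₀, y₀, hx₀, hy₀, hxy, hxp, hyp⟩ := H.exists_canonical_pair hp2 hab
    have h0 : IsDarboux ħ p (fun _ : Fin 1 => x₀) (fun _ : Fin 1 => y₀) := by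
      refine ⟨fun _ _ => Commute.refl _, fun _ _ => Commute.refl _, fun i j => ?_, fun _ => hxp,
        fun _ => hyp⟩
      rw [if_pos (Subsingleton.elim i j), ← hxy, smul_hbr]
    have HC := h0.isLocalQuantum_centralizer hp2 H
    have := HC.almostComm
    have hrC := h0.finrank_range_residueForm hp2 H (fun _ => hx₀) (fun _ => hy₀)
    obtain ⟨x, y, h, hx, hy⟩ := ih HC (by omega)
    have hc : ∀ c : h0.centralizer, Commute x₀ (c : A) ∧ Commute y₀ (c : A) := fun c =>
      ⟨(h0.mem_centralizer.mp c.2).1 0, (h0.mem_centralizer.mp c.2).2 0⟩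
    refine ⟨Fin.cons x₀ fun i => (x i : A), Fin.cons y₀ fun i => (y i : A), ?_, ?_, ?_⟩
    · constructor
      · intro i j
        refine Fin.cases ?_ (fun i => ?_) i <;> refine Fin.cases ?_ (fun j => ?_) j <;>
          simp only [Fin.cons_zero, Fin.cons_succ]
        · exact Commute.refl _
        · exact (hc _).1
        · exact (hc _).1.symm
        · exact congrArg Subtype.val (h.xx i j)
      · intro i j
        refine Fin.cases ?_ (fun i => ?_) i <;> refine Fin.cases ?_ (fun j => ?_) j <;>
          simp only [Fin.cons_zero, Fin.cons_succ]
        · exact Commute.refl _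
        · exact (hc _).2
        · exact (hc _).2.symm
        · exact congrArg Subtype.val (h.yy i j)
      · intro i j
        refine Fin.cases ?_ (fun i => ?_) i <;> refine Fin.cases ?_ (fun j => ?_) j <;>
          simp only [Fin.cons_zero, Fin.cons_succ]
        · rw [if_pos trivial, ← hxy, smul_hbr]
        · rw [(hc _).1.eq, sub_self, if_neg (Fin.succ_ne_zero j).symm, smul_zero]
        · rw [(hc _).2.eq, sub_self, if_neg (Fin.succ_ne_zero i), smul_zero]
        · have := congrArg Subtype.val (h.xy i j)
          simp only [Fin.succ_inj]
          refine Eq.trans this ?_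
          split_ifs <;> rfl
      · intro i
        refine Fin.cases ?_ (fun i => ?_) i <;> simp only [Fin.cons_zero, Fin.cons_succ]
        · exact hxp
        · exact h0.mem_center_of_centralizer hp2 (h.xp i)
      · intro i
        refine Fin.cases ?_ (fun i => ?_) i <;> simp only [Fin.cons_zero, Fin.cons_succ]
        · exact hyp
        · exact h0.mem_center_of_centralizer hp2 (h.yp i)
    · intro i
      refine Fin.cases hx₀ (fun i => ?_) i
      exact hx i
    · intro i
      refine Fin.cases hy₀ (fun i => ?_) i
      exact hy i

/-! ### Completions -/

/-- The algebra `C` is the `𝔫`-adic completion of `A`. -/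
structure IsAdicCompletionHom {S : Type*} [CommRing S] (𝔫 : Ideal S) {A C : Type*} [Ring A] [Ring C]
    [Algebra S A] [Algebra S C] (π : A →ₐ[S] C) : Prop where
  complete : IsAdicComplete 𝔫 C
  mem_of_map_mem : ∀ a N, π a ∈ adicFil 𝔫 C N → a ∈ adicFil 𝔫 A N
  exists_sub_mem : ∀ c N, ∃ a, c - π a ∈ adicFil 𝔫 C N

namespace IsAdicCompletionHom

variable {S : Type*} [CommRing S] {𝔫 : Ideal S} {A C : Type*} [Ring A] [Ring C]
    [Algebra S A] [Algebra S C] {π : A →ₐ[S] C} (h : IsAdicCompletionHom 𝔫 π)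

theorem map_mem {a : A} {N : ℕ} (ha : a ∈ adicFil 𝔫 A N) : π a ∈ adicFil 𝔫 C N :=
  adicFil_map π.toLinearMap ha

include h

theorem exists_seq (c : C) : ∃ f : ℕ → A, (∀ i, c - π (f i) ∈ adicFil 𝔫 C i) ∧
    ∀ i, f (i + 1) - f i ∈ adicFil 𝔫 A i := by
  choose f hf using fun i => h.exists_sub_mem c i
  refine ⟨f, hf, fun i => h.mem_of_map_mem _ _ ?_⟩
  have := sub_mem (hf i) (adicFil_anti 𝔫 i.le_succ (hf (i + 1)))
  rw [map_sub]
  convert this using 1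
  abel

theorem exists_limit {f : ℕ → A} (hf : ∀ i, f (i + 1) - f i ∈ adicFil 𝔫 A i) :
    ∃ c, ∀ i, c - π (f i) ∈ adicFil 𝔫 C i :=
  h.complete.exists_limit fun i => by
    rw [← map_sub]; exact map_mem (hf i)

omit h in
theorem mul_sub_mem {a b : C} {a' b' : A} {i : ℕ} (ha : a - π a' ∈ adicFil 𝔫 C i)
    (hb : b - π b' ∈ adicFil 𝔫 C i) : a * b - π (a' * b') ∈ adicFil 𝔫 C i := by
  have : a * b - π (a' * b') = (a - π a') * b + π a' * (b - π b') := by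
    rw [map_mul]; noncomm_ring
  rw [this]
  exact add_mem (mul_mem_adicFil_left _ ha) (mul_mem_adicFil_right _ hb)

theorem artinRees {ħ : S} (hAR : ∀ N, ∃ M, ∀ a : A, ħ • a ∈ adicFil 𝔫 A M → a ∈ adicFil 𝔫 A N)
    (N : ℕ) : ∃ M, ∀ c : C, ħ • c ∈ adicFil 𝔫 C M → c ∈ adicFil 𝔫 C N := by
  obtain ⟨M, hM⟩ := hAR N
  refine ⟨max M N, fun c hc => ?_⟩
  obtain ⟨a, ha⟩ := h.exists_sub_mem c (max M N)
  have h1 : ħ • a ∈ adicFil 𝔫 A (max M N) := by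
    refine h.mem_of_map_mem _ _ ?_
    have := sub_mem hc (Submodule.smul_mem _ ħ ha)
    rwa [smul_sub, sub_sub_cancel, ← map_smul] at this
  have h2 := map_mem (π := π) (hM a (adicFil_anti 𝔫 (le_max_left _ _) h1))
  have := add_mem (adicFil_anti 𝔫 (le_max_right _ _) ha) h2
  rwa [sub_add_cancel] at this

theorem exists_comm {ħ : S} [AlmostComm ħ A] (a b : C) : ∃ c : C, a * b - b * a = ħ • c := by
  obtain ⟨f, hf, hf'⟩ := h.exists_seq a
  obtain ⟨g, hg, hg'⟩ := h.exists_seq b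
  obtain ⟨c, hc⟩ := h.exists_limit (f := fun i => hbr ħ (f i) (g i)) (fun i => by
    have : hbr ħ (f (i + 1)) (g (i + 1)) - hbr ħ (f i) (g i) =
        hbr ħ (f (i + 1) - f i) (g (i + 1)) + hbr ħ (f i) (g (i + 1) - g i) := by
      rw [hbr_sub_left, hbr_sub_right]; abel
    rw [this]
    exact add_mem (hbr_mem_adicFil_left ħ _ (hf' i)) (hbr_mem_adicFil_right ħ _ (hg' i)))
  refine ⟨c, h.complete.eq_of_sub_mem fun i => ?_⟩
  have h1 := sub_mem (sub_mem (mul_sub_mem (hf i) (hg i)) (mul_sub_mem (hg i) (hf i)))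
    (Submodule.smul_mem _ ħ (hc i))
  have h2 : π (f i * g i) - π (g i * f i) = ħ • π (hbr ħ (f i) (g i)) := by
    rw [← map_sub, ← map_smul, smul_hbr]
  convert h1 using 1
  rw [smul_sub, ← h2]
  abel

/-- The element r with f^p - ħ^(p-1) r central is not a continuous function of f, so it is
transported along an approximating sequence: when f changes by e ∈ 𝔫^(i+1) A, Jacobson's formula
allows r to change by an element of 𝔫^i A only. The limit of the r works for c. -/
theorem nearlyCentral_pow {ħ : S} [AlmostComm ħ A] (p : ℕ) [hp : Fact p.Prime] [CharP A p]
    (hp2 : 2 < p) (hwc : ∀ a : A, NearlyCentral ħ 𝔫 p 0 (a ^ p)) (c : C) :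
    NearlyCentral ħ 𝔫 p 0 (c ^ p) := by
  obtain ⟨f, hf, hf'⟩ := h.exists_seq c
  -- The sequence is shifted by one so that all increments lie in 𝔫A, as needed to control their
  -- p-th powers.
  replace hf : ∀ i, c - π (f (i + 1)) ∈ adicFil 𝔫 C i := fun i =>
    adicFil_anti 𝔫 i.le_succ (hf (i + 1))
  have hstep : ∀ i r, f (i + 1) ^ p - ħ ^ (p - 1) • r ∈ Subring.center A →
      ∃ r', f (i + 1 + 1) ^ p - ħ ^ (p - 1) • r' ∈ Subring.center A ∧ r' - r ∈ adicFil 𝔫 A i := by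
    intro i r hr
    set e := f (i + 1 + 1) - f (i + 1) with he
    have he' : e ∈ adicFil 𝔫 A (i + 1) := hf' (i + 1)
    obtain ⟨z, hz, s, hs, hzs⟩ := nearlyCentral_pow_of_mem p hp2 hwc i.succ_pos he'
    obtain ⟨t, ht, hadd⟩ := add_pow_char_adicFil (ħ := ħ) p hp2 (a := f (i + 1)) (b := e)
      (M := i + 1) (fun j => hbr_mem_adicFil_left ħ _ he')
    refine ⟨r + (s + ((adh ħ (f (i + 1)) ^ (p - 1)) e + t)), ?_, ?_⟩
    · have : f (i + 1 + 1) = f (i + 1) + e := by rw [he]; abel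
      rw [this, hadd, hzs]
      have := add_mem hr hz
      convert this using 1
      simp only [smul_add]
      abel
    · rw [add_sub_cancel_left]
      exact adicFil_anti 𝔫 i.le_succ (add_mem (adicFil_anti 𝔫 (i + 1).le_succ hs)
        (add_mem (adh_pow_mem_adicFil _ he' _) ht))
  obtain ⟨z, hz, r₀, -, hr₀⟩ := hwc (f 1)
  obtain ⟨r, -, hr, hr'⟩ := exists_dependent_seq
    (fun i r => f (i + 1) ^ p - ħ ^ (p - 1) • r ∈ Subring.center A)
    (fun i r r' => r' - r ∈ adicFil 𝔫 A i) (a := r₀) (by rw [hr₀, add_sub_cancel_right]; exact hz)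
    hstep
  obtain ⟨s, hs⟩ := h.exists_limit hr'
  refine ⟨c ^ p - ħ ^ (p - 1) • s, ?_, s, by simp [adicFil], by abel⟩
  rw [Subring.mem_center_iff]
  intro g
  refine h.complete.eq_of_sub_mem fun i => ?_
  obtain ⟨g', hg'⟩ := h.exists_sub_mem g i
  have h0 : c ^ p - ħ ^ (p - 1) • s - π (f (i + 1) ^ p - ħ ^ (p - 1) • r i) ∈ adicFil 𝔫 C i := by
    have h1 := sub_mem (sub_mem_adicFil_pow (hf i) p) (Submodule.smul_mem _ (ħ ^ (p - 1)) (hs i))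
    convert h1 using 1
    rw [map_sub, map_pow, map_smul, smul_sub]
    abel
  have h1 := sub_mem (mul_sub_mem hg' h0) (mul_sub_mem h0 hg')
  rw [Subring.mem_center_iff.mp (hr i) g'] at h1
  convert h1 using 1
  abel

/-- The completion of an algebra which satisfies all axioms of `IsLocalQuantum` except for
completeness. -/
theorem isLocalQuantum {p : ℕ} [hp : Fact p.Prime] (hp2 : 2 < p) {k : Type*} [Field k] [CharP k p]
    [Algebra k S] [Algebra k A] [IsScalarTower k S A] [Algebra k C] [IsScalarTower k S C] {ħ : S}
    [AlmostComm ħ A] (χ : A →ₐ[k] k) (χ' : C →ₐ[k] k) (hχ : ∀ a, χ' (π a) = χ a) (hħ : ħ ∈ 𝔫)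
    (hχ' : ∀ s ∈ 𝔫, ∀ c, χ' (s • c) = 0)
    (hAR : ∀ N, ∃ M, ∀ a : A, ħ • a ∈ adicFil 𝔫 A M → a ∈ adicFil 𝔫 A N)
    (hwc : ∀ a : A, NearlyCentral ħ 𝔫 p 0 (a ^ p))
    (hpow : ∀ a, χ a = 0 → a ^ p ∈ adicFil 𝔫 A 1)
    (hfin : Module.Finite k (A ⧸ adicFil 𝔫 A 1)) : IsLocalQuantum p ħ 𝔫 χ' where
  ħ_mem := hħ
  χ_smul := hχ'
  complete := h.complete
  artinRees := h.artinRees hAR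
  exists_comm := h.exists_comm
  weaklyCentral := by
    have := IsLocalQuantum.charP (p := p) χ
    exact h.nearlyCentral_pow p hp2 hwc
  pow_mem c hc := by
    obtain ⟨a, ha⟩ := h.exists_sub_mem c 1
    have h1 : χ' (c - π a) = 0 := by
      refine adicFil_induction (P := fun c => χ' c = 0) (fun s hs c => hχ' s (by simpa using hs) c)
        (fun x _ y _ hx hy => by rw [map_add, hx, hy, add_zero]) ha
    rw [map_sub, hc, zero_sub, neg_eq_zero, hχ] at h1
    have h2 := add_mem (sub_mem_adicFil_pow ha p) (map_mem (π := π) (hpow a h1))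
    rwa [map_pow, sub_add_cancel] at h2
  finite := by
    refine Module.Finite.of_surjective (((adicFil 𝔫 A 1).mapQ (adicFil 𝔫 C 1) π.toLinearMap
      (fun a ha => map_mem ha)).restrictScalars k) ?_
    intro c
    obtain ⟨c, rfl⟩ := Submodule.mkQ_surjective _ c
    obtain ⟨a, ha⟩ := h.exists_sub_mem c 1
    refine ⟨Submodule.Quotient.mk a, ?_⟩
    change Submodule.Quotient.mk (π a) = Submodule.Quotient.mk c
    rw [eq_comm, Submodule.Quotient.eq]
    exact ha

end IsAdicCompletionHom

/-! ### Divisibility by a non-zero-divisor and adic filtrations -/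

/-- A consequence of the Artin–Rees lemma for modules which need not be finite. -/
theorem exists_smul_mem_adicFil_imp {S : Type*} [CommRing S] [IsNoetherianRing S] (𝔫 : Ideal S)
    {ħ : S} {A : Type*} [AddCommGroup A] [Module S A] (htf : ∀ a : A, ħ • a = 0 → a = 0)
    {m : ℕ} (c : Fin m → A) (hc : ∀ a : A, ∃ (s : Fin m → S) (b : A), a = ∑ i, s i • c i + ħ • b)
    (N : ℕ) : ∃ M, ∀ a : A, ħ • a ∈ adicFil 𝔫 A M → a ∈ adicFil 𝔫 A N := by
  let g : (Fin m → S) →ₗ[S] A := Fintype.linearCombination S c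
  have hg : ∀ s, g s = ∑ i, s i • c i := fun s => Fintype.linearCombination_apply S c s
  -- K consists of the relations among the c i modulo ħ. Artin–Rees in the finite module S^m turns a
  -- vector of K lying in 𝔫^(N+d) S^m into an element of 𝔫^N K, whose image is ħ times an element of
  -- 𝔫^N A.
  let K : Submodule S (Fin m → S) := (LinearMap.range (LinearMap.lsmul S A ħ)).comap g
  obtain ⟨d, hd⟩ := 𝔫.exists_pow_inf_eq_pow_smul K
  have h1 : ∀ M, ∀ a ∈ adicFil 𝔫 A M, ∃ v ∈ adicFil 𝔫 (Fin m → S) M, ∃ b ∈ adicFil 𝔫 A M,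
      a = g v + ħ • b := by
    intro M a ha
    refine Submodule.smul_induction_on ha ?_ ?_
    · intro s hs a _
      obtain ⟨v, b, rfl⟩ := hc a
      refine ⟨s • v, smul_mem_adicFil hs v, s • b, smul_mem_adicFil hs b, ?_⟩
      rw [map_smul, hg, smul_add, smul_comm ħ]
    · rintro _ _ ⟨v, hv, b, hb, rfl⟩ ⟨v', hv', b', hb', rfl⟩
      exact ⟨v + v', add_mem hv hv', b + b', add_mem hb hb', by rw [map_add, smul_add]; abel⟩
  have h2 : ∀ v ∈ 𝔫 ^ N • K, ∃ b ∈ adicFil 𝔫 A N, g v = ħ • b := by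
    intro v hv
    refine Submodule.smul_induction_on hv ?_ ?_
    · rintro s hs v ⟨b, hb⟩
      refine ⟨s • b, smul_mem_adicFil hs b, ?_⟩
      rw [map_smul, ← hb, LinearMap.lsmul_apply, smul_comm]
    · rintro v v' ⟨b, hb, h⟩ ⟨b', hb', h'⟩
      exact ⟨b + b', add_mem hb hb', by rw [map_add, h, h', smul_add]⟩
  refine ⟨N + d, fun a ha => ?_⟩
  obtain ⟨v, hv, b, hb, hab⟩ := h1 _ _ ha
  have hvK : v ∈ K := ⟨a - b, by rw [LinearMap.lsmul_apply, smul_sub, hab]; abel⟩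
  have hvN : v ∈ 𝔫 ^ N • K := by
    have : v ∈ 𝔫 ^ (N + d) • ⊤ ⊓ K := ⟨hv, hvK⟩
    rw [hd _ (Nat.le_add_left d N), Nat.add_sub_cancel] at this
    exact Submodule.smul_mono le_rfl inf_le_right this
  obtain ⟨b', hb', h'⟩ := h2 v hvN
  have : a - (b' + b) = 0 := htf _ (by rw [smul_sub, smul_add, hab, h', sub_self])
  rw [sub_eq_zero.mp this]
  exact add_mem hb' (adicFil_anti 𝔫 (Nat.le_add_right N d) hb)

/-! ### The completion at a two-sided ideal -/

section AdicCompletionAlg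

variable {S : Type*} [CommRing S] {A : Type*} [Ring A] [Algebra S A] {J : Ideal A} [J.IsTwoSided]

variable (S J) in
/-- The canonical map to the completion at a two-sided ideal. -/
def toAdicCompletionAlg : A →ₐ[S] adicCompletionAlg S J :=
  AlgHom.codRestrict (AlgHom.pi fun n => Ideal.Quotient.mkₐ S (J ^ n)) _ fun _ _ _ _ => rfl

omit [J.IsTwoSided] in
-- The exponent uses K + 1 because splitting J^(a+b) as J^a J^b requires b ≠ 0: J^0 is the whole
-- ring, and for a left ideal J the product of J with the ring may exceed J.
theorem map_pow_mem_adicFil {𝔫 : Ideal S} {B : Type*} [Ring B] {J : Ideal B} (φ : B →+* A) {K : ℕ}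
    (hK : ∀ a ∈ J ^ K, φ a ∈ adicFil 𝔫 A 1) (n : ℕ) :
    ∀ a ∈ J ^ ((K + 1) * n), φ a ∈ adicFil 𝔫 A n := by
  induction n with
  | zero => simp [adicFil]
  | succ n ih =>
    intro a ha
    rw [Nat.mul_succ, Submodule.pow_add _ K.succ_ne_zero] at ha
    refine Submodule.mul_induction_on ha ?_ (fun _ _ ha hb => by rw [map_add]; exact add_mem ha hb)
    intro a ha b hb
    rw [map_mul]
    exact mul_mem_adicFil (ih _ ha) (hK b (Ideal.pow_le_pow_right K.le_succ hb))

omit [J.IsTwoSided] in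
theorem smul_mem_pow_of_mem {𝔫 : Ideal S} (h : ∀ a ∈ adicFil 𝔫 A 1, a ∈ J) (n : ℕ) :
    ∀ a ∈ adicFil 𝔫 A n, a ∈ J ^ n := by
  induction n with
  | zero => intro a _; rw [Submodule.pow_zero, Ideal.one_eq_top]; trivial
  | succ n ih =>
    intro a ha
    refine adicFil_induction (P := fun a => a ∈ J ^ (n + 1)) ?_ (fun x _ y _ => add_mem) ha
    intro s hs a
    rw [pow_succ] at hs
    refine Submodule.smul_induction_on hs ?_ ?_
    · intro s hs t ht
      have : (s • t) • a = (s • 1) * (t • a) := by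
        rw [smul_mul_assoc, one_mul, smul_eq_mul, mul_smul]
      rw [this, Submodule.pow_succ]
      exact Submodule.mul_mem_mul (ih _ (smul_mem_adicFil hs _))
        (h _ (smul_mem_adicFil (by simpa using ht) _))
    · intro s t hs ht
      rw [add_smul]; exact add_mem hs ht

/-- The powers of J and the 𝔫^n A are cofinal, so the completion at J is the 𝔫-adic completion as an
S-module; the latter is complete because 𝔫 is finitely generated. -/
theorem isAdicCompletionHom_toAdicCompletionAlg {𝔫 : Ideal S} (hfg : 𝔫.FG)
    (h : ∀ a ∈ adicFil 𝔫 A 1, a ∈ J) {K : ℕ} (hK : ∀ a ∈ J ^ K, a ∈ adicFil 𝔫 A 1) :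
    IsAdicCompletionHom 𝔫 (toAdicCompletionAlg S J) := by
  have hJ := smul_mem_pow_of_mem h
  have hJ' : ∀ n, ∀ a ∈ J ^ ((K + 1) * n), a ∈ adicFil 𝔫 A n :=
    map_pow_mem_adicFil (RingHom.id A) hK
  let rep (n : ℕ) (x : A ⧸ J ^ n) : A := Quotient.out x
  have hrep : ∀ n x, Ideal.Quotient.mk (J ^ n) (rep n x) = x := fun n x => Quotient.out_eq x
  have hrep' : ∀ (f : adicCompletionAlg S J) m n, m ≤ n →
      Ideal.Quotient.mk (J ^ m) (rep n (f.1 n)) = f.1 m := by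
    intro f m n hmn
    rw [← f.2 m n hmn, ← Ideal.Quotient.factor_mk (Ideal.pow_le_pow_right hmn), hrep]
  -- The component modulo 𝔫^n A is read off from the component modulo J^((K+1)n), which is contained
  -- in 𝔫^n A.
  obtain ⟨E₀, hE₀⟩ : ∃ E₀ : adicCompletionAlg S J → AdicCompletion 𝔫 A, ∀ f n,
      (E₀ f).val n = Submodule.Quotient.mk (rep ((K + 1) * n) (f.1 ((K + 1) * n))) := by
    refine ⟨fun f => ⟨fun n => Submodule.Quotient.mk (rep ((K + 1) * n) (f.1 ((K + 1) * n))),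
      fun {m n} hmn => ?_⟩, fun _ _ => rfl⟩
    change Submodule.Quotient.mk _ = Submodule.Quotient.mk _
    rw [Submodule.Quotient.eq]
    refine hJ' m _ (Ideal.Quotient.eq.mp ?_)
    rw [LinearMap.id_apply, hrep, hrep' f _ _ (Nat.mul_le_mul_left _ hmn)]
  let E : adicCompletionAlg S J →ₗ[S] AdicCompletion 𝔫 A :=
    { toFun := E₀
      map_add' f g := by
        ext n
        rw [AdicCompletion.val_add_apply, hE₀, hE₀, hE₀, ← Submodule.Quotient.mk_add,
          Submodule.Quotient.eq]
        refine hJ' n _ (Ideal.Quotient.eq.mp ?_)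
        rw [map_add, hrep, hrep, hrep]; rfl
      map_smul' s f := by
        ext n
        rw [RingHom.id_apply, AdicCompletion.val_smul_apply, hE₀, hE₀,
          ← Submodule.Quotient.mk_smul, Submodule.Quotient.eq]
        refine hJ' n _ (Ideal.Quotient.eq.mp ?_)
        rw [hrep]
        change s • f.1 _ = s • Ideal.Quotient.mk (J ^ ((K + 1) * n)) _
        rw [hrep] }
  have hE : ∀ f n, (E f).val n = Submodule.Quotient.mk (rep ((K + 1) * n) (f.1 ((K + 1) * n))) :=
    hE₀
  have hEof : ∀ a, E (toAdicCompletionAlg S J a) = AdicCompletion.of 𝔫 A a := by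
    intro a
    ext n
    rw [hE]
    change Submodule.Quotient.mk _ = Submodule.Quotient.mk _
    rw [Submodule.Quotient.eq]
    exact hJ' n _ (Ideal.Quotient.eq.mp (hrep _ _))
  have hbij : Function.Bijective E := by
    constructor
    · refine (injective_iff_map_eq_zero E).mpr fun f hf => Subtype.ext (funext fun n => ?_)
      have h1 : (E f).val n = 0 := by rw [hf]; rfl
      rw [hE, Submodule.Quotient.mk_eq_zero] at h1
      have h2 := hJ n _ h1
      rw [← Ideal.Quotient.eq_zero_iff_mem, hrep' f n _ (Nat.le_mul_of_pos_left n K.succ_pos)] at h2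
      exact h2
    · intro g
      let g' (n : ℕ) : A := Quotient.out (g.val n)
      have hg' : ∀ n, Submodule.Quotient.mk (g' n) = g.val n := fun n => Quotient.out_eq _
      have hg'' : ∀ m n, m ≤ n → g' n - g' m ∈ adicFil 𝔫 A m := by
        intro m n hmn
        rw [← Submodule.Quotient.eq, hg', ← g.2 hmn, ← hg' n]
        rfl
      refine ⟨⟨fun n => Ideal.Quotient.mk _ (g' n), fun m n hmn => ?_⟩, ?_⟩
      · rw [Ideal.Quotient.factor_mk, Ideal.Quotient.eq]
        exact hJ m _ (hg'' m n hmn)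
      · ext n
        rw [hE, ← hg' n, Submodule.Quotient.eq]
        have h1 := hJ' n _ (Ideal.Quotient.eq.mp (hrep ((K + 1) * n)
          (Ideal.Quotient.mk _ (g' ((K + 1) * n)))))
        have h2 := add_mem h1 (hg'' n _ (Nat.le_mul_of_pos_left n K.succ_pos))
        rwa [sub_add_sub_cancel] at h2
  let e := LinearEquiv.ofBijective E hbij
  have hmem : ∀ f N, (E f).val N = 0 → f ∈ adicFil 𝔫 (adicCompletionAlg S J) N := by
    intro f N hf
    have h1 : E f ∈ adicFil 𝔫 (AdicCompletion 𝔫 A) N := by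
      rw [adicFil, AdicCompletion.pow_smul_top_eq_ker_eval hfg]
      exact hf
    have h2 := adicFil_map e.symm.toLinearMap h1
    rwa [show e.symm.toLinearMap (E f) = f from e.symm_apply_apply f] at h2
  refine ⟨IsAdicComplete.of_retract e.toLinearMap e.symm.toLinearMap e.symm_apply_apply
    (AdicCompletion.isAdicComplete hfg), fun a N ha => ?_, fun f N => ?_⟩
  · have h1 := AdicCompletion.pow_smul_top_le_ker_eval 𝔫 N (adicFil_map E ha)
    rw [hEof, LinearMap.mem_ker, AdicCompletion.eval_of, Submodule.mkQ_apply,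
      Submodule.Quotient.mk_eq_zero] at h1
    exact h1
  · refine ⟨rep ((K + 1) * N) (f.1 ((K + 1) * N)), hmem _ _ ?_⟩
    rw [map_sub, hEof]
    change (E f).val N - Submodule.Quotient.mk _ = 0
    rw [hE, sub_self]

end AdicCompletionAlg

/-! ### Change of base ring and extension of maps to the completion -/

section AdicCompletionAlg

variable {R S : Type*} [CommRing R] [CommRing S] {A : Type*} [Ring A] [Algebra R A]
  {J : Ideal A} [J.IsTwoSided]

variable (R S J) in
/-- The completion at a two-sided ideal does not depend on the base ring. -/
def adicCompletionAlgEquiv [Algebra R S] [Algebra S A] [IsScalarTower R S A] :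
    adicCompletionAlg R J ≃ₐ[R] adicCompletionAlg S J where
  toFun f := ⟨f.1, f.2⟩
  invFun f := ⟨f.1, f.2⟩
  left_inv _ := rfl
  right_inv _ := rfl
  map_mul' _ _ := rfl
  map_add' _ _ := rfl
  commutes' _ := rfl

/-- The value at f is the limit of φ on representatives of its components. Separatedness makes this
limit independent of choices, which yields compatibility with sums, products and scalars. -/
theorem adicCompletionAlg.exists_lift {C : Type*} [Ring C] [Algebra R C] [Algebra S C]
    {𝔫 : Ideal S} (hC : IsAdicComplete 𝔫 C) (φ : A →ₐ[R] C) {K : ℕ}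
    (hφ : ∀ n, ∀ a ∈ J ^ (K * n), φ a ∈ adicFil 𝔫 C n) :
    ∃ Φ : adicCompletionAlg R J →ₐ[R] C, ∀ (f : adicCompletionAlg R J) (n : ℕ) (a : A),
      Ideal.Quotient.mk (J ^ (K * n)) a = f.1 (K * n) → Φ f - φ a ∈ adicFil 𝔫 C n := by
  have hex : ∀ f : adicCompletionAlg R J, ∃ c : C, ∀ (n : ℕ) (a : A),
      Ideal.Quotient.mk (J ^ (K * n)) a = f.1 (K * n) → c - φ a ∈ adicFil 𝔫 C n := by
    intro f
    choose g hg using fun n => Ideal.Quotient.mk_surjective (f.1 (K * n))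
    obtain ⟨c, hc⟩ := hC.exists_limit (f := fun n => φ (g n)) (fun n => by
      rw [← map_sub]
      refine hφ n _ (Ideal.Quotient.eq.mp ?_)
      rw [hg n, ← f.2 _ _ (Nat.mul_le_mul_left K n.le_succ), ← hg (n + 1), Ideal.Quotient.factor_mk])
    refine ⟨c, fun n a ha => ?_⟩
    have h1 : φ (g n) - φ a ∈ adicFil 𝔫 C n := by
      rw [← map_sub]
      refine hφ n _ (Ideal.Quotient.eq.mp ?_)
      rw [hg, ha]
    have := add_mem (hc n) h1
    rwa [sub_add_sub_cancel] at this
  choose Φ hΦ using hex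
  have huniq : ∀ (f : adicCompletionAlg R J) (c : C), (∀ n, ∃ a,
      Ideal.Quotient.mk (J ^ (K * n)) a = f.1 (K * n) ∧ c - φ a ∈ adicFil 𝔫 C n) → Φ f = c := by
    intro f c h
    refine hC.eq_of_sub_mem fun n => ?_
    obtain ⟨a, ha, hca⟩ := h n
    have := sub_mem (hΦ f n a ha) hca
    rwa [sub_sub_sub_cancel_right] at this
  have hmk := fun (f : adicCompletionAlg R J) n => Ideal.Quotient.mk_surjective (f.1 (K * n))
  have hcomm : ∀ r, Φ (algebraMap R _ r) = algebraMap R C r := fun r => by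
    refine huniq _ _ fun n => ⟨algebraMap R A r, rfl, ?_⟩
    rw [AlgHom.commutes, sub_self]
    exact zero_mem _
  refine ⟨{ toFun := Φ
            map_one' := by simpa using hcomm 1
            map_zero' := by simpa using hcomm 0
            map_mul' := fun f g => ?_
            map_add' := fun f g => ?_
            commutes' := hcomm }, hΦ⟩
  · refine huniq _ _ fun n => ?_
    obtain ⟨a, ha⟩ := hmk f n
    obtain ⟨b, hb⟩ := hmk g n
    refine ⟨a * b, by rw [map_mul, ha, hb]; rfl, ?_⟩
    have : Φ f * Φ g - φ (a * b) = (Φ f - φ a) * Φ g + φ a * (Φ g - φ b) := by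
      rw [map_mul]; noncomm_ring
    rw [this]
    exact add_mem (mul_mem_adicFil_left _ (hΦ f n a ha)) (mul_mem_adicFil_right _ (hΦ g n b hb))
  · refine huniq _ _ fun n => ?_
    obtain ⟨a, ha⟩ := hmk f n
    obtain ⟨b, hb⟩ := hmk g n
    refine ⟨a + b, by rw [map_add, ha, hb]; rfl, ?_⟩
    rw [map_add, add_sub_add_comm]
    exact add_mem (hΦ f n a ha) (hΦ g n b hb)

end AdicCompletionAlg

/-! ### Rings which are commutative modulo an ideal -/

/-- The quotient by a two-sided ideal which contains all commutators. -/
abbrev Ideal.Quotient.commRingOfCommutator {A : Type*} [Ring A] (I : Ideal A) [I.IsTwoSided]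
    (h : ∀ a b : A, a * b - b * a ∈ I) : CommRing (A ⧸ I) :=
  { (inferInstance : Ring (A ⧸ I)) with
    mul_comm := by
      intro a b
      obtain ⟨a, rfl⟩ := Ideal.Quotient.mk_surjective a
      obtain ⟨b, rfl⟩ := Ideal.Quotient.mk_surjective b
      rw [← map_mul, ← map_mul, Ideal.Quotient.eq]
      exact h a b }

theorem exists_pow_mem_of_le_radical {A Q : Type*} [Ring A] [CommRing Q] (f : A →+* Q) {J : Ideal A}
    {J' I' : Ideal Q} (hJ : ∀ a ∈ J, f a ∈ J') (hfg : J'.FG) (hrad : J' ≤ I'.radical) :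
    ∃ K, ∀ a ∈ J ^ K, f a ∈ I' := by
  obtain ⟨K, hK⟩ := Ideal.exists_pow_le_of_le_radical_of_fg hrad hfg
  refine ⟨K, fun a ha => hK ?_⟩
  have : ∀ n, ∀ a ∈ J ^ n, f a ∈ J' ^ n := by
    intro n
    induction n with
    | zero => simp
    | succ n ih =>
      intro a ha
      rw [Submodule.pow_succ] at ha
      refine Submodule.mul_induction_on ha ?_
        (fun _ _ ha hb => by rw [map_add]; exact add_mem ha hb)
      intro a ha b hb
      rw [map_mul, pow_succ]
      exact Ideal.mul_mem_mul (ih a ha) (hJ b hb)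
  exact this K a ha

/-- Modulo F the ring is commutative and t i ^ p = 0, so multiplying a monomial by t i raises one
exponent or gives 0. -/
theorem mul_ordMonomial_mem {S A : Type*} [CommRing S] [Ring A] [Algebra S A] {F : Submodule S A}
    (hl : ∀ a, ∀ f ∈ F, a * f ∈ F) (hr : ∀ a, ∀ f ∈ F, f * a ∈ F) (hc : ∀ a b : A, a * b - b * a ∈ F)
    {p m : ℕ} (t : Fin m → A) (ht : ∀ i, t i ^ p ∈ F) (i : Fin m) (α : Fin m → Fin p) :
    t i * ordMonomial t α ∈ Submodule.span S (Set.range (ordMonomial (p := p) t)) ⊔ F := by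
  induction m with
  | zero => exact i.elim0
  | succ m ih =>
    have hα : α = Fin.cons (α 0) (Fin.tail α) := (Fin.cons_self_tail α).symm
    rw [hα, ordMonomial_cons]
    refine Fin.cases ?_ (fun i => ?_) i
    · rw [← mul_assoc, ← pow_succ']
      by_cases h : (α 0 : ℕ) + 1 < p
      · have : t 0 ^ ((α 0 : ℕ) + 1) * ordMonomial (fun i => t i.succ) (Fin.tail α) =
            ordMonomial t (Fin.cons ⟨(α 0 : ℕ) + 1, h⟩ (Fin.tail α) : Fin (m + 1) → Fin p) := by
          rw [ordMonomial_cons]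
        rw [this]
        exact Submodule.mem_sup_left (Submodule.subset_span ⟨_, rfl⟩)
      · have h' : (α 0 : ℕ) + 1 = p := by have := (α 0).2; omega
        rw [h']
        exact Submodule.mem_sup_right (hr _ _ (ht 0))
    · have h1 := ih (fun i => t i.succ) (fun i => ht _) i (Fin.tail α)
      obtain ⟨u, hu, f, hf, huf⟩ := Submodule.mem_sup.mp h1
      have h2 : t i.succ * (t 0 ^ (α 0 : ℕ) * ordMonomial (fun i => t i.succ) (Fin.tail α)) =
          t 0 ^ (α 0 : ℕ) * u + (t 0 ^ (α 0 : ℕ) * f + (t i.succ * t 0 ^ (α 0 : ℕ) -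
            t 0 ^ (α 0 : ℕ) * t i.succ) * ordMonomial (fun i => t i.succ) (Fin.tail α)) := by
        rw [← add_assoc, ← mul_add, huf]; noncomm_ring
      rw [h2]
      refine add_mem (Submodule.mem_sup_left ?_)
        (Submodule.mem_sup_right (add_mem (hl _ _ hf) (hr _ _ (hc _ _))))
      refine Submodule.span_induction (p := fun u _ => t 0 ^ (α 0 : ℕ) * u ∈ _) ?_ ?_ ?_ ?_ hu
      · rintro _ ⟨β, rfl⟩
        exact Submodule.subset_span ⟨Fin.cons (α 0) β, ordMonomial_cons _ _ _⟩
      · simp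
      · intro x y _ _ hx hy
        rw [mul_add]; exact add_mem hx hy
      · intro s x _ hx
        rw [mul_smul_comm]; exact Submodule.smul_mem _ _ hx

theorem commutator_mem_of_adjoin_eq_top {R A : Type*} [CommRing R] [Ring A] [Algebra R A]
    {F : AddSubgroup A} (hl : ∀ a, ∀ f ∈ F, a * f ∈ F) (hr : ∀ a, ∀ f ∈ F, f * a ∈ F)
    {T : Set A} (hT : Algebra.adjoin R T = ⊤) (h : ∀ s ∈ T, ∀ t ∈ T, s * t - t * s ∈ F) (a b : A) :
    a * b - b * a ∈ F := by
  have key : ∀ c : A, (∀ t ∈ T, c * t - t * c ∈ F) → ∀ b, c * b - b * c ∈ F := by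
    intro c hc b
    have hb : b ∈ Algebra.adjoin R T := hT ▸ trivial
    refine Algebra.adjoin_induction (p := fun b _ => c * b - b * c ∈ F) hc ?_ ?_ ?_ hb
    · intro r
      rw [Algebra.commutes, sub_self]; exact zero_mem _
    · intro x y _ _ hx hy
      have := add_mem hx hy
      convert this using 1
      noncomm_ring
    · intro x y _ _ hx hy
      have := add_mem (hr y _ hx) (hl x _ hy)
      convert this using 1
      noncomm_ring
  refine key a (fun t ht => ?_) b
  have := key t (fun s hs => h t ht s hs) a
  rw [← neg_sub]
  exact neg_mem this

/-! ### Actions of polynomial rings through central elements -/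

section CentralAction

variable {R A ι : Type*} [CommRing R] [Ring A] [Algebra R A]

/-- The algebra structure over a polynomial ring whose variables act by given central elements. -/
noncomputable abbrev centralAction (z : ι → A) (hz : ∀ i, z i ∈ Subalgebra.center R A) :
    Algebra (MvPolynomial ι R) A :=
  RingHom.toAlgebra' ((Subalgebra.center R A).val.toRingHom.comp
    (MvPolynomial.aeval (fun i => (⟨z i, hz i⟩ : Subalgebra.center R A))).toRingHom)
    (fun _ a => ((Subalgebra.mem_center_iff.mp (Subtype.prop _)) a).symm)

theorem centralAction_algebraMap_X (z : ι → A) (hz : ∀ i, z i ∈ Subalgebra.center R A) (i : ι) :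
    letI := centralAction z hz
    algebraMap (MvPolynomial ι R) A (MvPolynomial.X i) = z i := by
  change ((MvPolynomial.aeval (fun i => (⟨z i, hz i⟩ : Subalgebra.center R A))
    (MvPolynomial.X i) : Subalgebra.center R A) : A) = z i
  rw [MvPolynomial.aeval_X]

theorem centralAction_isScalarTower (z : ι → A) (hz : ∀ i, z i ∈ Subalgebra.center R A) :
    letI := centralAction z hz
    IsScalarTower R (MvPolynomial ι R) A := by
  let := centralAction z hz
  refine IsScalarTower.of_algebraMap_eq fun r => ?_
  change _ = ((MvPolynomial.aeval (fun i => (⟨z i, hz i⟩ : Subalgebra.center R A))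
    (algebraMap R (MvPolynomial ι R) r) : Subalgebra.center R A) : A)
  rw [AlgHom.commutes]
  rfl

end CentralAction

/-- The ideal generated by the variables and by the variable of the coefficient ring. -/
noncomputable def fullIdeal (k ι : Type*) [Field k] : Ideal (MvPolynomial ι k⟦X⟧) :=
  Ideal.span (insert (MvPolynomial.C PowerSeries.X) (Set.range MvPolynomial.X))

theorem fullIdeal_fg (k ι : Type*) [Field k] [Finite ι] : (fullIdeal k ι).FG :=
  Submodule.fg_span ((Set.finite_range _).insert _)

theorem exists_sub_mem_fullIdeal {k ι : Type*} [Field k] (s : MvPolynomial ι k⟦X⟧) :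
    ∃ c : k, s - algebraMap k _ c ∈ fullIdeal k ι := by
  induction s using MvPolynomial.induction_on with
  | C f =>
    refine ⟨PowerSeries.constantCoeff f, ?_⟩
    have h1 : f - PowerSeries.C (PowerSeries.constantCoeff f) ∈ Ideal.span {(PowerSeries.X : k⟦X⟧)} := by
      rw [Ideal.mem_span_singleton, PowerSeries.X_dvd_iff]
      simp
    obtain ⟨g, hg⟩ := Ideal.mem_span_singleton.mp h1
    have h2 : MvPolynomial.C f - algebraMap k (MvPolynomial ι k⟦X⟧) (PowerSeries.constantCoeff f) =
        MvPolynomial.C PowerSeries.X * MvPolynomial.C g := by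
      rw [← map_mul, ← hg, map_sub]
      rfl
    rw [h2]
    exact Ideal.mul_mem_right _ _ (Ideal.subset_span (Set.mem_insert _ _))
  | add s t hs ht =>
    obtain ⟨c, hc⟩ := hs
    obtain ⟨d, hd⟩ := ht
    refine ⟨c + d, ?_⟩
    rw [map_add, add_sub_add_comm]
    exact add_mem hc hd
  | mul_X s i _ =>
    refine ⟨0, ?_⟩
    rw [map_zero, sub_zero]
    exact Ideal.mul_mem_left _ _ (Ideal.subset_span (Set.mem_insert_of_mem _ ⟨i, rfl⟩))

/-- The two-sided ideal `𝔫 ^ N A` of an algebra. -/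
def adicIdeal {S : Type*} [CommRing S] (𝔫 : Ideal S) (A : Type*) [Ring A] [Algebra S A] (N : ℕ) :
    Ideal A :=
  { adicFil 𝔫 A N with smul_mem' := fun a _ hb => mul_mem_adicFil_right a hb }

instance {S : Type*} [CommRing S] (𝔫 : Ideal S) (A : Type*) [Ring A] [Algebra S A] (N : ℕ) :
    (adicIdeal 𝔫 A N).IsTwoSided := ⟨fun b ha => mul_mem_adicFil_left b ha⟩

/-- A topological version of Nakayama's lemma. -/
theorem IsAdicCompletionHom.exists_eq_sum_ordMonomial {S : Type*} [CommRing S] {𝔫 : Ideal S}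
    {A C : Type*} [Ring A] [Ring C] [Algebra S A] [Algebra S C] {π : A →ₐ[S] C}
    (h : IsAdicCompletionHom 𝔫 π) {m p : ℕ} (t : Fin m → A)
    (ht : ∀ a, a ∈ Submodule.span S (Set.range (ordMonomial (p := p) t)) ⊔ adicFil 𝔫 A 1) (c : C) :
    ∃ z : (Fin m → Fin p) → C, (∀ α, z α ∈ Subring.center C) ∧
      c = ∑ α, ordMonomial (fun i => π (t i)) α * z α := by
  set M : (Fin m → Fin p) → C := ordMonomial (fun i => π (t i)) with hM
  have hπM : ∀ α, π (ordMonomial t α) = M α := by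
    intro α
    rw [hM, ordMonomial, ordMonomial, map_list_prod, List.map_ofFn]
    congr 2
    funext i
    exact map_pow π _ _
  have hbase : ∀ c : C, ∃ s : (Fin m → Fin p) → S, c - ∑ α, s α • M α ∈ adicFil 𝔫 C 1 := by
    intro c
    obtain ⟨a, ha⟩ := h.exists_sub_mem c 1
    obtain ⟨u, hu, f, hf, huf⟩ := Submodule.mem_sup.mp (ht a)
    obtain ⟨s, rfl⟩ := (Submodule.mem_span_range_iff_exists_fun S).mp hu
    refine ⟨s, ?_⟩
    have := add_mem ha (IsAdicCompletionHom.map_mem (π := π) hf)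
    rw [← huf, map_add, map_sum] at this
    simp only [map_smul, hπM] at this
    convert this using 1
    abel
  have hstep : ∀ i, ∀ c ∈ adicFil 𝔫 C i, ∃ s : (Fin m → Fin p) → S, (∀ α, s α ∈ 𝔫 ^ i) ∧
      c - ∑ α, s α • M α ∈ adicFil 𝔫 C (i + 1) := by
    intro i c hc
    refine adicFil_induction (P := fun c => ∃ s : (Fin m → Fin p) → S, (∀ α, s α ∈ 𝔫 ^ i) ∧
      c - ∑ α, s α • M α ∈ adicFil 𝔫 C (i + 1)) ?_ ?_ hc
    · intro r hr c
      obtain ⟨s, hs⟩ := hbase c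
      refine ⟨fun α => r * s α, fun α => Ideal.mul_mem_right _ _ hr, ?_⟩
      have := smul_mem_adicFil_add hr hs
      rw [smul_sub, Finset.smul_sum] at this
      simpa only [mul_smul] using this
    · rintro a - b - ⟨s, hs, hs'⟩ ⟨r, hr, hr'⟩
      refine ⟨fun α => s α + r α, fun α => add_mem (hs α) (hr α), ?_⟩
      have := add_mem hs' hr'
      simp only [add_smul, Finset.sum_add_distrib]
      convert this using 1
      abel
  obtain ⟨σ, -, hσ, hσ'⟩ := exists_dependent_seq
    (fun i (σ : (Fin m → Fin p) → S) => c - ∑ α, σ α • M α ∈ adicFil 𝔫 C i)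
    (fun i σ σ' => ∀ α, σ' α - σ α ∈ 𝔫 ^ i) (a := 0) (by simp [adicFil]) (fun i σ hσ => by
      obtain ⟨s, hs, hs'⟩ := hstep i _ hσ
      refine ⟨σ + s, ?_, fun α => by simpa using hs α⟩
      simp only [Pi.add_apply, add_smul, Finset.sum_add_distrib]
      rwa [← sub_sub])
  -- The coefficients from S are Cauchy for 𝔫 but S need not be complete, so their limits are taken
  -- in C; they are central as limits of scalars.
  choose z hz using fun α => h.complete.exists_limit (f := fun i => σ i α • (1 : C))
    (fun i => by rw [← sub_smul]; exact smul_mem_adicFil (hσ' i α) 1)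
  refine ⟨z, fun α => ?_, ?_⟩
  · rw [Subring.mem_center_iff]
    intro g
    refine h.complete.eq_of_sub_mem fun i => ?_
    have := sub_mem (mul_mem_adicFil_right g (hz α i)) (mul_mem_adicFil_left g (hz α i))
    rw [mul_sub, sub_mul, mul_smul_comm, smul_mul_assoc, mul_one, one_mul, sub_sub_sub_cancel_right]
      at this
    exact this
  · refine h.complete.eq_of_sub_mem fun i => ?_
    have h1 : ∑ α, M α * (z α - σ i α • (1 : C)) ∈ adicFil 𝔫 C i :=
      sum_mem fun α _ => mul_mem_adicFil_right _ (hz α i)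
    have := sub_mem (hσ i) h1
    simp only [mul_sub, mul_smul_comm, mul_one, Finset.sum_sub_distrib] at this
    rwa [sub_sub_sub_cancel_right] at this

theorem pow_mul_eq_of_commute_commutator {R : Type*} [Ring R] {a b c : R} (h : a * b = b * a + c)
    (hc : Commute a c) (m : ℕ) : a ^ m * b = b * a ^ m + (m : R) * (a ^ (m - 1) * c) := by
  induction m with
  | zero => simp
  | succ m ih =>
    rw [pow_succ, mul_assoc, h, mul_add, ← mul_assoc, ih, Nat.add_sub_cancel, add_mul, mul_assoc b,
      mul_assoc, mul_assoc, ← hc.eq]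
    rcases m with _ | m
    · simp
    · rw [Nat.add_sub_cancel, ← mul_assoc (a ^ m), ← pow_succ]
      push_cast
      noncomm_ring

/-! ### The complete Weyl algebra -/

section Weyl

variable (k : Type*) [Field k] (n : ℕ)

/-- The projection from the free algebra. -/
noncomputable def weylMk : FreeAlgebra k⟦X⟧ (Fin n ⊕ Fin n) →ₐ[k⟦X⟧] WeylAlg k n :=
  RingCon.mkₐ k⟦X⟧ (ringConGen (WeylRel k n))

theorem weylMk_surjective : Function.Surjective (weylMk k n) :=
  RingCon.mk'_surjective _

variable {k n} in
theorem weylMk_eq {a b : FreeAlgebra k⟦X⟧ (Fin n ⊕ Fin n)} (h : WeylRel k n a b) :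
    weylMk k n a = weylMk k n b :=
  (RingCon.eq _).2 (RingCon.le_ringConGen _ _ h)

theorem adjoin_range_weylGen : Algebra.adjoin k⟦X⟧ (Set.range (weylGen k n)) = ⊤ := by
  have : Set.range (weylGen k n) = weylMk k n '' Set.range (FreeAlgebra.ι k⟦X⟧) := by
    rw [← Set.range_comp]; rfl
  rw [this, ← AlgHom.map_adjoin, FreeAlgebra.adjoin_range_ι, Algebra.map_top]
  exact (AlgHom.range_eq_top _).mpr (weylMk_surjective k n)

theorem weylGen_xx (i j : Fin n) :
    Commute (weylGen k n (Sum.inl i)) (weylGen k n (Sum.inl j)) := by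
  have := weylMk_eq (WeylRel.xx (k := k) i j)
  rwa [map_mul, map_mul] at this

theorem weylGen_yy (i j : Fin n) :
    Commute (weylGen k n (Sum.inr i)) (weylGen k n (Sum.inr j)) := by
  have := weylMk_eq (WeylRel.yy (k := k) i j)
  rwa [map_mul, map_mul] at this

theorem weylGen_xy (i j : Fin n) :
    weylGen k n (Sum.inl i) * weylGen k n (Sum.inr j) =
      weylGen k n (Sum.inr j) * weylGen k n (Sum.inl i) +
        algebraMap k⟦X⟧ _ (if i = j then PowerSeries.X else 0) := by
  have := weylMk_eq (WeylRel.xy (k := k) i j)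
  rwa [map_add, map_mul, map_mul, AlgHom.commutes] at this

/-- The generators of the Weyl algebra, as a single tuple. -/
noncomputable def weylTuple : Fin (n + n) → WeylAlg k n :=
  Fin.append (fun i => weylGen k n (Sum.inl i)) (fun i => weylGen k n (Sum.inr i))

theorem range_weylTuple : Set.range (weylTuple k n) = Set.range (weylGen k n) := by
  ext a
  constructor
  · rintro ⟨i, rfl⟩
    refine Fin.addCases (fun i => ?_) (fun i => ?_) i
    · exact ⟨Sum.inl i, by rw [weylTuple, Fin.append_left]⟩
    · exact ⟨Sum.inr i, by rw [weylTuple, Fin.append_right]⟩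
  · rintro ⟨i | i, rfl⟩
    · exact ⟨Fin.castAdd n i, by rw [weylTuple, Fin.append_left]⟩
    · exact ⟨Fin.natAdd n i, by rw [weylTuple, Fin.append_right]⟩

theorem weylGen_commutator (s t : Fin n ⊕ Fin n) :
    ∃ r : k⟦X⟧, weylGen k n s * weylGen k n t =
      weylGen k n t * weylGen k n s + algebraMap k⟦X⟧ _ (PowerSeries.X * r) := by
  rcases s with i | i <;> rcases t with j | j
  · exact ⟨0, by rw [(weylGen_xx k n i j).eq]; simp⟩
  · rw [weylGen_xy]
    split_ifs
    · exact ⟨1, by simp⟩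
    · exact ⟨0, by simp⟩
  · rw [weylGen_xy]
    split_ifs
    · exact ⟨-1, by simp⟩
    · exact ⟨0, by simp⟩
  · exact ⟨0, by rw [(weylGen_yy k n i j).eq]; simp⟩

/-- The commutator c of two generators is central, so the commutator of a p-th power is p times a
product, hence 0. -/
theorem weylTuple_pow_mem_center (p : ℕ) [CharP k p] (i : Fin (n + n)) :
    weylTuple k n i ^ p ∈ Subalgebra.center k⟦X⟧ (WeylAlg k n) := by
  obtain ⟨s, hs⟩ : weylTuple k n i ∈ Set.range (weylGen k n) := by
    rw [← range_weylTuple]; exact ⟨i, rfl⟩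
  have hp : (p : WeylAlg k n) = 0 := by
    have h1 : (p : k⟦X⟧) = 0 := by
      rw [← map_natCast (PowerSeries.C (R := k)), CharP.cast_eq_zero, map_zero]
    rw [← map_natCast (algebraMap k⟦X⟧ (WeylAlg k n)), h1, map_zero]
  rw [← hs, Subalgebra.mem_center_iff]
  intro b
  have hb : b ∈ Algebra.adjoin k⟦X⟧ (Set.range (weylGen k n)) := by
    rw [adjoin_range_weylGen]; trivial
  refine Algebra.adjoin_induction (p := fun b _ => b * weylGen k n s ^ p = weylGen k n s ^ p * b)
    ?_ ?_ ?_ ?_ hb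
  · rintro _ ⟨t, rfl⟩
    obtain ⟨r, hr⟩ := weylGen_commutator k n s t
    rw [pow_mul_eq_of_commute_commutator hr (Algebra.commutes _ _).symm, hp, zero_mul, add_zero]
  · intro r
    exact Algebra.commutes _ _
  · intro x y _ _ hx hy
    rw [add_mul, mul_add, hx, hy]
  · intro x y _ _ hx hy
    rw [mul_assoc, hy, ← mul_assoc, hx, mul_assoc]

theorem weylGen_mem_weylIdeal (s : Fin n ⊕ Fin n) : weylGen k n s ∈ weylIdeal k n :=
  TwoSidedIdeal.subset_span (Set.mem_insert_of_mem _ ⟨s, rfl⟩)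

theorem weylTuple_mem_weylIdeal (i : Fin (n + n)) : weylTuple k n i ∈ weylIdeal k n := by
  obtain ⟨s, hs⟩ : weylTuple k n i ∈ Set.range (weylGen k n) := by
    rw [← range_weylTuple]; exact ⟨i, rfl⟩
  rw [← hs]
  exact weylGen_mem_weylIdeal k n s

theorem X_mem_weylIdeal : algebraMap k⟦X⟧ (WeylAlg k n) PowerSeries.X ∈ weylIdeal k n :=
  TwoSidedIdeal.subset_span (Set.mem_insert _ _)

/-- The generators of the complete Weyl algebra. -/
noncomputable def completeWeylTuple (i : Fin (n + n)) : CompleteWeyl k n :=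
  toAdicCompletionAlg k⟦X⟧ (weylIdeal k n) (weylTuple k n i)

/-- The p-th powers of the generators and ħ act centrally, and the adic topology of the ideal 𝔫 they
generate is the given one. Modulo 𝔫 the Weyl algebra is spanned by monomials with exponents below p,
so the topological Nakayama lemma applies. No independence of these monomials over the center is
needed for the splitting. -/
theorem CompleteWeyl.exists_eq_sum (p : ℕ) [hp : Fact p.Prime] [CharP k p] (w : CompleteWeyl k n) :
    ∃ z : (Fin (n + n) → Fin p) → CompleteWeyl k n,
      (∀ α, z α ∈ Subalgebra.center k⟦X⟧ (CompleteWeyl k n)) ∧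
      w = ∑ α, ordMonomial (completeWeylTuple k n) α * z α := by
  let := centralAction (fun i => weylTuple k n i ^ p) (weylTuple_pow_mem_center k n p)
  have htower := centralAction_isScalarTower (fun i => weylTuple k n i ^ p)
    (weylTuple_pow_mem_center k n p)
  set S := MvPolynomial (Fin (n + n)) k⟦X⟧ with hS
  set 𝔫 : Ideal S := fullIdeal k (Fin (n + n)) with h𝔫
  have hX : algebraMap k⟦X⟧ (WeylAlg k n) PowerSeries.X ∈ adicFil 𝔫 (WeylAlg k n) 1 := by
    rw [IsScalarTower.algebraMap_apply k⟦X⟧ S, Algebra.algebraMap_eq_smul_one]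
    exact smul_mem_adicFil (by
      rw [pow_one]; exact Ideal.subset_span (Set.mem_insert _ _)) _
  have htp : ∀ i, weylTuple k n i ^ p ∈ adicFil 𝔫 (WeylAlg k n) 1 := by
    intro i
    rw [← centralAction_algebraMap_X (fun i => weylTuple k n i ^ p)
      (weylTuple_pow_mem_center k n p), Algebra.algebraMap_eq_smul_one]
    exact smul_mem_adicFil (by
      rw [pow_one]; exact Ideal.subset_span (Set.mem_insert_of_mem _ ⟨i, rfl⟩)) _
  have hcomm : ∀ a b : WeylAlg k n, a * b - b * a ∈ adicFil 𝔫 (WeylAlg k n) 1 := by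
    refine commutator_mem_of_adjoin_eq_top (F := (adicFil 𝔫 (WeylAlg k n) 1).toAddSubgroup)
      (fun a _ hf => mul_mem_adicFil_right a hf) (fun a _ hf => mul_mem_adicFil_left a hf)
      (adjoin_range_weylGen k n) ?_
    rintro _ ⟨s, rfl⟩ _ ⟨t, rfl⟩
    obtain ⟨r, hr⟩ := weylGen_commutator k n s t
    rw [hr, add_sub_cancel_left, map_mul]
    exact mul_mem_adicFil_left _ hX
  have hle : ∀ a ∈ adicFil 𝔫 (WeylAlg k n) 1, a ∈ weylIdeal k n := by
    intro a ha
    refine adicFil_induction (P := fun a => a ∈ weylIdeal k n) ?_ (fun _ _ _ _ => add_mem) ha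
    intro s hs a
    rw [pow_one] at hs
    rw [Algebra.smul_def]
    refine Ideal.mul_mem_right _ _ ?_
    have : 𝔫 ≤ (weylIdeal k n).comap (algebraMap S (WeylAlg k n)) := by
      rw [h𝔫, fullIdeal, Ideal.span_le]
      rintro _ (rfl | ⟨i, rfl⟩)
      · change algebraMap S (WeylAlg k n) (algebraMap k⟦X⟧ S PowerSeries.X) ∈ weylIdeal k n
        rw [← IsScalarTower.algebraMap_apply]
        exact X_mem_weylIdeal k n
      · change algebraMap S (WeylAlg k n) (MvPolynomial.X i) ∈ weylIdeal k n
        rw [centralAction_algebraMap_X]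
        exact Ideal.pow_mem_of_mem _ (weylTuple_mem_weylIdeal k n i) _ hp.out.pos
    exact this hs
  -- Modulo 𝔫 the algebra is commutative, ħ vanishes and the generators are nilpotent, so a finitely
  -- generated nil ideal is nilpotent.
  obtain ⟨K, hK⟩ : ∃ K, ∀ a ∈ weylIdeal k n ^ K, a ∈ adicFil 𝔫 (WeylAlg k n) 1 := by
    let := Ideal.Quotient.commRingOfCommutator (adicIdeal 𝔫 (WeylAlg k n) 1) hcomm
    let f : WeylAlg k n →+* WeylAlg k n ⧸ adicIdeal 𝔫 (WeylAlg k n) 1 := Ideal.Quotient.mk _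
    have hf : ∀ a, f a = 0 ↔ a ∈ adicFil 𝔫 (WeylAlg k n) 1 := fun a =>
      Ideal.Quotient.eq_zero_iff_mem
    obtain ⟨K, hK⟩ := exists_pow_mem_of_le_radical f (J := weylIdeal k n)
      (J' := Ideal.span (Set.range fun i => f (weylTuple k n i))) (I' := ⊥) (by
        intro a ha
        have ha' : a ∈ TwoSidedIdeal.span
          (insert (algebraMap k⟦X⟧ (WeylAlg k n) PowerSeries.X) (Set.range (weylGen k n))) := ha
        refine TwoSidedIdeal.span_induction (p := fun a _ => f a ∈ Ideal.span _) ?_ ?_ ?_ ?_ ?_ ?_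
          ha'
        · rintro _ (rfl | h)
          · rw [(hf _).mpr hX]; exact zero_mem _
          · rw [← range_weylTuple] at h
            obtain ⟨i, rfl⟩ := h
            exact Ideal.subset_span ⟨i, rfl⟩
        · rw [map_zero]; exact zero_mem _
        · intro x y _ _ hx hy
          rw [map_add]; exact add_mem hx hy
        · intro x _ hx
          rw [map_neg]; exact neg_mem hx
        · intro a x _ hx
          rw [map_mul]; exact Ideal.mul_mem_left _ _ hx
        · intro a x _ hx
          rw [map_mul]; exact Ideal.mul_mem_right _ _ hx)
      (Submodule.fg_span (Set.finite_range _)) (by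
        rw [Ideal.span_le]
        rintro _ ⟨i, rfl⟩
        refine ⟨p, ?_⟩
        rw [← map_pow, (hf _).mpr (htp i)]
        exact zero_mem _)
    exact ⟨K, fun a ha => (hf a).mp (hK a ha)⟩
  have hπ := isAdicCompletionHom_toAdicCompletionAlg (fullIdeal_fg k _) hle hK
  have hspan : ∀ a : WeylAlg k n, a ∈ Submodule.span S (Set.range
      (ordMonomial (p := p) (weylTuple k n))) ⊔ adicFil 𝔫 (WeylAlg k n) 1 := by
    set U := Submodule.span S (Set.range
      (ordMonomial (p := p) (weylTuple k n))) ⊔ adicFil 𝔫 (WeylAlg k n) 1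
    have h1 : (1 : WeylAlg k n) ∈ U := by
      refine Submodule.mem_sup_left (Submodule.subset_span ⟨fun _ => ⟨0, hp.out.pos⟩, ?_⟩)
      simp [ordMonomial, List.ofFn_const]
    have hmul : ∀ i, ∀ u ∈ U, weylTuple k n i * u ∈ U := by
      intro i u hu
      obtain ⟨v, hv, f, hf, rfl⟩ := Submodule.mem_sup.mp hu
      rw [mul_add]
      refine add_mem ?_ (Submodule.mem_sup_right (mul_mem_adicFil_right _ hf))
      refine Submodule.span_induction (p := fun v _ => weylTuple k n i * v ∈ U) ?_ ?_ ?_ ?_ hv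
      · rintro _ ⟨α, rfl⟩
        exact mul_ordMonomial_mem (fun a _ hf => mul_mem_adicFil_right a hf)
          (fun a _ hf => mul_mem_adicFil_left a hf) hcomm _ htp i α
      · rw [mul_zero]; exact zero_mem _
      · intro x y _ _ hx hy
        rw [mul_add]; exact add_mem hx hy
      · intro s x _ hx
        rw [mul_smul_comm]; exact Submodule.smul_mem _ _ hx
    intro a
    have ha : a ∈ Algebra.adjoin k⟦X⟧ (Set.range (weylGen k n)) := by
      rw [adjoin_range_weylGen]; trivial
    have key : ∀ u ∈ U, a * u ∈ U := by
      refine Algebra.adjoin_induction (p := fun a _ => ∀ u ∈ U, a * u ∈ U) ?_ ?_ ?_ ?_ ha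
      · intro s hs
        rw [← range_weylTuple] at hs
        obtain ⟨i, rfl⟩ := hs
        exact hmul i
      · intro r u hu
        rw [IsScalarTower.algebraMap_apply k⟦X⟧ S, ← Algebra.smul_def]
        exact Submodule.smul_mem _ _ hu
      · intro x y _ _ hx hy u hu
        rw [add_mul]; exact add_mem (hx u hu) (hy u hu)
      · intro x y _ _ hx hy u hu
        rw [mul_assoc]; exact hx _ (hy u hu)
    simpa using key 1 h1
  let e : CompleteWeyl k n ≃ₐ[k⟦X⟧] adicCompletionAlg S (weylIdeal k n) :=
    adicCompletionAlgEquiv k⟦X⟧ S (weylIdeal k n)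
  obtain ⟨z, hz, hw⟩ := hπ.exists_eq_sum_ordMonomial (weylTuple k n) hspan (e w)
  refine ⟨fun α => e.symm (z α), fun α => ?_, ?_⟩
  · rw [Subalgebra.mem_center_iff]
    intro b
    apply e.injective
    rw [map_mul, map_mul, e.apply_symm_apply]
    exact Subring.mem_center_iff.mp (hz α) _
  · apply e.injective
    rw [map_sum, hw]
    refine Finset.sum_congr rfl fun α _ => ?_
    rw [map_mul, e.apply_symm_apply]
    congr 1

/-- The relations give a map of the uncompleted algebra, continuous because generators go into P and
P^K ⊆ 𝔫C. The commutation claim holds on generators and extends by density. -/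
theorem CompleteWeyl.exists_hom {S C : Type*} [CommRing S] [Ring C] [Algebra S C] [Algebra k⟦X⟧ C]
    {𝔫 : Ideal S} (hC : IsAdicComplete 𝔫 C) {P : Ideal C} [P.IsTwoSided] {K : ℕ}
    (hK : ∀ c ∈ P ^ K, c ∈ adicFil 𝔫 C 1) (hX : algebraMap k⟦X⟧ C PowerSeries.X ∈ P)
    {x y : Fin n → C} (hx : ∀ i, x i ∈ P) (hy : ∀ i, y i ∈ P)
    (xx : ∀ i j, Commute (x i) (x j)) (yy : ∀ i j, Commute (y i) (y j))
    (xy : ∀ i j, x i * y j = y j * x i + algebraMap k⟦X⟧ C (if i = j then PowerSeries.X else 0)) :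
    ∃ Φ : CompleteWeyl k n →ₐ[k⟦X⟧] C, (∀ i, Φ (completeWeylTuple k n i) = Fin.append x y i) ∧
      ∀ c, (∀ i, Commute (x i) c) → (∀ i, Commute (y i) c) → ∀ w, Commute (Φ w) c := by
  let φ : WeylAlg k n →ₐ[k⟦X⟧] C := RingCon.liftₐ (ringConGen (WeylRel k n))
    (FreeAlgebra.lift k⟦X⟧ (Sum.elim x y)) (by
      rw [RingCon.ringConGen_le]
      intro a b h
      change FreeAlgebra.lift k⟦X⟧ (Sum.elim x y) a = FreeAlgebra.lift k⟦X⟧ (Sum.elim x y) b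
      cases h with
      | xx i j => simpa using (xx i j).eq
      | yy i j => simpa using (yy i j).eq
      | xy i j => simpa using xy i j)
  have hφ : ∀ s, φ (weylGen k n s) = Sum.elim x y s := fun s =>
    FreeAlgebra.lift_ι_apply _ _
  have hmem : ∀ a ∈ weylIdeal k n, φ a ∈ P := by
    intro a ha
    have ha' : a ∈ TwoSidedIdeal.span
      (insert (algebraMap k⟦X⟧ (WeylAlg k n) PowerSeries.X) (Set.range (weylGen k n))) := ha
    refine TwoSidedIdeal.span_induction (p := fun a _ => φ a ∈ P) ?_ ?_ ?_ ?_ ?_ ?_ ha'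
    · rintro _ (rfl | ⟨s | s, rfl⟩)
      · rw [AlgHom.commutes]; exact hX
      · rw [hφ]; exact hx s
      · rw [hφ]; exact hy s
    · rw [map_zero]; exact zero_mem _
    · intro x y _ _ hx hy
      rw [map_add]; exact add_mem hx hy
    · intro x _ hx
      rw [map_neg]; exact neg_mem hx
    · intro a x _ hx
      rw [map_mul]; exact Ideal.mul_mem_left _ _ hx
    · intro a x _ hx
      rw [map_mul]; exact Ideal.mul_mem_right _ _ hx
  have hpow : ∀ N, ∀ a ∈ weylIdeal k n ^ N, φ a ∈ P ^ N := by
    intro N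
    induction N with
    | zero => intro a _; rw [Submodule.pow_zero, Ideal.one_eq_top]; trivial
    | succ N ih =>
      intro a ha
      rw [Submodule.pow_succ] at ha
      refine Submodule.mul_induction_on ha ?_
        (fun _ _ ha hb => by rw [map_add]; exact add_mem ha hb)
      intro a ha b hb
      rw [map_mul, Submodule.pow_succ]
      exact Submodule.mul_mem_mul (ih a ha) (hmem b hb)
  obtain ⟨Φ, hΦ⟩ : ∃ Φ : CompleteWeyl k n →ₐ[k⟦X⟧] C, ∀ (w : CompleteWeyl k n) (N : ℕ)
      (a : WeylAlg k n), Ideal.Quotient.mk (weylIdeal k n ^ ((K + 1) * N)) a =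
        w.1 ((K + 1) * N) → Φ w - φ a ∈ adicFil 𝔫 C N := adicCompletionAlg.exists_lift hC φ
    (map_pow_mem_adicFil φ.toRingHom (fun a ha => hK _ (hpow K a ha)))
  refine ⟨Φ, fun i => ?_, fun c hcx hcy w => ?_⟩
  · have h1 : Φ (completeWeylTuple k n i) = φ (weylTuple k n i) :=
      hC.eq_of_sub_mem fun N => hΦ _ N _ rfl
    rw [h1]
    refine Fin.addCases (fun i => ?_) (fun i => ?_) i
    · rw [weylTuple, Fin.append_left, Fin.append_left, hφ]; rfl
    · rw [weylTuple, Fin.append_right, Fin.append_right, hφ]; rfl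
  · have hcomm : ∀ a, φ a * c = c * φ a := by
      intro a
      have ha : a ∈ Algebra.adjoin k⟦X⟧ (Set.range (weylGen k n)) := by
        rw [adjoin_range_weylGen]; trivial
      refine Algebra.adjoin_induction (p := fun a _ => φ a * c = c * φ a) ?_ ?_ ?_ ?_ ha
      · rintro _ ⟨s | s, rfl⟩
        · rw [hφ]; exact hcx s
        · rw [hφ]; exact hcy s
      · intro r
        rw [AlgHom.commutes, Algebra.commutes]
      · intro a b _ _ ha hb
        rw [map_add, add_mul, mul_add, ha, hb]
      · intro a b _ _ ha hb
        rw [map_mul, mul_assoc, hb, ← mul_assoc, ha, mul_assoc]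
    refine hC.eq_of_sub_mem fun N => ?_
    obtain ⟨a, ha⟩ := Ideal.Quotient.mk_surjective (w.1 ((K + 1) * N))
    have h1 := hΦ w N a ha
    have := sub_mem (mul_mem_adicFil_left c h1) (mul_mem_adicFil_right c h1)
    rw [sub_mul, mul_sub, hcomm, sub_sub_sub_cancel_right] at this
    exact this

end Weyl

/-! ### Reduction modulo the deformation parameter -/

/-- The bracket of A is bilinear over S, so {ħc, b} = ħ{c, b}, and it descends modulo ħ. -/
theorem exists_poissonBracket {k S A L : Type*} [CommRing k] [CommRing S] [Algebra k S] {ħ : S}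
    [Ring A] [Algebra S A] [Algebra k A] [IsScalarTower k S A] [AlmostComm ħ A] [CommRing L]
    [Algebra k L] (ρ : A →ₐ[k] L) (hρ : Function.Surjective ρ)
    (hker : ∀ a, ρ a = 0 ↔ ∃ c, a = ħ • c) :
    ∃ P : PoissonBracket k L, ∀ a b, P.br (ρ a) (ρ b) = ρ (hbr ħ a b) := by
  choose σ hσ using hρ
  have hl : ∀ a a' b, ρ a = ρ a' → ρ (hbr ħ a b) = ρ (hbr ħ a' b) := by
    intro a a' b h
    obtain ⟨c, hc⟩ := (hker (a - a')).mp (by rw [map_sub, h, sub_self])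
    rw [← sub_eq_zero, ← map_sub, ← hbr_sub_left, hc, hbr_smul_left]
    exact (hker _).mpr ⟨_, rfl⟩
  have hr : ∀ a b b', ρ b = ρ b' → ρ (hbr ħ a b) = ρ (hbr ħ a b') := by
    intro a b b' h
    rw [hbr_skew, hbr_skew (ħ := ħ) a b', map_neg, map_neg, hl _ _ _ h]
  let F : L → L → L := fun a b => ρ (hbr ħ (σ a) (σ b))
  have hF : ∀ a b, F (ρ a) (ρ b) = ρ (hbr ħ a b) := fun a b =>
    (hl _ _ _ (hσ _)).trans (hr _ _ _ (hσ _))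
  have hk : ∀ (c : k) (a : A), c • a = algebraMap k S c • a := fun c a =>
    (algebraMap_smul S c a).symm
  let D : L → Derivation k L L := fun a => Derivation.mk'
    { toFun := F a
      map_add' := fun b c => by
        rw [← hσ a, ← hσ b, ← hσ c, ← map_add, hF, hF, hF, hbr_add_right, map_add]
      map_smul' := fun c b => by
        rw [← hσ a, ← hσ b, ← map_smul, hF, hF, hk, hbr_smul_right, ← hk, map_smul,
          RingHom.id_apply] }
    (fun b c => by
      change F a (b * c) = b * F a c + c * F a b
      rw [← hσ a, ← hσ b, ← hσ c, ← map_mul, hF, hF, hF, hbr_mul_right, map_add, map_mul, map_mul]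
      ring)
  have hD : ∀ a b, D (ρ a) (ρ b) = ρ (hbr ħ a b) := hF
  refine ⟨{ br :=
              { toFun := D
                map_add' := fun a b => ?_
                map_smul' := fun c a => ?_ }
            self := fun a => ?_
            jacobi := fun a b c => ?_ }, hD⟩
  · ext c
    rw [Derivation.add_apply, ← hσ a, ← hσ b, ← hσ c, ← map_add, hD, hD, hD, hbr_add_left, map_add]
  · ext b
    rw [Derivation.smul_apply, ← hσ a, ← hσ b, ← map_smul, hD, hD, hk, hbr_smul_left, ← hk,
      map_smul, RingHom.id_apply]
  · change D a a = 0
    rw [← hσ a, hD, hbr_self, map_zero]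
  · change D a (D b c) + D b (D c a) + D c (D a b) = 0
    rw [← hσ a, ← hσ b, ← hσ c, hD, hD, hD, hD, hD, hD, ← map_add, ← map_add]
    have h1 := hbr_jacobi (ħ := ħ) (σ a) (σ b) (σ c)
    rw [hbr_skew (ħ := ħ) (hbr ħ (σ a) (σ b)) (σ c), hbr_skew (ħ := ħ) (σ a) (σ c),
      hbr_neg_right] at h1
    rw [h1, ← map_zero ρ]
    congr 1
    abel

theorem adicFil_exists_lift {S A L : Type*} [CommRing S] {𝔫 : Ideal S} [AddCommGroup A] [Module S A]
    [AddCommGroup L] [Module S L] {f : A →ₗ[S] L} (hf : Function.Surjective f) {N : ℕ} {l : L}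
    (hl : l ∈ adicFil 𝔫 L N) : ∃ a ∈ adicFil 𝔫 A N, f a = l := by
  have : (adicFil 𝔫 A N).map f = adicFil 𝔫 L N := by
    rw [adicFil, Submodule.map_smul'', Submodule.map_top, LinearMap.range_eq_top.mpr hf]
  rw [← this] at hl
  exact hl

theorem IsAdicComplete.of_seq {S A : Type*} [CommRing S] {𝔫 : Ideal S} [AddCommGroup A] [Module S A]
    (h0 : ∀ a : A, (∀ n, a ∈ adicFil 𝔫 A n) → a = 0)
    (h1 : ∀ f : ℕ → A, (∀ n, f (n + 1) - f n ∈ adicFil 𝔫 A n) →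
      ∃ L, ∀ n, L - f n ∈ adicFil 𝔫 A n) : IsAdicComplete 𝔫 A where
  toIsHausdorff := ⟨fun a ha => h0 a fun n => by
    have := ha n
    rwa [SModEq.sub_mem, sub_zero] at this⟩
  toIsPrecomplete := ⟨fun f hf => by
    obtain ⟨L, hL⟩ := h1 f (fun n => by
      have := (hf n.le_succ).symm
      rwa [SModEq.sub_mem] at this)
    refine ⟨L, fun n => SModEq.symm ?_⟩
    rw [SModEq.sub_mem]
    exact hL n⟩

/-- Separatedness says that ħA is closed. If a is approximated by ħ c_N, the Artin–Rees condition
makes the c_N Cauchy, and a is ħ times their limit. -/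
theorem IsAdicComplete.of_surjective {S A L : Type*} [CommRing S] {𝔫 : Ideal S} {ħ : S}
    [AddCommGroup A] [Module S A] [AddCommGroup L] [Module S L] (hA : IsAdicComplete 𝔫 A)
    (hAR : ∀ N, ∃ M, ∀ a : A, ħ • a ∈ adicFil 𝔫 A M → a ∈ adicFil 𝔫 A N)
    {f : A →ₗ[S] L} (hf : Function.Surjective f) (hker : ∀ a, f a = 0 ↔ ∃ c, a = ħ • c) :
    IsAdicComplete 𝔫 L := by
  refine IsAdicComplete.of_seq (fun l hl => ?_) (fun g hg => ?_)
  · obtain ⟨a, rfl⟩ := hf l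
    have h1 : ∀ N, ∃ c, a - ħ • c ∈ adicFil 𝔫 A N := by
      intro N
      obtain ⟨b, hb, hba⟩ := adicFil_exists_lift hf (hl N)
      obtain ⟨c, hc⟩ := (hker (a - b)).mp (by rw [map_sub, hba, sub_self])
      exact ⟨c, by rw [← hc, sub_sub_cancel]; exact hb⟩
    choose M hM using hAR
    -- A monotone majorant of M with M' N ≥ N, so that two consecutive approximations can be
    -- compared.
    let M' : ℕ → ℕ := fun N => N + ∑ i ∈ Finset.range (N + 1), M i
    have hM1 : ∀ N, M N ≤ M' N := fun N =>
      (Finset.single_le_sum (f := M) (fun _ _ => Nat.zero_le _)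
        (Finset.mem_range.mpr N.lt_succ_self)).trans (Nat.le_add_left _ _)
    have hM2 : ∀ N, M' N ≤ M' (N + 1) := fun N => by
      simp only [M']
      rw [Finset.sum_range_succ _ (N + 1)]
      omega
    choose c hc using fun N => h1 (M' N)
    obtain ⟨d, hd⟩ := hA.exists_limit (f := c) (fun N => hM N _ (by
      have := sub_mem (adicFil_anti 𝔫 (hM1 N) (hc N))
        (adicFil_anti 𝔫 ((hM1 N).trans (hM2 N)) (hc (N + 1)))
      rwa [sub_sub_sub_cancel_left, ← smul_sub] at this))
    refine (hker a).mpr ⟨d, hA.eq_of_sub_mem fun N => ?_⟩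
    have := sub_mem (adicFil_anti 𝔫 (Nat.le_add_right _ _) (hc N)) (Submodule.smul_mem _ ħ (hd N))
    rwa [smul_sub, sub_sub_sub_cancel_right] at this
  · obtain ⟨a₀, ha₀⟩ := hf (g 0)
    obtain ⟨a, -, ha, ha'⟩ := exists_dependent_seq (fun n (a : A) => f a = g n)
      (fun n a b => b - a ∈ adicFil 𝔫 A n) ha₀ (fun n a ha => by
        obtain ⟨b, hb, hb'⟩ := adicFil_exists_lift hf (hg n)
        exact ⟨a + b, by rw [map_add, ha, hb']; abel, by rwa [add_sub_cancel_left]⟩)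
    obtain ⟨l, hl⟩ := hA.exists_limit ha'
    refine ⟨f l, fun n => ?_⟩
    rw [← ha n, ← map_sub]
    exact adicFil_map f (hl n)

theorem IsAdicComplete.of_pow_le {S L : Type*} [CommRing S] {𝔫 : Ideal S} [CommRing L] [Algebra S L]
    (h : IsAdicComplete 𝔫 L) {m : Ideal L} (hle : ∀ a ∈ adicFil 𝔫 L 1, a ∈ m) {K : ℕ}
    (hK : ∀ a ∈ m ^ K, a ∈ adicFil 𝔫 L 1) : IsAdicComplete m L := by
  have h1 : ∀ n, ∀ a ∈ m ^ ((K + 1) * n), a ∈ adicFil 𝔫 L n :=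
    map_pow_mem_adicFil (RingHom.id L) hK
  have h2 := smul_mem_pow_of_mem hle
  have h3 : ∀ n a, a ∈ adicFil m L n ↔ a ∈ m ^ n := fun n a => by
    rw [adicFil, smul_eq_mul, Ideal.mul_top]
  refine IsAdicComplete.of_seq (fun a ha => ?_) (fun f hf => ?_)
  · exact h.eq_zero_of_mem fun n => h1 n a ((h3 _ _).mp (ha _))
  · have hlt : ∀ m' n, m' ≤ n → f n - f m' ∈ m ^ m' := fun m' n hmn =>
      (h3 _ _).mp (adicFil_seq_sub hf hmn)
    obtain ⟨l, hl⟩ := h.exists_limit (f := fun n => f ((K + 1) * n)) (fun n =>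
      h1 n _ (hlt _ _ (Nat.mul_le_mul_left _ n.le_succ)))
    refine ⟨l, fun n => (h3 _ _).mpr ?_⟩
    have := add_mem (h2 n _ (hl n)) (hlt n _ (Nat.le_mul_of_pos_left n K.succ_pos))
    rwa [sub_add_sub_cancel] at this

/-- For an ħ-adic Cauchy sequence f_i, with increments ħ^i c_i, the tails ∑ ħ^l c_(i+l) converge
𝔫-adically to some b_i. All f_i + ħ^i b_i coincide, and their common value is the ħ-adic limit. -/
theorem IsAdicComplete.span_singleton {S A : Type*} [CommRing S] {𝔫 : Ideal S} {ħ : S}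
    [AddCommGroup A] [Module S A] (hA : IsAdicComplete 𝔫 A) (hħ : ħ ∈ 𝔫) :
    IsAdicComplete (Ideal.span {ħ}) A := by
  have hmem : ∀ n (a : A), a ∈ adicFil (Ideal.span {ħ}) A n ↔ ∃ b, a = ħ ^ n • b := by
    intro n a
    rw [adicFil, Ideal.span_singleton_pow, Submodule.ideal_span_singleton_smul,
      Submodule.mem_smul_pointwise_iff_exists]
    exact ⟨fun ⟨b, _, h⟩ => ⟨b, h.symm⟩, fun ⟨b, h⟩ => ⟨b, trivial, h.symm⟩⟩
  have hF : ∀ n (b : A), ħ ^ n • b ∈ adicFil 𝔫 A n := fun n b =>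
    smul_mem_adicFil (Ideal.pow_mem_pow hħ n) b
  refine IsAdicComplete.of_seq (fun a ha => hA.eq_zero_of_mem fun n => ?_) (fun f hf => ?_)
  · obtain ⟨b, rfl⟩ := (hmem n a).mp (ha n)
    exact hF n b
  · choose c hc using fun n => (hmem n _).mp (hf n)
    have hsum : ∀ i m, f (i + m) = f i + ħ ^ i • ∑ l ∈ Finset.range m, ħ ^ l • c (i + l) := by
      intro i m
      induction m with
      | zero => simp
      | succ m ih =>
        rw [Finset.sum_range_succ, smul_add, ← add_assoc (f i), ← ih, smul_smul, ← pow_add, ← hc,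
          ← add_assoc i m 1]
        abel
    choose b hb using fun i => hA.exists_limit
      (f := fun m => ∑ l ∈ Finset.range m, ħ ^ l • c (i + l))
      (fun m => by rw [Finset.sum_range_succ, add_sub_cancel_left]; exact hF m _)
    refine ⟨f 0 + b 0, fun i => (hmem i _).mpr ⟨b i, hA.eq_of_sub_mem fun m => ?_⟩⟩
    have h1 := adicFil_anti 𝔫 (Nat.le_add_left m i) (hb 0 (i + m))
    have h2 := Submodule.smul_mem _ (ħ ^ i) (hb i m)
    have h3 := hsum 0 (i + m)
    rw [pow_zero, one_smul, zero_add] at h3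
    have h4 := sub_mem h1 h2
    rw [smul_sub, ← sub_eq_iff_eq_add'.mpr (hsum i m), ← sub_eq_iff_eq_add'.mpr h3] at h4
    convert h4 using 1
    abel

namespace IsLocalQuantum

/-- Take L = A/ħA. Its nonunits are the kernel of the induced character; vanishing of χ on all
brackets is what makes this maximal ideal Poisson. -/
theorem exists_quantization {p : ℕ} {k : Type u} [Field k] {S : Type*}
    [CommRing S] [Algebra k S] [Algebra k⟦X⟧ S] [IsScalarTower k k⟦X⟧ S] {𝔫 : Ideal S}
    {A : Type w} [Ring A] [Algebra S A] [Algebra k A] [IsScalarTower k S A] [Algebra k⟦X⟧ A]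
    [IsScalarTower k⟦X⟧ S A] {χ : A →ₐ[k] k} [AlmostComm (algebraMap k⟦X⟧ S PowerSeries.X) A]
    (H : IsLocalQuantum p (algebraMap k⟦X⟧ S PowerSeries.X) 𝔫 χ) {K : ℕ}
    (hK : ∀ c ∈ RingHom.ker χ ^ K, c ∈ adicFil 𝔫 A 1)
    (hres : ∀ a b, χ (hbr (algebraMap k⟦X⟧ S PowerSeries.X) a b) = 0) :
    ∃ (L : Type w) (_ : CommRing L) (_ : Algebra k L) (P : PoissonBracket k L),
      P.IsCompleteLocal ∧ Nonempty (Quantization P A) ∧ IsWeaklyCentral p k A := by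
  set ħ : S := algebraMap k⟦X⟧ S PowerSeries.X with hħ
  have hX : ∀ a : A, (PowerSeries.X : k⟦X⟧) • a = ħ • a := fun a =>
    (algebraMap_smul S (PowerSeries.X : k⟦X⟧) a).symm
  let I : Ideal A :=
    { carrier := {a | ∃ c, a = ħ • c}
      add_mem' := by
        rintro _ _ ⟨a, rfl⟩ ⟨b, rfl⟩
        exact ⟨a + b, (smul_add _ _ _).symm⟩
      zero_mem' := ⟨0, (smul_zero _).symm⟩
      smul_mem' := by
        rintro a _ ⟨b, rfl⟩
        exact ⟨a * b, by rw [smul_eq_mul, mul_smul_comm]⟩ }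
  have hI : I.IsTwoSided := ⟨by
    rintro _ b ⟨a, rfl⟩
    exact ⟨a * b, smul_mul_assoc _ _ _⟩⟩
  let iL : CommRing (A ⧸ I) := Ideal.Quotient.commRingOfCommutator I fun a b =>
    ⟨_, (smul_hbr ħ a b).symm⟩
  let iS : Algebra S (A ⧸ I) := inferInstance
  let ik : Algebra k (A ⧸ I) := inferInstance
  let ρ : A →ₐ[k] A ⧸ I := Ideal.Quotient.mkₐ k I
  have hρ : Function.Surjective ρ := Ideal.Quotient.mk_surjective
  have hker : ∀ a, ρ a = 0 ↔ ∃ c, a = ħ • c := fun a => Ideal.Quotient.eq_zero_iff_mem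
  obtain ⟨P, hP⟩ := exists_poissonBracket ρ hρ hker
  let χL : A ⧸ I →+* k := Ideal.Quotient.lift I (χ : A →+* k) (by
    rintro _ ⟨a, rfl⟩
    exact H.χ_smul _ H.ħ_mem a)
  have hχL : ∀ a, χL (ρ a) = χ a := fun a => rfl
  have hunit : ∀ l, IsUnit l ↔ χL l ≠ 0 := by
    intro l
    constructor
    · intro h
      exact (h.map χL).ne_zero
    · obtain ⟨a, rfl⟩ := hρ l
      intro h
      exact (H.isUnit h).map ρ
  have hnt : Nontrivial (A ⧸ I) := χL.domain_nontrivial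
  have hloc : IsLocalRing (A ⧸ I) := IsLocalRing.of_nonunits_add fun a b ha hb => by
    rw [mem_nonunits_iff, hunit, not_not] at ha hb ⊢
    rw [map_add, ha, hb, add_zero]
  have hmax : ∀ l, l ∈ IsLocalRing.maximalIdeal (A ⧸ I) ↔ χL l = 0 := fun l => by
    rw [IsLocalRing.mem_maximalIdeal, mem_nonunits_iff, hunit, not_not]
  have hLc : IsAdicComplete 𝔫 (A ⧸ I) := H.complete.of_surjective H.artinRees
    (f := (Ideal.Quotient.mkₐ S I).toLinearMap) hρ hker
  have hmapS : ∀ {N a}, a ∈ adicFil 𝔫 A N → ρ a ∈ adicFil 𝔫 (A ⧸ I) N := fun h =>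
    adicFil_map (Ideal.Quotient.mkₐ S I).toLinearMap h
  refine ⟨A ⧸ I, iL, ik, P, ⟨hloc, ?_, ?_⟩, ⟨?_⟩, ?_⟩
  · refine hLc.of_pow_le (K := K) ?_ ?_
    · intro l hl
      obtain ⟨a, ha, rfl⟩ := adicFil_exists_lift
        (f := (Ideal.Quotient.mkₐ S I).toLinearMap) hρ hl
      exact (hmax _).mpr (H.χ_adicFil le_rfl ha)
    · have : ∀ n, ∀ l ∈ IsLocalRing.maximalIdeal (A ⧸ I) ^ n, ∃ a ∈ RingHom.ker χ ^ n, ρ a = l := by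
        intro n
        induction n with
        | zero =>
          intro l _
          obtain ⟨a, rfl⟩ := hρ l
          exact ⟨a, by rw [Submodule.pow_zero, Ideal.one_eq_top]; trivial, rfl⟩
        | succ n ih =>
          intro l hl
          rw [pow_succ] at hl
          refine Submodule.mul_induction_on hl ?_ ?_
          · intro l hl m hm
            obtain ⟨a, ha, rfl⟩ := ih l hl
            obtain ⟨b, rfl⟩ := hρ m
            refine ⟨a * b, ?_, map_mul ρ a b⟩
            rw [Submodule.pow_succ]
            exact Submodule.mul_mem_mul ha ((hmax _).mp hm)
          · rintro _ _ ⟨a, ha, rfl⟩ ⟨b, hb, rfl⟩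
            exact ⟨a + b, add_mem ha hb, map_add ρ a b⟩
      intro l hl
      obtain ⟨a, ha, rfl⟩ := this K l hl
      exact hmapS (hK a ha)
  · intro l m _
    obtain ⟨a, rfl⟩ := hρ l
    obtain ⟨b, rfl⟩ := hρ m
    rw [hP, hmax, hχL]
    exact hres a b
  · refine
      { torsionFree := fun a ha => AlmostComm.torsionFree (ħ := ħ) a (by rw [← hX]; exact ha)
        complete := ?_
        ρ := ρ
        ρ_algebraMap := fun f => ?_
        ρ_surjective := hρ
        ρ_eq_zero_iff := fun a => by simp only [hX]; exact hker a
        bracket := fun a b c h => ?_ }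
    · have h1 := H.complete.span_singleton H.ħ_mem
      have h2 : Ideal.span {ħ} = (Ideal.span {(PowerSeries.X : k⟦X⟧)}).map (algebraMap k⟦X⟧ S) := by
        rw [Ideal.map_span, Set.image_singleton]
      rw [h2, IsAdicComplete.map_algebraMap_iff] at h1
      exact h1
    · obtain ⟨g, hg⟩ : (PowerSeries.X : k⟦X⟧) ∣ f - PowerSeries.C (PowerSeries.constantCoeff f) := by
        rw [PowerSeries.X_dvd_iff]; simp
      have h1 : algebraMap k⟦X⟧ A (f - PowerSeries.C (PowerSeries.constantCoeff f)) =
          ħ • algebraMap k⟦X⟧ A g := by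
        rw [hg, map_mul, ← Algebra.smul_def, hX]
      have h2 : algebraMap k⟦X⟧ A (PowerSeries.C (PowerSeries.constantCoeff f)) =
          algebraMap k A (PowerSeries.constantCoeff f) := by
        rw [IsScalarTower.algebraMap_apply k⟦X⟧ S A, IsScalarTower.algebraMap_apply k S A,
          IsScalarTower.algebraMap_apply k k⟦X⟧ S]
        rfl
      have h3 := (hker _).mpr ⟨_, h1⟩
      rw [map_sub, h2, map_sub, AlgHom.commutes, sub_eq_zero] at h3
      exact h3
    · change P.br (ρ a) (ρ b) = ρ c
      rw [hP, hbr_unique (c := c) (by rw [h, hX])]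
  · intro a
    obtain ⟨z, hz, r, -, h⟩ := H.weaklyCentral a
    refine ⟨r, ?_⟩
    have : (PowerSeries.X : k⟦X⟧) ^ (p - 1) • r = ħ ^ (p - 1) • r := by
      rw [hħ, ← map_pow, algebraMap_smul]
    rw [this, h, add_sub_cancel_right]
    exact hz

end IsLocalQuantum

/-! ### Splitting off a complete Weyl algebra -/

section Tensor

variable {R W A : Type*} [CommRing R] [Ring W] [Algebra R W] [Ring A] [Algebra R A]

/-- If `A` is free over a subalgebra `D`, with basis the images of monomials which span an algebra
`W` over its center, and `W` acts centrally on `D`, then `A` is the tensor product of the two. -/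
theorem nonempty_algEquiv_tensorProduct_center {p m : ℕ} {t : Fin m → W}
    (hW : ∀ w : W, ∃ z : (Fin m → Fin p) → W, (∀ α, z α ∈ Subalgebra.center R W) ∧
      w = ∑ α, ordMonomial t α * z α)
    (Φ : W →ₐ[R] A) (D : Subalgebra R A) (hD : ∀ w, ∀ d ∈ D, Commute (Φ w) d)
    (hΦ : ∀ z ∈ Subalgebra.center R W, Φ z ∈ D)
    (hinj : ∀ c : (Fin m → Fin p) → D,
      ∑ α, ordMonomial (fun i => Φ (t i)) α * (c α : A) = 0 → ∀ α, c α = 0)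
    (hsurj : ∀ a, ∃ c : (Fin m → Fin p) → D,
      a = ∑ α, ordMonomial (fun i => Φ (t i)) α * (c α : A)) :
    ∃ (_ : Algebra (Subalgebra.center R W) D)
      (_ : IsScalarTower R (Subalgebra.center R W) D),
      Nonempty (A ≃ₐ[R] W ⊗[Subalgebra.center R W] D) := by
  let Z := Subalgebra.center R W
  have hΦM : ∀ α : Fin (m) → Fin p, Φ (ordMonomial (t) α) =
      ordMonomial (fun i => Φ (t i)) α := by
    intro α
    rw [ordMonomial, ordMonomial, map_list_prod, List.map_ofFn]
    congr 2
    funext i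
    exact map_pow Φ _ _
  let ψ : Z →ₐ[R] D := (Φ.comp Z.val).codRestrict D (fun z => hΦ z z.2)
  let iD : Algebra Z D := RingHom.toAlgebra' ψ.toRingHom
    (fun z d => Subtype.ext (hD z d d.2))
  -- The image of the center commutes with D and with the images of monomials, and these generate A.
  have hcen : ∀ (z : Z) (a : A), Φ z * a = a * Φ z := by
    intro z a
    obtain ⟨c, rfl⟩ := hsurj a
    refine Commute.sum_right _ _ _ fun α _ => Commute.mul_right ?_ (hD z _ (c α).2)
    rw [← hΦM]
    have h1 := Subalgebra.mem_center_iff.mp z.2 (ordMonomial (t) α)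
    unfold Commute SemiconjBy
    rw [← map_mul, ← map_mul, h1]
  let iA : Algebra Z A := RingHom.toAlgebra' (Φ.comp Z.val).toRingHom hcen
  have htower : IsScalarTower R Z D := IsScalarTower.of_algebraMap_eq fun r =>
    (ψ.commutes r).symm
  let f : W →ₐ[Z] A := { Φ with commutes' := fun z => rfl }
  let g : D →ₐ[Z] A := { D.val with commutes' := fun z => rfl }
  let μ : W ⊗[Z] D →ₐ[Z] A := Algebra.TensorProduct.lift f g (fun w d => hD w d d.2)
  have hμ : ∀ (w : W) (d : D), μ (w ⊗ₜ d) = Φ w * d := fun w d =>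
    Algebra.TensorProduct.lift_tmul _ _ _ w d
  -- Central coefficients move across the tensor sign, so every tensor is a combination of monomials
  -- with coefficients in D. Bijectivity of μ is then exactly freeness of A over D on the images of
  -- the monomials.
  have hspan : ∀ τ : W ⊗[Z] D, ∃ c : (Fin (m) → Fin p) → D,
      τ = ∑ α, ordMonomial (t) α ⊗ₜ c α := by
    intro τ
    induction τ with
    | zero => exact ⟨0, by simp⟩
    | add x y hx hy =>
      obtain ⟨c, rfl⟩ := hx
      obtain ⟨d, rfl⟩ := hy
      exact ⟨c + d, by simp [TensorProduct.tmul_add, Finset.sum_add_distrib]⟩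
    | tmul w d =>
      obtain ⟨z, hz, hw⟩ := hW w
      refine ⟨fun α => (⟨z α, hz α⟩ : Z) • d, ?_⟩
      rw [hw, TensorProduct.sum_tmul]
      refine Finset.sum_congr rfl fun α _ => ?_
      rw [← TensorProduct.smul_tmul]
      congr 1
      exact (Subalgebra.mem_center_iff.mp (hz α) _)
  have hμs : ∀ c : (Fin (m) → Fin p) → D,
      μ (∑ α, ordMonomial (t) α ⊗ₜ c α) =
        ∑ α, ordMonomial (fun i => Φ (t i)) α * (c α : A) := by
    intro c
    rw [map_sum]
    exact Finset.sum_congr rfl fun α _ => by rw [hμ, hΦM]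
  have hbij : Function.Bijective μ := by
    constructor
    · refine (injective_iff_map_eq_zero μ).mpr fun τ hτ => ?_
      obtain ⟨c, rfl⟩ := hspan τ
      rw [hμs] at hτ
      have := hinj c hτ
      simp [this]
    · intro a
      obtain ⟨c, rfl⟩ := hsurj a
      exact ⟨_, hμs c⟩
  let e : W ⊗[Z] D ≃+* A := RingEquiv.ofBijective μ hbij
  refine ⟨iD, htower, ⟨AlgEquiv.symm (AlgEquiv.ofRingEquiv (f := e) fun r => ?_)⟩⟩
  change μ (algebraMap R W r ⊗ₜ 1) = _
  rw [hμ]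
  simp

end Tensor

/-- The n pairs use up the whole rank 2n, so the form vanishes on their centralizer, which becomes
the second tensor factor and a quantization of its reduction modulo ħ. -/
theorem IsLocalQuantum.exists_tensor_decomposition {p : ℕ} [hp : Fact p.Prime] (hp2 : 2 < p)
    {k : Type u} [Field k] [IsAlgClosed k] [CharP k p] {S : Type*} [CommRing S] [Algebra k S]
    [Algebra k⟦X⟧ S] [IsScalarTower k k⟦X⟧ S] {𝔫 : Ideal S} {A : Type w} [Ring A] [Algebra S A]
    [Algebra k A] [IsScalarTower k S A] [Algebra k⟦X⟧ A] [IsScalarTower k⟦X⟧ S A]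
    {χ : A →ₐ[k] k} [AlmostComm (algebraMap k⟦X⟧ S PowerSeries.X) A]
    (H : IsLocalQuantum p (algebraMap k⟦X⟧ S PowerSeries.X) 𝔫 χ) {K : ℕ}
    (hK : ∀ c ∈ RingHom.ker χ ^ K, c ∈ adicFil 𝔫 A 1) {n : ℕ}
    (hn : Module.finrank k (LinearMap.range
      (residueForm (algebraMap k⟦X⟧ S PowerSeries.X) χ)) = n + n) :
    ∃ (Aplus : Type w) (_ : Ring Aplus) (_ : Algebra k⟦X⟧ Aplus)
      (_ : Algebra (Subalgebra.center k⟦X⟧ (CompleteWeyl k n)) Aplus)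
      (_ : IsScalarTower k⟦X⟧ (Subalgebra.center k⟦X⟧ (CompleteWeyl k n)) Aplus)
      (L : Type w) (_ : CommRing L) (_ : Algebra k L) (PL : PoissonBracket k L),
      PL.IsCompleteLocal ∧
      Nonempty (Quantization PL Aplus) ∧
      IsWeaklyCentral p k Aplus ∧
      Nonempty (A ≃ₐ[k⟦X⟧]
        CompleteWeyl k n ⊗[Subalgebra.center k⟦X⟧ (CompleteWeyl k n)] Aplus) := by
  set ħ : S := algebraMap k⟦X⟧ S PowerSeries.X with hħ
  have hAp := charP (p := p) χ
  obtain ⟨x, y, h, hx, hy⟩ := IsLocalQuantum.exists_isDarboux hp2 n H hn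
  have HD := h.isLocalQuantum_centralizer hp2 H
  have hDac := HD.almostComm
  have hrank := h.finrank_range_residueForm hp2 H hx hy
  have hres : ∀ a b, resChar χ h.centralizer (hbr ħ a b) = 0 := by
    have h1 : Module.finrank k (LinearMap.range (residueForm ħ (resChar χ h.centralizer))) = 0 := by
      have := hn.symm.trans hrank
      omega
    have h2 := HD.finite_range_residueForm
    have h3 : LinearMap.range (residueForm ħ (resChar χ h.centralizer)) = ⊥ :=
      Submodule.finrank_eq_zero.mp h1
    intro a b
    exact congrArg (fun f => f a b) (LinearMap.range_eq_bot.mp h3)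
  obtain ⟨r, hr⟩ := h.exists_retraction hp2
  have hKD : ∀ c ∈ RingHom.ker (resChar χ h.centralizer) ^ K, c ∈ adicFil 𝔫 h.centralizer 1 := by
    have hpow : ∀ N, ∀ c ∈ RingHom.ker (resChar χ h.centralizer) ^ N,
        (c : A) ∈ RingHom.ker χ ^ N := by
      intro N
      induction N with
      | zero => intro a _; rw [Submodule.pow_zero, Ideal.one_eq_top]; trivial
      | succ N ih =>
        intro a ha
        rw [Submodule.pow_succ] at ha
        refine Submodule.mul_induction_on ha ?_ (fun _ _ ha hb => add_mem ha hb)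
        intro a ha b hb
        rw [Submodule.pow_succ]
        exact Submodule.mul_mem_mul (ih a ha) hb
    intro c hc
    exact mem_adicFil_of_retract h.centralizer.val.toLinearMap r hr (hK _ (hpow K c hc))
  obtain ⟨L, iL, iL', PL, h1, h2, h3⟩ := HD.exists_quantization hKD hres
  have hX : ∀ a : A, algebraMap k⟦X⟧ A PowerSeries.X * a = ħ • a := fun a => by
    rw [IsScalarTower.algebraMap_apply k⟦X⟧ S A, Algebra.smul_def]
  obtain ⟨Φ, hΦ, hΦ'⟩ := CompleteWeyl.exists_hom k n H.complete hK (x := x) (y := y)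
    (by
      have := H.χ_smul ħ H.ħ_mem 1
      rwa [← hX, mul_one] at this) hx hy h.xx h.yy (fun i j => by
      rw [← sub_eq_iff_eq_add', h.xy]
      split_ifs
      · rw [← hX, mul_one]
      · simp)
  have hΦt : (fun i => Φ (completeWeylTuple k n i)) = Fin.append x y := funext hΦ
  have hΦx : ∀ i, Φ (completeWeylTuple k n (Fin.castAdd n i)) = x i := fun i => by
    rw [hΦ, Fin.append_left]
  have hΦy : ∀ i, Φ (completeWeylTuple k n (Fin.natAdd n i)) = y i := fun i => by
    rw [hΦ, Fin.append_right]
  let D : Subalgebra k⟦X⟧ A := h.centralizer.restrictScalars k⟦X⟧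
  obtain ⟨iZ, hZ, e⟩ := nonempty_algEquiv_tensorProduct_center
    (CompleteWeyl.exists_eq_sum k n p) Φ D
    (fun w d hd => hΦ' d (h.mem_centralizer.mp hd).1 (h.mem_centralizer.mp hd).2 w)
    (fun z hz => h.mem_centralizer.mpr ⟨fun i => by
        rw [← hΦx]
        unfold Commute SemiconjBy
        rw [← map_mul, ← map_mul, Subalgebra.mem_center_iff.mp hz],
      fun i => by
        rw [← hΦy]
        unfold Commute SemiconjBy
        rw [← map_mul, ← map_mul, Subalgebra.mem_center_iff.mp hz]⟩)
    (fun c hc => by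
      rw [hΦt] at hc
      have h0 := (h.decomp hp2).map_eq_zero_iff.mp hc
      exact fun α => congrFun h0 α)
    (fun a => ⟨(h.decomp hp2).symm a, by
      rw [hΦt]
      exact ((h.decomp hp2).apply_symm_apply a).symm⟩)
  exact ⟨D, inferInstance, inferInstance, iZ, hZ, L, iL, iL', PL, h1, h2, h3, e⟩

/-! ### Ranks of skew-symmetric forms -/

theorem LinearMap.finrank_eq_of_ker_eq {k V W W' : Type*} [Field k] [AddCommGroup V] [Module k V]
    [AddCommGroup W] [Module k W] [AddCommGroup W'] [Module k W'] {R : Submodule k W} (f : V →ₗ[k] R)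
    (g : V →ₗ[k] W') (hf : Function.Surjective f) (hg : Function.Surjective g)
    (h : ∀ v, f v = 0 ↔ g v = 0) :
    Module.finrank k R = Module.finrank k W' :=
  ((f.quotKerEquivOfSurjective hf).symm ≪≫ₗ
    (Submodule.quotEquivOfEq (LinearMap.ker f) (LinearMap.ker g) (Submodule.ext h)) ≪≫ₗ
    (g.quotKerEquivOfSurjective hg)).finrank_eq

theorem Submodule.finrank_eq_of_bijective {k V W : Type*} [Field k] [AddCommGroup V] [Module k V]
    [AddCommGroup W] [Module k W] {R : Submodule k V} {R' : Submodule k W}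
    (G : R →ₗ[k] R') (hG : ∀ v, G v = 0 → v = 0) (hG' : Function.Surjective G) :
    Module.finrank k R = Module.finrank k R' :=
  (LinearEquiv.ofBijective G ⟨(injective_iff_map_eq_zero G).mpr hG, hG'⟩).finrank_eq

/-- The rank of a skew-symmetric form does not change under pullback along a map which is
surjective modulo the radical. -/
theorem LinearMap.finrank_range_eq_of_pullback {k V V' : Type*} [Field k] [AddCommGroup V]
    [Module k V] [AddCommGroup V'] [Module k V'] (φ : V →ₗ[k] V') (ω : V →ₗ[k] V →ₗ[k] k)
    (ω' : V' →ₗ[k] V' →ₗ[k] k) (hω : ∀ v w, ω' (φ v) (φ w) = ω v w)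
    (hskew : ∀ v w, ω' v w = -ω' w v) (hφ : ∀ v', ∃ v, ω' (v' - φ v) = 0) :
    Module.finrank k (LinearMap.range ω) = Module.finrank k (LinearMap.range ω') := by
  have h1 : ∀ f ∈ LinearMap.range ω', f ∘ₗ φ ∈ LinearMap.range ω := by
    rintro _ ⟨v', rfl⟩
    obtain ⟨v, hv⟩ := hφ v'
    rw [map_sub, sub_eq_zero] at hv
    refine ⟨v, ?_⟩
    ext w
    rw [hv, LinearMap.comp_apply, hω]
  let G : LinearMap.range ω' →ₗ[k] LinearMap.range ω :=
    ((LinearMap.lcomp k k φ).comp (Submodule.subtype _)).codRestrict _ (fun f => h1 f f.2)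
  refine (Submodule.finrank_eq_of_bijective G ?_ ?_).symm
  · rintro ⟨_, v', rfl⟩ hf
    apply Subtype.ext
    ext w'
    obtain ⟨w, hw⟩ := hφ w'
    have h2 : ω' v' (φ w) = 0 := congrArg (fun g => (g : V →ₗ[k] k) w) (congrArg Subtype.val hf)
    have h3 : ω' v' (w' - φ w) = 0 := by rw [hskew, hw]; simp
    rw [map_sub, h2, sub_zero] at h3
    exact h3
  · rintro ⟨_, v, rfl⟩
    refine ⟨⟨ω' (φ v), _, rfl⟩, Subtype.ext ?_⟩
    ext w
    exact hω v w

namespace PoissonBracket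

variable {k B : Type*} [Field k] [CommRing B] [Algebra k B] (P : PoissonBracket k B) (ev : B →ₐ[k] k)

/-- The form `(a, b) ↦ {a, b}(y)` at a rational point. -/
noncomputable def formAt : B →ₗ[k] B →ₗ[k] k :=
  LinearMap.mk₂ k (fun a b => ev (P.br a b))
    (fun a b c => by rw [map_add, Derivation.add_apply, map_add])
    (fun c a b => by rw [map_smul, Derivation.smul_apply, map_smul])
    (fun a b c => by rw [map_add, map_add])
    (fun c a b => by rw [(P.br a).map_smul c b, map_smul])

theorem formAt_apply (a b : B) : P.formAt ev a b = ev (P.br a b) := rfl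

theorem formAt_skew (a b : B) : P.formAt ev a b = -P.formAt ev b a := by
  rw [formAt_apply, P.skew, map_neg, formAt_apply]

theorem formAt_algebraMap_left (c : k) : P.formAt ev (algebraMap k B c) = 0 := by
  ext b
  rw [formAt_skew, formAt_apply, Derivation.map_algebraMap]
  simp

/-- At a point where the bracket is nondegenerate, the rank of the form is the dimension of the
cotangent space. -/
theorem finrank_range_formAt {m : Ideal B} (hm : RingHom.ker ev = m)
    (hP : P.IsNondegenerateAt m) :
    Module.finrank k (LinearMap.range (P.formAt ev)) = Module.finrank k m.Cotangent := by
  have hev : ∀ b, ev b = 0 ↔ b ∈ m := fun b => by rw [← hm, RingHom.mem_ker]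
  have hsub : ∀ b, b - algebraMap k B (ev b) ∈ m := fun b => by
    rw [← hev, map_sub, AlgHom.commutes]; simp
  have hzero : ∀ b, b ∈ m ^ 2 → P.formAt ev b = 0 := by
    intro b hb
    rw [pow_two] at hb
    refine Submodule.mul_induction_on hb ?_ (fun x y hx hy => by rw [map_add, hx, hy, add_zero])
    intro x hx y hy
    ext c
    rw [formAt_skew, formAt_apply, Derivation.leibniz, map_add, smul_eq_mul, smul_eq_mul, map_mul,
      map_mul, (hev x).mpr hx, (hev y).mpr hy]
    simp
  let F : m →ₗ[k] LinearMap.range (P.formAt ev) :=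
    ((P.formAt ev).comp (m.subtype.restrictScalars k)).codRestrict _ (fun b => ⟨b, rfl⟩)
  have hF : ∀ b : m, ((F b : LinearMap.range (P.formAt ev)) : B →ₗ[k] k) = P.formAt ev b :=
    fun _ => rfl
  let T : m →ₗ[k] m.Cotangent := m.toCotangent.restrictScalars k
  have hT : Function.Surjective T := m.toCotangent_surjective
  have hker : ∀ b, F b = 0 ↔ T b = 0 := by
    intro b
    change _ ↔ m.toCotangent b = 0
    rw [Ideal.toCotangent_eq_zero, Subtype.ext_iff, hF]
    constructor
    · intro h
      refine hP b b.2 fun g _ => (hev _).mp ?_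
      exact congrArg (fun f => f g) h
    · exact hzero b
  have hFs : Function.Surjective F := by
    rintro ⟨_, b, rfl⟩
    refine ⟨⟨_, hsub b⟩, Subtype.ext ?_⟩
    rw [hF, map_sub, formAt_algebraMap_left, sub_zero]
  exact LinearMap.finrank_eq_of_ker_eq F T hFs hT hker

end PoissonBracket

theorem IsAdicCompletionHom.pow_ker_mem {S : Type*} [CommRing S] {𝔫 : Ideal S} {k A C : Type*}
    [Field k] [Ring A] [Ring C] [Algebra S A] [Algebra S C] {π : A →ₐ[S] C}
    (h : IsAdicCompletionHom 𝔫 π) {χ : A →+* k} {χ' : C →+* k} (hχ : ∀ a, χ' (π a) = χ a)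
    (hχ' : ∀ c ∈ adicFil 𝔫 C 1, χ' c = 0) {K : ℕ}
    (hK : ∀ a ∈ RingHom.ker χ ^ K, a ∈ adicFil 𝔫 A 1) :
    ∀ c ∈ RingHom.ker χ' ^ K, c ∈ adicFil 𝔫 C 1 := by
  have key : ∀ N, ∀ c ∈ RingHom.ker χ' ^ N, ∃ a ∈ RingHom.ker χ ^ N, c - π a ∈ adicFil 𝔫 C 1 := by
    intro N
    induction N with
    | zero =>
      intro c _
      obtain ⟨a, ha⟩ := h.exists_sub_mem c 1
      exact ⟨a, by rw [Submodule.pow_zero, Ideal.one_eq_top]; trivial, ha⟩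
    | succ N ih =>
      intro c hc
      rw [Submodule.pow_succ] at hc
      refine Submodule.mul_induction_on hc ?_ ?_
      · intro c hc d hd
        obtain ⟨a, ha, hca⟩ := ih c hc
        obtain ⟨b, hdb⟩ := h.exists_sub_mem d 1
        refine ⟨a * b, ?_, mul_sub_mem hca hdb⟩
        rw [Submodule.pow_succ]
        refine Submodule.mul_mem_mul ha ?_
        have := hχ' _ hdb
        rw [map_sub, RingHom.mem_ker.mp hd, zero_sub, neg_eq_zero, hχ] at this
        exact this
      · rintro c d ⟨a, ha, hca⟩ ⟨b, hb, hdb⟩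
        refine ⟨a + b, add_mem ha hb, ?_⟩
        rw [map_add, add_sub_add_comm]
        exact add_mem hca hdb
  intro c hc
  obtain ⟨a, ha, hca⟩ := key K c hc
  have := add_mem hca (map_mem (π := π) (hK a ha))
  rwa [sub_add_cancel] at this

/-! ### Generators at a rational point -/

/-- Subtracting from algebra generators their values at the point keeps them generators of the
algebra and makes them generate the maximal ideal. Both properties of one family are needed:
finiteness over S and comparison of topologies. -/
theorem exists_generators_at_point {k B : Type*} [Field k] [CommRing B] [Algebra k B]
    [Algebra.FiniteType k B] (ev : B →ₐ[k] k) :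
    ∃ (r : ℕ) (b : Fin r → B), Algebra.adjoin k (Set.range b) = ⊤ ∧
      RingHom.ker ev = Ideal.span (Set.range b) := by
  obtain ⟨r, f, hf⟩ := Algebra.FiniteType.iff_quotient_mvPolynomial''.mp ‹Algebra.FiniteType k B›
  let b : Fin r → B := fun i => f (MvPolynomial.X i) - algebraMap k B (ev (f (MvPolynomial.X i)))
  have hadj : Algebra.adjoin k (Set.range b) = ⊤ := by
    rw [eq_top_iff, ← (AlgHom.range_eq_top f).mpr hf, ← Algebra.map_top, ← MvPolynomial.adjoin_range_X,
      AlgHom.map_adjoin, Algebra.adjoin_le_iff]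
    rintro _ ⟨_, ⟨i, rfl⟩, rfl⟩
    have h1 : f (MvPolynomial.X i) = b i + algebraMap k B (ev (f (MvPolynomial.X i))) := by
      simp [b]
    rw [SetLike.mem_coe, h1]
    exact add_mem (Algebra.subset_adjoin ⟨i, rfl⟩) (Subalgebra.algebraMap_mem _ _)
  refine ⟨r, b, hadj, le_antisymm ?_ ?_⟩
  · intro a ha
    have key : ∀ a : B, a - algebraMap k B (ev a) ∈ Ideal.span (Set.range b) := by
      intro a
      have ha : a ∈ Algebra.adjoin k (Set.range b) := hadj ▸ trivial
      refine Algebra.adjoin_induction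
        (p := fun a _ => a - algebraMap k B (ev a) ∈ Ideal.span (Set.range b)) ?_ ?_ ?_ ?_ ha
      · rintro _ ⟨i, rfl⟩
        have : ev (b i) = 0 := by simp [b]
        rw [this, map_zero, sub_zero]
        exact Ideal.subset_span ⟨i, rfl⟩
      · intro c
        rw [AlgHom.commutes]
        simp
      · intro x y _ _ hx hy
        rw [map_add, map_add, add_sub_add_comm]
        exact add_mem hx hy
      · intro x y _ _ hx hy
        have : x * y - algebraMap k B (ev (x * y)) = (x - algebraMap k B (ev x)) * y +
            algebraMap k B (ev x) * (y - algebraMap k B (ev y)) := by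
          rw [map_mul, map_mul]; ring
        rw [this]
        exact add_mem (Ideal.mul_mem_right _ _ hx) (Ideal.mul_mem_left _ _ hy)
    have := key a
    rwa [RingHom.mem_ker.mp ha, map_zero, sub_zero] at this
  · rw [Ideal.span_le]
    rintro _ ⟨i, rfl⟩
    simp [b, RingHom.mem_ker]

theorem exists_algHom_ker_eq {k B : Type*} [Field k] [IsAlgClosed k] [CommRing B] [Algebra k B]
    [Algebra.FiniteType k B] (m : Ideal B) [m.IsMaximal] : ∃ ev : B →ₐ[k] k, RingHom.ker ev = m := by
  let := Ideal.Quotient.field m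
  have hfin : Module.Finite k (B ⧸ m) := finite_of_finite_type_of_isJacobsonRing k (B ⧸ m)
  have hbij := IsAlgClosed.algebraMap_bijective_of_isIntegral (k := k) (K := B ⧸ m)
  let e : k ≃ₐ[k] B ⧸ m := AlgEquiv.ofBijective (Algebra.ofId k (B ⧸ m)) hbij
  refine ⟨(e.symm : B ⧸ m →ₐ[k] k).comp (Ideal.Quotient.mkₐ k m), ?_⟩
  ext b
  rw [RingHom.mem_ker, AlgHom.comp_apply]
  change e.symm (Ideal.Quotient.mk m b) = 0 ↔ _
  rw [map_eq_zero_iff _ e.symm.injective, Ideal.Quotient.eq_zero_iff_mem]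

/-! ### Completion of a quantization at a rational point -/

theorem finite_of_pow_generators {k S B : Type*} [Field k] [CommRing S] [Algebra k S] [CommRing B]
    [Algebra k B] [Algebra S B] [IsScalarTower k S B] {r p : ℕ} (hp : p ≠ 0) {b : Fin r → B}
    (hb : Algebra.adjoin k (Set.range b) = ⊤)
    (hpow : ∀ i, ∃ s, algebraMap S B s = b i ^ p) : Module.Finite S B := by
  have h1 : Algebra.FiniteType k B := ⟨⟨(Set.finite_range b).toFinset, by simpa using hb⟩⟩
  have h2 : Algebra.FiniteType S B := Algebra.FiniteType.of_restrictScalars_finiteType k S B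
  have h3 : Algebra.IsIntegral S B := ⟨fun a => by
    have ha : a ∈ Algebra.adjoin k (Set.range b) := hb ▸ trivial
    refine Algebra.adjoin_induction (p := fun a _ => IsIntegral S a) ?_ ?_ ?_ ?_ ha
    · rintro _ ⟨i, rfl⟩
      obtain ⟨s, hs⟩ := hpow i
      refine IsIntegral.of_pow (Nat.pos_of_ne_zero hp) ?_
      rw [← hs]
      exact isIntegral_algebraMap
    · intro c
      rw [IsScalarTower.algebraMap_apply k S B]
      exact isIntegral_algebraMap
    · intro x y _ _ hx hy
      exact hx.add hy
    · intro x y _ _ hx hy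
      exact hx.mul hy⟩
  exact Algebra.IsIntegral.finite

/-- All axioms of the local theory except completeness are checked on A over a polynomial ring
acting through central elements. The rank of the form is then compared along B ← A → completion. -/
theorem Quantization.exists_tensor_decomposition {p : ℕ} [hp : Fact p.Prime] (hp2 : 2 < p)
    {k : Type u} [Field k] [IsAlgClosed k] [CharP k p]
    {B : Type v} [CommRing B] [Algebra k B] [Algebra.FiniteType k B]
    {P : PoissonBracket k B} {A : Type w} [Ring A] [Algebra k⟦X⟧ A]
    (Q : Quantization P A) (hQ : IsWeaklyCentral p k A) (ev : B →ₐ[k] k) {m : Ideal B}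
    (hm : RingHom.ker ev = m) {n : ℕ}
    (hn : Module.finrank k (LinearMap.range (P.formAt ev)) = n + n) :
    ∃ (Aplus : Type w) (_ : Ring Aplus) (_ : Algebra k⟦X⟧ Aplus)
      (_ : Algebra (Subalgebra.center k⟦X⟧ (CompleteWeyl k n)) Aplus)
      (_ : IsScalarTower k⟦X⟧ (Subalgebra.center k⟦X⟧ (CompleteWeyl k n)) Aplus)
      (L : Type w) (_ : CommRing L) (_ : Algebra k L) (PL : PoissonBracket k L),
      PL.IsCompleteLocal ∧
      Nonempty (Quantization PL Aplus) ∧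
      IsWeaklyCentral p k Aplus ∧
      Nonempty (adicCompletionAlg k⟦X⟧ (Ideal.comap Q.ρ m) ≃ₐ[k⟦X⟧]
        CompleteWeyl k n ⊗[Subalgebra.center k⟦X⟧ (CompleteWeyl k n)] Aplus) := by
  obtain ⟨r, b, hb, hmb⟩ := exists_generators_at_point ev
  have hev : ∀ c, ev c = 0 ↔ c ∈ m := fun c => by rw [← hm, RingHom.mem_ker]
  choose a ha using fun i => Q.ρ_surjective (b i)
  choose a' ha' using fun i => hQ (a i)
  -- Central lifts of b i ^ p supplied by weak centrality; the variables of S act through them.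
  set z : Fin r → A := fun i => a i ^ p - (PowerSeries.X : k⟦X⟧) ^ (p - 1) • a' i with hz
  have hzc : ∀ i, z i ∈ Subalgebra.center k⟦X⟧ A := ha'
  let S := MvPolynomial (Fin r) k⟦X⟧
  let iS : Algebra S A := centralAction z hzc
  have tS : IsScalarTower k⟦X⟧ S A := centralAction_isScalarTower z hzc
  let ik : Algebra k A := Algebra.compHom A (algebraMap k k⟦X⟧)
  have tk : IsScalarTower k k⟦X⟧ A := IsScalarTower.of_algebraMap_eq fun _ => rfl
  have tkS : IsScalarTower k S A := IsScalarTower.of_algebraMap_eq fun c => by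
    rw [IsScalarTower.algebraMap_apply k k⟦X⟧ A, IsScalarTower.algebraMap_apply k k⟦X⟧ S,
      ← IsScalarTower.algebraMap_apply k⟦X⟧ S A]
  set ħ : S := algebraMap k⟦X⟧ S PowerSeries.X with hħ
  set 𝔫 : Ideal S := fullIdeal k (Fin r) with h𝔫
  have hħ𝔫 : ħ ∈ 𝔫 := Ideal.subset_span (Set.mem_insert _ _)
  have hX𝔫 : ∀ i, (MvPolynomial.X i : S) ∈ 𝔫 := fun i =>
    Ideal.subset_span (Set.mem_insert_of_mem _ ⟨i, rfl⟩)
  have hXħ : ∀ c : A, (PowerSeries.X : k⟦X⟧) • c = ħ • c := fun c =>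
    (algebraMap_smul S (PowerSeries.X : k⟦X⟧) c).symm
  have hXz : ∀ i, algebraMap S A (MvPolynomial.X i) = z i := centralAction_algebraMap_X z hzc
  have hρħ : ∀ c : A, Q.ρ (ħ • c) = 0 := fun c => by
    rw [← hXħ]; exact (Q.ρ_eq_zero_iff _).mpr ⟨c, rfl⟩
  have hρ0 : ∀ c : A, Q.ρ c = 0 → ∃ d, c = ħ • d := fun c hc => by
    obtain ⟨d, hd⟩ := (Q.ρ_eq_zero_iff c).mp hc
    exact ⟨d, by rw [hd, hXħ]⟩
  have hρz : ∀ i, Q.ρ (z i) = b i ^ p := fun i => by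
    have h1 : Q.ρ ((PowerSeries.X : k⟦X⟧) ^ (p - 1) • a' i) = 0 := by
      refine (Q.ρ_eq_zero_iff _).mpr ⟨(PowerSeries.X : k⟦X⟧) ^ (p - 2) • a' i, ?_⟩
      rw [smul_smul, ← pow_succ', show p - 2 + 1 = p - 1 by omega]
    rw [hz, map_sub, h1, sub_zero, map_pow, ha]
  have hρk : ∀ c : k, Q.ρ (algebraMap k A c) = algebraMap k B c := fun c => by
    rw [IsScalarTower.algebraMap_apply k k⟦X⟧ A, Q.ρ_algebraMap]
    rfl
  have hac : AlmostComm ħ A :=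
    { torsionFree := fun c hc => Q.torsionFree c (by rw [hXħ]; exact hc)
      exists_comm := fun c d => hρ0 _ (by rw [map_sub, map_mul, map_mul, mul_comm, sub_self]) }
  let χ : A →ₐ[k] k := { (ev : B →+* k).comp Q.ρ with
    commutes' := fun c => by
      change ev (Q.ρ (algebraMap k A c)) = c
      rw [hρk, AlgHom.commutes]
      rfl }
  have hχ : ∀ c, χ c = ev (Q.ρ c) := fun _ => rfl
  set J := Ideal.comap Q.ρ m with hJ
  have hJχ : ∀ c, c ∈ J ↔ χ c = 0 := fun c => by rw [hχ, hev]; rfl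
  let I' : Ideal B := Ideal.span (Set.range fun i => b i ^ p)
  -- As ħ ∈ 𝔫, the ideal 𝔫A is the preimage of the ideal generated by the b i ^ p. Questions about
  -- 𝔫A thus become questions in the commutative ring B.
  have hF : ∀ c, c ∈ adicFil 𝔫 A 1 ↔ Q.ρ c ∈ I' := by
    intro c
    constructor
    · intro hc
      refine adicFil_induction (P := fun c => Q.ρ c ∈ I') ?_ ?_ hc
      · intro s hs c
        rw [Algebra.smul_def, map_mul]
        refine Ideal.mul_mem_right _ _ ?_
        have hle : 𝔫 ≤ I'.comap (Q.ρ.comp (algebraMap S A)) := by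
          rw [h𝔫, fullIdeal, Ideal.span_le]
          rintro _ (rfl | ⟨i, rfl⟩)
          · have : Q.ρ (algebraMap S A ħ) = 0 := by
              rw [Algebra.algebraMap_eq_smul_one, hρħ]
            change Q.ρ (algebraMap S A ħ) ∈ I'
            rw [this]; exact zero_mem _
          · change Q.ρ (algebraMap S A (MvPolynomial.X i)) ∈ I'
            rw [hXz, hρz]
            exact Ideal.subset_span ⟨i, rfl⟩
        exact hle (by simpa using hs)
      · intro x _ y _ hx hy
        rw [map_add]; exact add_mem hx hy
    · intro hc
      have h1 : ∀ d ∈ I', ∃ c ∈ adicFil 𝔫 A 1, Q.ρ c = d := by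
        intro d hd
        refine Submodule.span_induction (p := fun d _ => ∃ c ∈ adicFil 𝔫 A 1, Q.ρ c = d)
          ?_ ⟨0, zero_mem _, map_zero _⟩ ?_ ?_ hd
        · rintro _ ⟨i, rfl⟩
          refine ⟨z i, ?_, hρz i⟩
          rw [← hXz, Algebra.algebraMap_eq_smul_one]
          exact smul_mem_adicFil (by simpa using hX𝔫 i) _
        · rintro _ _ _ _ ⟨c, hc, rfl⟩ ⟨d, hd, rfl⟩
          exact ⟨c + d, add_mem hc hd, map_add _ _ _⟩
        · rintro e _ _ ⟨c, hc, rfl⟩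
          obtain ⟨e, rfl⟩ := Q.ρ_surjective e
          exact ⟨e * c, mul_mem_adicFil_right e hc, map_mul _ _ _⟩
      obtain ⟨d, hd, hdc⟩ := h1 _ hc
      obtain ⟨e, he⟩ := hρ0 (c - d) (by rw [map_sub, hdc, sub_self])
      rw [← sub_add_cancel c d, he]
      exact add_mem (smul_mem_adicFil (by simpa using hħ𝔫) _) hd
  have hbm : ∀ i, b i ∈ m := fun i => by
    rw [← hm, hmb]; exact Ideal.subset_span ⟨i, rfl⟩
  have hle : ∀ c ∈ adicFil 𝔫 A 1, c ∈ J := by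
    intro c hc
    have : I' ≤ m := by
      rw [Ideal.span_le]
      rintro _ ⟨i, rfl⟩
      exact Ideal.pow_mem_of_mem _ (hbm i) _ hp.out.pos
    exact this ((hF c).mp hc)
  obtain ⟨K, hK⟩ : ∃ K, ∀ c ∈ J ^ K, c ∈ adicFil 𝔫 A 1 := by
    obtain ⟨K, hK⟩ := exists_pow_mem_of_le_radical Q.ρ (J := J) (J' := m) (I' := I')
      (fun _ h => h) (by rw [← hm, hmb]; exact Submodule.fg_span (Set.finite_range _)) (by
        rw [← hm, hmb, Ideal.span_le]
        rintro _ ⟨i, rfl⟩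
        exact ⟨p, Ideal.subset_span ⟨i, rfl⟩⟩)
    exact ⟨K, fun c hc => (hF c).mpr (hK c hc)⟩
  have hBnt : Nontrivial B := ev.toRingHom.domain_nontrivial
  have hBp : CharP B p := charP_of_injective_algebraMap (algebraMap k B).injective p
  have hpow : ∀ c, χ c = 0 → c ^ p ∈ adicFil 𝔫 A 1 := by
    intro c hc
    rw [hF, map_pow]
    have : m ≤ I'.comap (frobenius B p) := by
      rw [← hm, hmb, Ideal.span_le]
      rintro _ ⟨i, rfl⟩
      exact Ideal.subset_span ⟨i, rfl⟩
    exact this ((hJχ c).mpr hc)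
  have hwc : ∀ c : A, NearlyCentral ħ 𝔫 p 0 (c ^ p) := by
    intro c
    obtain ⟨c', hc'⟩ := hQ c
    refine ⟨_, hc', c', by simp [adicFil], ?_⟩
    have : (PowerSeries.X : k⟦X⟧) ^ (p - 1) • c' = ħ ^ (p - 1) • c' := by
      rw [hħ, ← map_pow, algebraMap_smul]
    rw [← this, sub_add_cancel]
  -- B is finite over S because its generators have p-th powers in the image of S; lifts of module
  -- generators generate A modulo ħ, which suffices for Artin–Rees.
  obtain ⟨N, g, hg⟩ : ∃ (N : ℕ) (g : Fin N → A), ∀ c : A, ∃ (s : Fin N → S) (d : A),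
      c = ∑ i, s i • g i + ħ • d := by
    let iB : Algebra S B := (Q.ρ.comp (algebraMap S A)).toAlgebra
    have tB : IsScalarTower k S B := IsScalarTower.of_algebraMap_eq fun c => by
      change _ = Q.ρ (algebraMap S A (algebraMap k S c))
      rw [← IsScalarTower.algebraMap_apply, hρk]
    have hfin : Module.Finite S B := finite_of_pow_generators hp.out.ne_zero hb
      (fun i => ⟨MvPolynomial.X i, by
        change Q.ρ (algebraMap S A (MvPolynomial.X i)) = _
        rw [hXz, hρz]⟩)
    obtain ⟨N, e, he⟩ := Module.Finite.exists_fin (R := S) (M := B)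
    choose g hg using fun i => Q.ρ_surjective (e i)
    refine ⟨N, g, fun c => ?_⟩
    have hc : Q.ρ c ∈ Submodule.span S (Set.range e) := he ▸ trivial
    obtain ⟨s, hs⟩ := (Submodule.mem_span_range_iff_exists_fun S).mp hc
    obtain ⟨d, hd⟩ := hρ0 (c - ∑ i, s i • g i) (by
      rw [map_sub, ← hs, map_sum, sub_eq_zero]
      refine Finset.sum_congr rfl fun i _ => ?_
      rw [Algebra.smul_def (s i) (g i), map_mul, hg, Algebra.smul_def]
      rfl)
    exact ⟨s, d, by rw [← hd]; abel⟩
  have hfin : Module.Finite k (A ⧸ adicFil 𝔫 A 1) := by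
    let G : (Fin N → k) →ₗ[k] A ⧸ adicFil 𝔫 A 1 :=
      (((adicFil 𝔫 A 1).mkQ).restrictScalars k).comp (Fintype.linearCombination k g)
    refine Module.Finite.of_surjective G fun c => ?_
    obtain ⟨c, rfl⟩ := Submodule.mkQ_surjective _ c
    obtain ⟨s, d, rfl⟩ := hg c
    choose t ht using fun i => exists_sub_mem_fullIdeal (s i)
    refine ⟨t, ?_⟩
    change (adicFil 𝔫 A 1).mkQ (Fintype.linearCombination k g t) = _
    rw [← sub_eq_zero, ← map_sub, Submodule.mkQ_apply, Submodule.Quotient.mk_eq_zero,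
      Fintype.linearCombination_apply, ← sub_sub, ← Finset.sum_sub_distrib]
    refine sub_mem (sum_mem fun i _ => ?_) (smul_mem_adicFil (by simpa using hħ𝔫) _)
    rw [← algebraMap_smul S (t i) (g i), ← sub_smul]
    refine smul_mem_adicFil ?_ _
    rw [pow_one, ← neg_sub]
    exact neg_mem (ht i)
  have hAR := exists_smul_mem_adicFil_imp 𝔫
    (fun c hc => AlmostComm.torsionFree (ħ := ħ) (A := A) c hc) g hg
  have hπ := isAdicCompletionHom_toAdicCompletionAlg (fullIdeal_fg k (Fin r)) hle hK
  let C := adicCompletionAlg S J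
  let χ₁ : A ⧸ J ^ 1 →+* k := Ideal.Quotient.lift (J ^ 1) (χ : A →+* k) (fun c hc =>
    (hJχ c).mp (Ideal.pow_le_self one_ne_zero hc))
  let χ' : C →ₐ[k] k :=
    { χ₁.comp ((Pi.evalRingHom (fun n => A ⧸ J ^ n) 1).comp C.val.toRingHom) with
      commutes' := fun c => χ.commutes c }
  have hχπ : ∀ c, χ' (toAdicCompletionAlg S J c) = χ c := fun _ => rfl
  have hχs : ∀ s ∈ 𝔫, ∀ c, χ' (s • c) = 0 := by
    intro s hs c
    obtain ⟨d, hd⟩ := Ideal.Quotient.mk_surjective (c.1 1)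
    have h1 : χ' (s • c) = χ₁ (s • c.1 1) := rfl
    have h2 : s • c.1 1 = Ideal.Quotient.mk (J ^ 1) (s • d) := by rw [← hd]; rfl
    rw [h1, h2]
    exact (hJχ _).mp (hle _ (smul_mem_adicFil (by simpa using hs) d))
  have H := hπ.isLocalQuantum hp2 χ χ' hχπ hħ𝔫 hχs hAR hwc hpow hfin
  have hCac := H.almostComm
  have hKC :=
    hπ.pow_ker_mem (χ := (χ : A →+* k)) (χ' := (χ' : C →+* k)) hχπ
      (fun c hc => H.χ_adicFil le_rfl hc) (fun c hc => hK c (by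
        have : RingHom.ker (χ : A →+* k) = J := by
          ext c; exact (hJχ c).symm
        rwa [this] at hc))
  have hπhbr : ∀ c d : A, toAdicCompletionAlg S J (hbr ħ c d) =
      hbr ħ (toAdicCompletionAlg S J c) (toAdicCompletionAlg S J d) := fun c d =>
    (hbr_unique (by rw [← map_mul, ← map_mul, ← map_sub, ← smul_hbr ħ c d, map_smul])).symm
  have hrank : Module.finrank k (LinearMap.range (IsLocalQuantum.residueForm ħ χ')) = n + n := by
    rw [← hn]
    have e1 := LinearMap.finrank_range_eq_of_pullback
      ((toAdicCompletionAlg S J).toLinearMap.restrictScalars k)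
      (IsLocalQuantum.residueForm ħ χ) (IsLocalQuantum.residueForm ħ χ')
      (fun c d => by
        change χ' (hbr ħ (toAdicCompletionAlg S J c) (toAdicCompletionAlg S J d)) = χ (hbr ħ c d)
        rw [← hπhbr, hχπ])
      IsLocalQuantum.residueForm_skew
      (fun c => by
        obtain ⟨d, hd⟩ := hπ.exists_sub_mem c 1
        refine ⟨d, ?_⟩
        ext e
        exact H.χ_adicFil le_rfl (hbr_mem_adicFil_left ħ e hd))
    have hQb : ∀ c d, P.br (Q.ρ c) (Q.ρ d) = Q.ρ (hbr ħ c d) := fun c d =>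
      Q.bracket c d _ (by rw [hXħ, smul_hbr])
    let ρ' : A →ₗ[k] B :=
      { toFun := Q.ρ
        map_add' := map_add Q.ρ
        map_smul' := fun c d => by
          rw [Algebra.smul_def, map_mul, hρk, ← Algebra.smul_def]; rfl }
    have e2 := LinearMap.finrank_range_eq_of_pullback ρ'
      (IsLocalQuantum.residueForm ħ χ) (P.formAt ev)
      (fun c d => by
        change ev (P.br (Q.ρ c) (Q.ρ d)) = χ (hbr ħ c d)
        rw [hQb]; rfl)
      (P.formAt_skew ev)
      (fun c => by
        obtain ⟨d, rfl⟩ := Q.ρ_surjective c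
        exact ⟨d, by
          change P.formAt ev (Q.ρ d - Q.ρ d) = 0
          rw [sub_self, map_zero]⟩)
    exact e1.symm.trans e2
  obtain ⟨Ap, i1, i2, i3, i4, L, i5, i6, PL, h1, h2, h3, ⟨e⟩⟩ :=
    H.exists_tensor_decomposition hp2 hKC hrank
  exact ⟨Ap, i1, i2, i3, i4, L, i5, i6, PL, h1, h2, h3,
    ⟨(adicCompletionAlgEquiv k⟦X⟧ S J).trans e⟩⟩

/-! ### Cotangent spaces at rational points and Kähler differentials -/

section Cotangent

variable (k : Type*) [Field k]

/-- The map 𝔪/𝔪² → k ⊗ Ω is onto because Ω of k over k vanishes. It is injective because the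
derivation c ↦ c - c(pt) modulo 𝔪² provides a left inverse. -/
theorem finrank_cotangent_ker_algebraMap (C : Type*) [CommRing C] [Algebra k C] [Algebra C k]
    [IsScalarTower k C k] :
    Module.finrank k (RingHom.ker (algebraMap C k)).Cotangent =
      Module.finrank k (k ⊗[C] Ω[C⁄k]) := by
  set m := RingHom.ker (algebraMap C k) with hm
  have hs : Function.Surjective (algebraMap C k) := fun a => ⟨algebraMap k C a, by
    rw [← IsScalarTower.algebraMap_apply]; rfl⟩
  have hmem : ∀ c : C, c - algebraMap k C (algebraMap C k c) ∈ m := fun c => by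
    rw [hm, RingHom.mem_ker, map_sub, ← IsScalarTower.algebraMap_apply]
    simp
  let f := KaehlerDifferential.kerCotangentToTensor k C k
  have hsurj : Function.Surjective f := by
    intro x
    refine (KaehlerDifferential.exact_kerCotangentToTensor_mapBaseChange k C k hs x).mp ?_
    exact Subsingleton.elim _ _
  let s : C →ₗ[k] m :=
    { toFun := fun c => ⟨c - algebraMap k C (algebraMap C k c), hmem c⟩
      map_add' := fun a b => by ext; simp; ring
      map_smul' := fun a b => by
        ext
        simp only [Algebra.smul_def, map_mul, RingHom.id_apply, Submodule.coe_smul_of_tower]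
        rw [← IsScalarTower.algebraMap_apply k C k]
        simp; ring }
  have hscal : ∀ (c : C) (x : m.Cotangent), c • x = algebraMap k C (algebraMap C k c) • x := by
    intro c x
    obtain ⟨x, rfl⟩ := m.toCotangent_surjective x
    rw [← sub_eq_zero, ← sub_smul, ← map_smul, Ideal.toCotangent_eq_zero, pow_two]
    exact Ideal.mul_mem_mul (hmem c) x.2
  let d : Derivation k C m.Cotangent := Derivation.mk' ((m.toCotangent.restrictScalars k).comp s)
    (by
      intro a b
      simp only [LinearMap.comp_apply, LinearMap.restrictScalars_apply]
      rw [← m.toCotangent.map_smul a, ← m.toCotangent.map_smul b, ← map_add, ← sub_eq_zero,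
        ← map_sub, Ideal.toCotangent_eq_zero, pow_two]
      convert neg_mem (Ideal.mul_mem_mul (hmem a) (hmem b)) using 1
      simp [s]
      ring)
  have hinj : Function.Injective f := by
    let g : k ⊗[C] Ω[C⁄k] →+ m.Cotangent := TensorProduct.liftAddHom
      ((AddMonoidHom.flip (AddMonoidHom.mk' (fun w => (smulAddHom k m.Cotangent).flip
        (d.liftKaehlerDifferential w)) (fun a b => by ext; simp))))
      (by
        intro c a w
        change (c • a) • d.liftKaehlerDifferential w = a • d.liftKaehlerDifferential (c • w)
        rw [map_smul, hscal, algebraMap_smul, Algebra.smul_def, mul_smul, smul_comm])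
    have hg : ∀ x, g (f x) = x := by
      intro x
      obtain ⟨x, rfl⟩ := m.toCotangent_surjective x
      change (1 : k) • d.liftKaehlerDifferential (KaehlerDifferential.D k C x) = _
      rw [one_smul, Derivation.liftKaehlerDifferential_comp_D]
      change m.toCotangent (s x) = _
      congr 1
      ext
      have : algebraMap C k (x : C) = 0 := x.2
      simp [s, this]
    exact Function.LeftInverse.injective hg
  exact LinearEquiv.finrank_eq
    ((LinearEquiv.ofBijective f ⟨hinj, hsurj⟩).restrictScalars k)

theorem finrank_tensor_kaehler_of_formallyEtale (S T : Type*) [CommRing S] [CommRing T]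
    [Algebra k S] [Algebra k T] [Algebra S T] [IsScalarTower k S T] [Algebra S k] [Algebra T k]
    [IsScalarTower S T k] [Algebra.FormallyEtale S T] :
    Module.finrank k (k ⊗[S] Ω[S⁄k]) = Module.finrank k (k ⊗[T] Ω[T⁄k]) := by
  have e1 : k ⊗[T] (T ⊗[S] Ω[S⁄k]) ≃ₗ[k] k ⊗[S] Ω[S⁄k] :=
    TensorProduct.AlgebraTensorModule.cancelBaseChange S T k k _
  have e2 : k ⊗[T] (T ⊗[S] Ω[S⁄k]) ≃ₗ[k] k ⊗[T] Ω[T⁄k] :=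
    TensorProduct.AlgebraTensorModule.congr (LinearEquiv.refl k k)
      (KaehlerDifferential.tensorKaehlerEquivOfFormallyEtale k S T)
  exact (e1.symm.trans e2).finrank_eq

theorem finrank_tensor_kaehler_mvPolynomial (r : ℕ) [Algebra (MvPolynomial (Fin r) k) k] :
    Module.finrank k (k ⊗[MvPolynomial (Fin r) k] Ω[MvPolynomial (Fin r) k⁄k]) = r := by
  have := Module.Free.of_basis (KaehlerDifferential.mvPolynomialBasis k (Fin r))
  rw [Module.finrank_baseChange,
    Module.finrank_eq_card_basis (KaehlerDifferential.mvPolynomialBasis k (Fin r)),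
    Fintype.card_fin]

end Cotangent

/-! ### Dimension of étale algebras over polynomial rings -/

section Height

variable {k : Type*} [Field k]

/-- Induction on variables: the contraction of M to one variable fewer is again maximal by the
Jacobson property, and M has height one more than it. -/
theorem MvPolynomial.height_eq_of_isMaximal (r : ℕ) (M : Ideal (MvPolynomial (Fin r) k))
    [M.IsMaximal] : M.height = r := by
  induction r with
  | zero =>
    have h1 : M.height ≤ (0 : ℕ) := by
      have h := Ideal.height_le_ringKrullDim_of_ne_top (I := M) (Ideal.IsMaximal.ne_top ‹_›)
      rw [MvPolynomial.ringKrullDim_of_isNoetherianRing, ringKrullDim_eq_zero_of_field] at h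
      simpa using h
    simpa using h1
  | succ r ih =>
    let e := (MvPolynomial.finSuccEquiv k r).toRingEquiv
    have h1 : (M.comap e.symm).IsMaximal := Ideal.comap_isMaximal_of_equiv e.symm
    rw [← RingEquiv.height_comap e.symm M]
    have h2 : ((M.comap e.symm).comap Polynomial.C).IsMaximal :=
      Polynomial.isMaximal_comap_C_of_isJacobsonRing _
    have h3 : (M.comap e.symm).LiesOver ((M.comap e.symm).comap Polynomial.C) := ⟨rfl⟩
    rw [Polynomial.height_eq_height_add_one ((M.comap e.symm).comap Polynomial.C), ih]
    simp

/-- Étale maps are quasi-finite, so distinct comparable primes have distinct contractions, and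
chains map to strict chains in affine space. -/
theorem height_le_of_etale_mvPolynomial (k : Type*) [Field k] {r : ℕ} {T : Type*} [CommRing T]
    [Algebra (MvPolynomial (Fin r) k) T] [Algebra.Etale (MvPolynomial (Fin r) k) T] (Q : Ideal T) [hQ : Q.IsPrime] : Q.height ≤ r := by
  let S := MvPolynomial (Fin r) k
  have hmono : StrictMono (PrimeSpectrum.comap (algebraMap S T)) := by
    intro P Q hPQ
    refine lt_of_le_of_ne (Ideal.comap_mono hPQ.le) fun h => hPQ.ne ?_
    ext1
    exact Algebra.QuasiFinite.eq_of_le_of_under_eq (R := S) _ _ hPQ.le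
      (congrArg PrimeSpectrum.asIdeal h)
  have h1 : ringKrullDim T ≤ ringKrullDim S := Order.krullDim_le_of_strictMono _ hmono
  rw [MvPolynomial.ringKrullDim_of_isNoetherianRing, ringKrullDim_eq_zero_of_field] at h1
  have h2 := (Ideal.height_le_ringKrullDim_of_ne_top (I := Q) hQ.ne_top).trans h1
  rw [zero_add, Nat.card_fin] at h2
  exact_mod_cast h2

/-- The lower bound comes from going-down, available because étale maps are flat. -/
theorem height_eq_of_etale_mvPolynomial {r : ℕ} {T : Type*} [CommRing T]
    [Algebra (MvPolynomial (Fin r) k) T] [Algebra.Etale (MvPolynomial (Fin r) k) T] (Q : Ideal T) [Q.IsPrime]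
    [(Q.under (MvPolynomial (Fin r) k)).IsMaximal] : Q.height = r := by
  refine le_antisymm (height_le_of_etale_mvPolynomial k Q) ?_
  have : IsNoetherianRing T :=
    Algebra.FiniteType.isNoetherianRing (MvPolynomial (Fin r) k) T
  rw [Ideal.height_eq_height_add_of_liesOver_of_hasGoingDown
    (Q.under (MvPolynomial (Fin r) k)) Q, MvPolynomial.height_eq_of_isMaximal]
  exact le_self_add

end Height

/-! ### Dimension of smooth open subsets of affine varieties -/

section SmoothChart

variable {k : Type*} [Field k] [IsAlgClosed k] {C : Type*} [CommRing C] [Algebra k C]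

theorem exists_algHom_apply_ne_zero [Algebra.FiniteType k C] {q : Ideal C} [hq : q.IsPrime] {f : C}
    (hf : f ∉ q) : ∃ ev : C →ₐ[k] k, ev f ≠ 0 := by
  have hnt : Nontrivial (Localization.Away f) := by
    rw [← not_subsingleton_iff_nontrivial, IsLocalization.subsingleton_iff (M := .powers f)]
    rintro ⟨n, hn⟩
    exact hf (hq.mem_of_pow_mem n (by rw [show f ^ n = 0 from hn]; exact q.zero_mem))
  have hft : Algebra.FiniteType k (Localization.Away f) :=
    Algebra.FiniteType.trans (S := C) inferInstance inferInstance
  obtain ⟨M, hM⟩ := Ideal.exists_maximal (Localization.Away f)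
  obtain ⟨ev, -⟩ := exists_algHom_ker_eq (k := k) M
  refine ⟨ev.comp (IsScalarTower.toAlgHom k C (Localization.Away f)), ?_⟩
  have h1 : IsUnit (ev (algebraMap C (Localization.Away f) f)) :=
    (IsLocalization.Away.algebraMap_isUnit f).map ev
  exact h1.ne_zero

omit [IsAlgClosed k] in
-- Near a smooth point the variety is étale over affine r-space. Étale maps preserve heights at
-- rational points and the fibre of Ω there, so height and cotangent dimension are both r.
theorem Algebra.IsSmoothAt.exists_chart [Algebra.FiniteType k C] (q : Ideal C) [q.IsPrime]
    [Algebra.IsSmoothAt k q] :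
    ∃ f ∉ q, ∃ r : ℕ, (∀ q' : Ideal C, q'.IsPrime → f ∉ q' → q'.height ≤ r) ∧
      ∀ ev : C →ₐ[k] k, ev f ≠ 0 → (RingHom.ker ev).height = r ∧
        Module.finrank k (RingHom.ker ev).Cotangent = r := by
  have hfp : Algebra.FinitePresentation k C := Algebra.FinitePresentation.of_finiteType.mp ‹_›
  obtain ⟨f, hf, r, i1, i2, i3⟩ :=
    Algebra.IsSmoothAt.exists_isStandardEtale_mvPolynomial (R := k) (p := q)
  let S := MvPolynomial (Fin r) k
  let T := Localization.Away f
  have het : Algebra.Etale S T := inferInstance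
  refine ⟨f, hf, r, fun q' hq' hfq' => ?_, fun ev hev => ?_⟩
  · have hd : Disjoint (Submonoid.powers f : Set C) q' :=
      (Ideal.disjoint_powers_iff_notMem_of_isPrime f).mpr hfq'
    have hp : (q'.map (algebraMap C T)).IsPrime :=
      IsLocalization.isPrime_of_isPrime_disjoint (.powers f) T q' hq' hd
    have h1 : (q'.map (algebraMap C T)).under C = q' :=
      IsLocalization.under_map_of_isPrime_disjoint (.powers f) T hq' hd
    rw [← h1, IsLocalization.height_under (.powers f)]
    exact height_le_of_etale_mvPolynomial k _
  · let ev' : T →ₐ[k] k := IsLocalization.liftAlgHom (M := .powers f) (f := ev) (by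
      rintro ⟨_, n, rfl⟩
      simpa using hev.isUnit.pow n)
    have hev' : ∀ c, ev' (algebraMap C T c) = ev c := fun c => by
      simp [ev', T]
    let a1 : Algebra C k := ev.toRingHom.toAlgebra
    let a2 : Algebra T k := ev'.toRingHom.toAlgebra
    let a3 : Algebra S k := (ev'.toRingHom.comp (algebraMap S T)).toAlgebra
    have t1 : IsScalarTower k C k := IsScalarTower.of_algebraMap_eq fun c => (ev.commutes c).symm
    have t2 : IsScalarTower k T k := IsScalarTower.of_algebraMap_eq fun c => (ev'.commutes c).symm
    have t3 : IsScalarTower S T k := IsScalarTower.of_algebraMap_eq fun c => rfl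
    have t4 : IsScalarTower C T k := IsScalarTower.of_algebraMap_eq fun c => (hev' c).symm
    have t5 : IsScalarTower k S k := IsScalarTower.of_algebraMap_eq fun c => by
      rw [IsScalarTower.algebraMap_apply S T k, ← IsScalarTower.algebraMap_apply k S T,
        ← IsScalarTower.algebraMap_apply k T k]
    constructor
    · have hk : RingHom.ker ev = (RingHom.ker ev').under C := by
        ext c
        change ev c = 0 ↔ ev' (algebraMap C T c) = 0
        rw [hev']
      have hp : (RingHom.ker ev').IsPrime := RingHom.ker_isPrime ev'
      have hmax : ((RingHom.ker ev').under S).IsMaximal := by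
        have : (RingHom.ker ev').under S = RingHom.ker (algebraMap S k) := rfl
        rw [this]
        refine RingHom.ker_isMaximal_of_surjective _ fun c => ⟨algebraMap k S c, ?_⟩
        rw [← IsScalarTower.algebraMap_apply]; rfl
      rw [hk, IsLocalization.height_under (.powers f)]
      exact height_eq_of_etale_mvPolynomial (k := k) _
    · have h1 := finrank_cotangent_ker_algebraMap k C
      rw [finrank_tensor_kaehler_of_formallyEtale k C T,
        ← finrank_tensor_kaehler_of_formallyEtale k S T,
        finrank_tensor_kaehler_mvPolynomial] at h1
      exact h1

end SmoothChart

/-! ### Krull dimension of open subsets of a spectrum -/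

section OpenDimension

open TopologicalSpace PrimeSpectrum

variable {C : Type*} [CommRing C] {U : Set (PrimeSpectrum C)}

theorem PrimeSpectrum.coheight_closure_singleton (q : PrimeSpectrum C)
    (Z : IrreducibleCloseds (PrimeSpectrum C)) (hZ : (Z : Set (PrimeSpectrum C)) = closure {q}) :
    Order.coheight Z = q.asIdeal.height := by
  have h1 : Z = OrderDual.ofDual (PrimeSpectrum.pointsEquivIrreducibleCloseds C q) := by
    ext1
    rw [hZ]
    rfl
  rw [h1, ← Order.height_toDual, OrderDual.toDual_ofDual, Order.height_orderIso]
  exact PrimeSpectrum.height_eq_orderHeight q |>.symm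

/-- The length of a chain of irreducible closed subsets is at most the coheight of its smallest
member. This is the height of the generic point of its closure in the spectrum, and that point lies
in U because U is open. -/
theorem PrimeSpectrum.topologicalKrullDim_le_of_height_le (hU : IsOpen U) {d : ℕ}
    (h : ∀ q ∈ U, q.asIdeal.height ≤ d) : topologicalKrullDim U ≤ d := by
  have hemb := hU.isOpenEmbedding_subtypeVal
  refine iSup_le fun l => ?_
  have h1 : (l.length : ℕ∞) ≤ Order.coheight l.head := Order.length_le_coheight_head
  rw [← hemb.coheight_map] at h1
  set Z := IrreducibleCloseds.map Subtype.val hemb.continuous l.head with hZ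
  obtain ⟨x, hx⟩ := l.head.isIrreducible.nonempty
  have hxZ : (x : PrimeSpectrum C) ∈ (Z : Set (PrimeSpectrum C)) :=
    subset_closure ⟨x, hx, rfl⟩
  obtain ⟨q, hq⟩ := QuasiSober.sober Z.isIrreducible Z.isClosed
  have hqU : q ∈ U := by
    have : q ⤳ x := hq.specializes hxZ
    exact this.mem_open hU x.2
  rw [PrimeSpectrum.coheight_closure_singleton q Z hq.def.symm] at h1
  exact_mod_cast h1.trans (h q hqU)

theorem PrimeSpectrum.height_le_topologicalKrullDim (hU : IsOpen U) {q : PrimeSpectrum C}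
    (hq : q ∈ U) : (q.asIdeal.height : WithBot ℕ∞) ≤ topologicalKrullDim U := by
  have hemb := hU.isOpenEmbedding_subtypeVal
  let Z : IrreducibleCloseds U := ⟨closure {⟨q, hq⟩}, isIrreducible_singleton.closure, isClosed_closure⟩
  have h1 := Order.coheight_le_krullDim Z
  rw [← hemb.coheight_map, PrimeSpectrum.coheight_closure_singleton q _ (by
    change closure (Subtype.val '' closure {(⟨q, hq⟩ : U)}) = _
    rw [closure_image_closure hemb.continuous, Set.image_singleton])] at h1
  exact h1

end OpenDimension

/-- The chart dimension r is locally constant, hence constant on the connected set U. It bounds all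
heights in U and is attained at the given rational point, so it equals both the Krull dimension of U
and the cotangent dimension. -/
theorem finrank_cotangent_eq_of_isSmoothAt {k : Type*} [Field k] [IsAlgClosed k] {C : Type*}
    [CommRing C] [Algebra k C] [Algebra.FiniteType k C] {U : Set (PrimeSpectrum C)}
    (hU : IsOpen U) (hc : IsConnected U) (hs : ∀ q ∈ U, Algebra.IsSmoothAt k q.asIdeal) {d : ℕ}
    (hd : topologicalKrullDim U = (d : WithBot ℕ∞)) (ev : C →ₐ[k] k) {q : PrimeSpectrum C}
    (hq : q ∈ U) (hev : RingHom.ker ev = q.asIdeal) :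
    Module.finrank k q.asIdeal.Cotangent = d := by
  have hch : ∀ q : U, ∃ f ∉ q.1.asIdeal, ∃ r : ℕ,
      (∀ q' : Ideal C, q'.IsPrime → f ∉ q' → q'.height ≤ r) ∧
      ∀ ev : C →ₐ[k] k, ev f ≠ 0 → (RingHom.ker ev).height = r ∧
        Module.finrank k (RingHom.ker ev).Cotangent = r := fun q => by
    have := hs q.1 q.2
    exact Algebra.IsSmoothAt.exists_chart q.1.asIdeal
  choose f hf r hr hr' using hch
  have hlc : IsLocallyConstant r := by
    refine (IsLocallyConstant.iff_exists_open r).mpr fun x =>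
      ⟨Subtype.val ⁻¹' (PrimeSpectrum.basicOpen (f x) : Set (PrimeSpectrum C)),
        (PrimeSpectrum.basicOpen (f x)).isOpen.preimage continuous_subtype_val, hf x,
        fun y hy => ?_⟩
    -- Two overlapping charts share a rational point, where both numbers equal the same cotangent
    -- dimension.
    have hfy : f x * f y ∉ y.1.asIdeal := fun h =>
      (y.1.isPrime.mem_or_mem h).elim hy (hf y)
    obtain ⟨e, he⟩ := exists_algHom_apply_ne_zero (k := k) hfy
    rw [map_mul] at he
    exact (hr' y e (right_ne_zero_of_mul he)).2.symm.trans (hr' x e (left_ne_zero_of_mul he)).2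
  have hconn : ConnectedSpace U := isConnected_iff_connectedSpace.mp hc
  have hconst : ∀ x, r x = r ⟨q, hq⟩ := fun x =>
    hlc.apply_eq_of_isPreconnected isPreconnected_univ trivial trivial
  have hfev : ev (f ⟨q, hq⟩) ≠ 0 := fun h => hf ⟨q, hq⟩ (by
    change f ⟨q, hq⟩ ∈ q.asIdeal
    rw [← hev]; exact h)
  obtain ⟨h1, h2⟩ := hr' ⟨q, hq⟩ ev hfev
  rw [hev] at h1 h2
  have hle := PrimeSpectrum.topologicalKrullDim_le_of_height_le hU (d := r ⟨q, hq⟩) fun q' hq' =>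
    (hr ⟨q', hq'⟩ _ q'.isPrime (hf ⟨q', hq'⟩)).trans (by rw [hconst])
  have hge := PrimeSpectrum.height_le_topologicalKrullDim hU hq
  rw [h1] at hge
  rw [h2]
  have := le_antisymm hle hge
  rw [hd] at this
  exact_mod_cast this.symm

/-! ### The Poisson form at a point of a symplectic subvariety -/

theorem PrimeSpectrum.range_comap_mk_vanishingIdeal {B : Type*} [CommRing B]
    (Y : Set (PrimeSpectrum B)) :
    Set.range (PrimeSpectrum.comap (Ideal.Quotient.mk (PrimeSpectrum.vanishingIdeal Y))) =
      closure Y := by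
  rw [range_comap_of_surjective _ _ Ideal.Quotient.mk_surjective, Ideal.mk_ker,
    PrimeSpectrum.zeroLocus_vanishingIdeal_eq_closure]

theorem PrimeSpectrum.isOpen_preimage_comap_mk_vanishingIdeal {B : Type*} [CommRing B]
    {Y : Set (PrimeSpectrum B)} (hY : IsLocallyClosed Y) :
    IsOpen (PrimeSpectrum.comap (Ideal.Quotient.mk (PrimeSpectrum.vanishingIdeal Y)) ⁻¹' Y) := by
  obtain ⟨V, hV, hVY⟩ : ∃ V, IsOpen V ∧ Y = V ∩ closure Y := by
    obtain ⟨V, Z, hV, hZ, rfl⟩ := hY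
    refine ⟨V, hV, Set.Subset.antisymm (Set.subset_inter Set.inter_subset_left subset_closure) ?_⟩
    exact Set.inter_subset_inter_right _ (closure_minimal Set.inter_subset_right hZ)
  have h : PrimeSpectrum.comap (Ideal.Quotient.mk (PrimeSpectrum.vanishingIdeal Y)) ⁻¹' Y =
      PrimeSpectrum.comap (Ideal.Quotient.mk (PrimeSpectrum.vanishingIdeal Y)) ⁻¹' V := by
    ext q
    have hq : PrimeSpectrum.comap (Ideal.Quotient.mk (PrimeSpectrum.vanishingIdeal Y)) q ∈
        closure Y :=
      (PrimeSpectrum.range_comap_mk_vanishingIdeal Y).le ⟨q, rfl⟩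
    exact ⟨fun h => (hVY.le h).1, fun h => hVY.ge ⟨h, hq⟩⟩
  rw [h]
  exact hV.preimage (PrimeSpectrum.continuous_comap _)

/-- The form factors through functions on the closure of Y, whose ideal is Poisson. Nondegeneracy
there identifies its rank with the cotangent dimension at the point. This is dim Y, since Y is
homeomorphic to a smooth connected open subset of the spectrum of that quotient. -/
theorem PoissonBracket.IsSymplecticSubvariety.finrank_range_formAt {k : Type*} [Field k]
    [IsAlgClosed k] {B : Type*} [CommRing B] [Algebra k B] [Algebra.FiniteType k B]
    {P : PoissonBracket k B} {Y : Set (PrimeSpectrum B)} (hY : P.IsSymplecticSubvariety Y)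
    (ev : B →ₐ[k] k) {y : PrimeSpectrum B} (hev : RingHom.ker ev = y.asIdeal) (hy : y ∈ Y) {d : ℕ}
    (hd : topologicalKrullDim Y = (d : WithBot ℕ∞)) :
    Module.finrank k (LinearMap.range (P.formAt ev)) = d := by
  obtain ⟨hlc, hconn, hI, hsm, hnd⟩ := hY
  set I := PrimeSpectrum.vanishingIdeal Y with hIdef
  set g := PrimeSpectrum.comap (Ideal.Quotient.mk I) with hg
  have hemb : Topology.IsClosedEmbedding g :=
    PrimeSpectrum.isClosedEmbedding_comap_of_surjective _ _ Ideal.Quotient.mk_surjective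
  have himg : g '' (g ⁻¹' Y) = Y :=
    Set.image_preimage_eq_of_subset
      (subset_closure.trans (PrimeSpectrum.range_comap_mk_vanishingIdeal Y).ge)
  have hIy : I ≤ RingHom.ker ev := by
    rw [hev]
    intro b hb
    exact (PrimeSpectrum.mem_vanishingIdeal Y b).mp hb y hy
  let evC : (B ⧸ I) →ₐ[k] k := Ideal.Quotient.liftₐ I ev fun b hb => hIy hb
  have hevC : ∀ b, evC (Ideal.Quotient.mk I b) = ev b := fun b => rfl
  have hmax : (RingHom.ker evC).IsMaximal :=
    RingHom.ker_isMaximal_of_surjective _ fun c => ⟨algebraMap k _ c, evC.commutes c⟩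
  let q : MaximalSpectrum (B ⧸ I) := ⟨RingHom.ker evC, hmax⟩
  have hgq : g q.toPrimeSpectrum = y := by
    ext b
    rw [← hev]
    rfl
  have hqU : q.toPrimeSpectrum ∈ g ⁻¹' Y := by
    rw [Set.mem_preimage, hgq]; exact hy
  have hUd : topologicalKrullDim (g ⁻¹' Y) = (d : WithBot ℕ∞) := by
    rw [← hd]
    refine IsHomeomorph.topologicalKrullDim_eq (Y.restrictPreimage g) ?_
    rw [isHomeomorph_iff_isEmbedding_surjective]
    refine ⟨hemb.isEmbedding.restrictPreimage Y, fun x => ?_⟩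
    obtain ⟨z, hz, hzx⟩ := himg.ge x.2
    exact ⟨⟨z, hz⟩, Subtype.ext hzx⟩
  have hUc : IsConnected (g ⁻¹' Y) := by
    rw [← himg] at hconn
    exact ⟨hconn.nonempty.of_image, hemb.isInducing.isPreconnected_image.mp hconn.isPreconnected⟩
  have hfin : Algebra.FiniteType k (B ⧸ I) :=
    Algebra.FiniteType.of_surjective (Ideal.Quotient.mkₐ k I) Ideal.Quotient.mk_surjective
  have h1 : Module.finrank k (RingHom.ker evC).Cotangent = d :=
    finrank_cotangent_eq_of_isSmoothAt (q := q.toPrimeSpectrum)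
      (PrimeSpectrum.isOpen_preimage_comap_mk_vanishingIdeal hlc) hUc hsm hUd evC hqU rfl
  have h2 := PoissonBracket.finrank_range_formAt (P := P.quotient I hI) (ev := evC)
    (m := RingHom.ker evC) rfl (hnd q hqU)
  rw [← h1, ← h2]
  refine LinearMap.finrank_range_eq_of_pullback (Ideal.Quotient.mkₐ k I).toLinearMap
    (P.formAt ev) ((P.quotient I hI).formAt evC) (fun a b => rfl)
    ((P.quotient I hI).formAt_skew evC) fun c => ?_
  obtain ⟨c, rfl⟩ := Ideal.Quotient.mk_surjective c
  exact ⟨c, by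
    change (P.quotient I hI).formAt evC (Ideal.Quotient.mk I c - Ideal.Quotient.mk I c) = 0
    rw [sub_self, map_zero]⟩

/-! ### The splitting theorem at a point of a symplectic leaf -/

theorem theorem1 (p : ℕ) (hp : p.Prime) (hp2 : 2 < p)
    (k : Type u) [Field k] [IsAlgClosed k] [CharP k p]
    (B : Type v) [CommRing B] [Algebra k B] [Algebra.FiniteType k B]
    (P : PoissonBracket k B)
    (A : Type w) [Ring A] [Algebra k⟦X⟧ A]
    (Q : Quantization P A) (hQ : IsWeaklyCentral p k A)
    (y : MaximalSpectrum B)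
    (Y : Set (PrimeSpectrum B)) (hY : P.IsSymplecticLeaf Y) (hyY : y.toPrimeSpectrum ∈ Y)
    (n : ℕ) (hn : topologicalKrullDim Y = ((2 * n : ℕ) : WithBot ℕ∞)) :
    ∃ (Aplus : Type w) (_ : Ring Aplus) (_ : Algebra k⟦X⟧ Aplus)
      (_ : Algebra (Subalgebra.center k⟦X⟧ (CompleteWeyl k n)) Aplus)
      (_ : IsScalarTower k⟦X⟧ (Subalgebra.center k⟦X⟧ (CompleteWeyl k n)) Aplus)
      (L : Type w) (_ : CommRing L) (_ : Algebra k L) (PL : PoissonBracket k L),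
      PL.IsCompleteLocal ∧
      Nonempty (Quantization PL Aplus) ∧
      IsWeaklyCentral p k Aplus ∧
      Nonempty (adicCompletionAlg k⟦X⟧ (Ideal.comap Q.ρ y.asIdeal) ≃ₐ[k⟦X⟧]
        CompleteWeyl k n ⊗[Subalgebra.center k⟦X⟧ (CompleteWeyl k n)] Aplus) := by
  have : Fact p.Prime := ⟨hp⟩
  obtain ⟨ev, hev⟩ := exists_algHom_ker_eq (k := k) y.asIdeal
  refine Q.exists_tensor_decomposition hp2 hQ ev hev ?_
  rw [← two_mul]
  exact hY.prop.finrank_range_formAt ev hev hyY hn
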